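/- Let $L>0$, let $\mathbb T=[-L,L]$ be the torus (end points identified), let $\alpha\in\mathbb R$, $T>0$ and $s\ge 5$. Write $u_l=\pi l/L$, and for $r\ge0$ let $\|f\|_{H^r}^2=2L\sum_{l\in\mathbb Z}(1+u_l^2)^r|\hat f_l|^2$, where $\hat f_l$ are the Fourier coefficients of $f$ on $\mathbb T$. Elements of $H^r(\mathbb T)$, $r\ge1$, are identified with their continuous representatives. **Data.** Let $\psi_{in}\in H^s(\mathbb T)$ be complex-valued, let $v_0,v_1,v_2,\dots$ be real-valued continuous functions on $\mathbb T$, and let $\lambda_1>\lambda_2>\dots>0$. Put $U=[-\frac12,\frac12]^{\mathbb N}$, $U_m=[-\frac12,\frac12]^m$, $$V(\boldsymbol\xi,x)=v_0(x)+\sum_{j=1}^\infty\sqrt{\lambda_j}\,\xi_jv_j(x)\quad(\boldsymbol\xi\in U),\qquad V_m(\xi,x)=v_0(x)+\sum_{j=1}^m\sqrt{\lambda_j}\,\xi_jv_j(x)\quad(\xi\in U_m),$$ where the series converges uniformly in $x$ for every $\boldsymbol\xi\in U$. Assume that 1. $\sup_{\boldsymbol\xi\in U}\|V(\boldsymbol\xi)\|_{H^s}<\infty$,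 and $\sup_{\xi\in U_m}\|V_m(\xi)\|_{H^s}\le\sup_{\boldsymbol\xi\in U}\|V(\boldsymbol\xi)\|_{H^s}$ for all $m\geq 1$; 2. there are constants $C',\chi>0$ with $\sup_{\boldsymbol\xi\in U}\|V_m(\boldsymbol\xi_{\{1:m\}})-V(\boldsymbol\xi)\|_{H^1}\le C'm^{-\chi}$ for all $m\ge1$, and $\sum_{j\ge1}\big[3^j\sqrt{\lambda_j}\,\|v_j\|_{H^1}\big]^{1/2}<\infty$. **Equation.** For $m\in\mathbb N$ and $\xi\in U_m$ let $\psi_m(\cdot,\xi,\cdot)\in C([0,T];H^1(\mathbb T))$ be the (weak) solution of the truncated problem $$i\partial_t\psi_m=-\tfrac12\partial_x^2\psi_m+V_m(\xi,x)\psi_m+\alpha|\psi_m|^2\psi_m,\qquad \psi_m(0,\xi,x)=\psi_{in}(x).$$ **Scheme.** For an even integer $M>0$ and a step $\tau>0$ let $h=2L/M$, $x_k=-L+kh$ ($0\le k<M$), $t_n=n\tau$. For a grid function $\phi$ let $\widetilde\phi_l=\frac1M\sum_{k=0}^{M-1}\phi_ke^{-iu_l(x_k+L)}$ and $I_M\phi(x)=\sum_{l=-M/2}^{M/2-1}\widetilde\phi_l\,e^{iu_l(x+L)}$.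 The Strang time-splitting Fourier pseudospectral solution $\psi_m^n=(\psi^n_{m,k})_k$ is defined by $\psi^0_{m,k}=\psi_{in}(x_k)$ and, for $n\ge0$, $$\psi^{*}_{m,k}=\sum_{l=-M/2}^{M/2-1}e^{-iu_l^2\tau/4}\,\widetilde{(\psi_m^n)}_l\,e^{iu_l(x_k+L)},\qquad \psi^{**}_{m,k}=e^{-i[V_m(\xi,x_k)+\alpha|\psi^{*}_{m,k}|^2]\tau}\psi^{*}_{m,k},$$ $$\psi^{n+1}_{m,k}=\sum_{l=-M/2}^{M/2-1}e^{-iu_l^2\tau/4}\,\widetilde{(\psi_m^{**})}_l\,e^{iu_l(x_k+L)}.$$ **Claim.** There exist constants $\tau_0,h_0,C>0$, independent of $m$, $\xi$, $\tau$ and $h$, such that for all $m\in\mathbb N$, $\xi\in U_m$, all $0<\tau\le\tau_0$, all even $M>0$ with $h\le h_0$, and all $n\ge0$ with $t_n\le T$, $$\|I_M\psi_m^n-\psi_m(t_n,\xi,\cdot)\|_{H^1}\le C(\tau^2+h^{s-1}).$$ -/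

import Mathlib

open scoped ENNReal ContDiff Topology

noncomputable section

namespace RandomNLS

/-! ### The torus and its Sobolev norms -/

/-- The torus `𝕋 = [-L, L]` with its end points identified. -/
abbrev Torus (L : ℝ) : Type := AddCircle (2 * L)

instance factTwoMulPos (L : ℝ) [h : Fact (0 < L)] : Fact (0 < 2 * L) :=
  ⟨mul_pos two_pos h.out⟩

/-- The frequency `u_l = π l / L`. -/
def freq (L : ℝ) (l : ℤ) : ℝ := Real.pi * l / L

/-- The `H^s(𝕋)` norm of an (integrable) function on the torus,
`‖f‖_{H^s}^2 = 2L ∑_l (1 + u_l^2)^s |f̂_l|^2`, with value `∞` when `f ∉ H^s`.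
(`fourierCoeff` is taken with respect to the normalized measure on the torus; with the factor `2L`
the norm for `s = 0` is the `L^2(-L, L)` norm, and `‖f‖_{H^1}^2 = ‖f‖_{L^2}^2 + ‖f'‖_{L^2}^2`.) -/
def sobolevNorm {L : ℝ} [Fact (0 < L)] (s : ℝ) (f : Torus L → ℂ) : ℝ≥0∞ :=
  (ENNReal.ofReal (2 * L) *
    ∑' l : ℤ, ENNReal.ofReal ((1 + freq L l ^ 2) ^ s * ‖fourierCoeff f l‖ ^ 2)) ^ (1 / 2 : ℝ)

/-- The `H^s(𝕋)` norm of a real-valued function. -/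
def sobolevNormReal {L : ℝ} [Fact (0 < L)] (s : ℝ) (f : Torus L → ℝ) : ℝ≥0∞ :=
  sobolevNorm s (fun x => (f x : ℂ))

/-! ### The random potential

The components `v_1, v_2, …`, the strengths `λ_1, λ_2, …` and the parameters `ξ_1, ξ_2, …` are
indexed from `0`: `v j`, `lam j`, `ξ j` stand for `v_{j+1}`, `λ_{j+1}`, `ξ_{j+1}`. -/

/-- The parameter set `U = [-1/2, 1/2]^ℕ`. -/
def paramSet : Set (ℕ → ℝ) := {ξ | ∀ j, ξ j ∈ Set.Icc (-(1 / 2) : ℝ) (1 / 2)}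

/-- The truncated parameter set `U_m = [-1/2, 1/2]^m`. -/
def paramSetTrunc (m : ℕ) : Set (Fin m → ℝ) := {ξ | ∀ j, ξ j ∈ Set.Icc (-(1 / 2) : ℝ) (1 / 2)}

/-- The truncated potential `V_m(ξ, x) = v_0(x) + ∑_{j=1}^m √λ_j ξ_j v_j(x)`. -/
def truncPotential {L : ℝ} (v₀ : C(Torus L, ℝ)) (lam : ℕ → ℝ) (v : ℕ → C(Torus L, ℝ))
    (m : ℕ) (ξ : Fin m → ℝ) : C(Torus L, ℝ) :=
  v₀ + ∑ j : Fin m, (Real.sqrt (lam j) * ξ j) • v j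

/-- `V(ξ, x) = v_0(x) + ∑_{j=1}^∞ √λ_j ξ_j v_j(x)` for every `ξ ∈ U`, the series converging
uniformly in `x`. -/
def IsPotential {L : ℝ} (v₀ : C(Torus L, ℝ)) (lam : ℕ → ℝ) (v : ℕ → C(Torus L, ℝ))
    (V : (ℕ → ℝ) → C(Torus L, ℝ)) : Prop :=
  ∀ ξ ∈ paramSet, HasSum (fun j => (Real.sqrt (lam j) * ξ j) • v j) (V ξ - v₀)

/-- The assumptions on the data: the Karhunen–Loève form of the potential with positive, strictly
decreasing strengths; the `H^s` regularity of the initial value and, uniformly in the parameter, of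
the potential; the rate of the dimension truncation; and the decay of the terms of the series.
Elements of `H^s(𝕋)`, `s ≥ 1`, are represented by continuous functions. -/
structure DataAssumptions {L : ℝ} [Fact (0 < L)] (s : ℝ) (ψin : C(Torus L, ℂ))
    (v₀ : C(Torus L, ℝ)) (lam : ℕ → ℝ) (v : ℕ → C(Torus L, ℝ))
    (V : (ℕ → ℝ) → C(Torus L, ℝ)) : Prop where
  lam_pos : ∀ j, 0 < lam j
  lam_anti : StrictAnti lam
  isPotential : IsPotential v₀ lam v V
  initial_mem : sobolevNorm s ψin < ⊤
  potential_mem : (⨆ ξ ∈ paramSet, sobolevNormReal s (V ξ)) < ⊤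
  trunc_le : ∀ m : ℕ, 0 < m →
    (⨆ ξ ∈ paramSetTrunc m, sobolevNormReal s (truncPotential v₀ lam v m ξ)) ≤
      ⨆ ξ ∈ paramSet, sobolevNormReal s (V ξ)
  trunc_rate : ∃ C > (0 : ℝ), ∃ χ > (0 : ℝ), ∀ m : ℕ, 0 < m →
    (⨆ ξ ∈ paramSet, sobolevNormReal 1 (truncPotential v₀ lam v m (fun j => ξ j) - V ξ)) ≤
      ENNReal.ofReal (C * (m : ℝ) ^ (-χ))
  decay : ∑' j : ℕ, (ENNReal.ofReal (3 ^ (j + 1) * Real.sqrt (lam j)) *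
    sobolevNormReal 1 (v j)) ^ (1 / 2 : ℝ) < ⊤

/-! ### The nonlinear Schrödinger equation -/

/-- `ψ ∈ C([0, T]; H^1(𝕋))` solves `i ∂_t ψ = -½ ∂_x² ψ + W ψ + α |ψ|² ψ` on `[0, T]` with
`ψ(0) = ψin`, the equation being tested in space against the smooth `2L`-periodic functions. -/
structure IsNLSSolution {L : ℝ} [Fact (0 < L)] (α T : ℝ) (W : C(Torus L, ℝ))
    (ψin : C(Torus L, ℂ)) (ψ : ℝ → C(Torus L, ℂ)) : Prop where
  mem : ∀ t ∈ Set.Icc 0 T, sobolevNorm 1 (ψ t) < ⊤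
  cont : ∀ t ∈ Set.Icc 0 T,
    Filter.Tendsto (fun r => sobolevNorm 1 (ψ r - ψ t)) (𝓝[Set.Icc 0 T] t) (𝓝 0)
  initial : ψ 0 = ψin
  eqn : ∀ φ : ℝ → ℂ, ContDiff ℝ ∞ φ → Function.Periodic φ (2 * L) → ∀ t ∈ Set.Icc 0 T,
    HasDerivWithinAt (fun r => ∫ x in (-L)..L, ψ r (x : Torus L) * φ x)
      (-Complex.I * ∫ x in (-L)..L,
        (-(1 / 2) * ψ t (x : Torus L) * iteratedDeriv 2 φ x +
          ((W (x : Torus L) : ℂ) * ψ t (x : Torus L) +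
            (α : ℂ) * (‖ψ t (x : Torus L)‖ : ℂ) ^ 2 * ψ t (x : Torus L)) * φ x))
      (Set.Icc 0 T) t

/-! ### The time-splitting Fourier pseudospectral scheme

Grid functions live on `x_0, …, x_{M-1}`; on the torus `x_M` is the point `x_0`. -/

/-- The grid point `x_k = -L + k h`, `h = 2L / M`. -/
def gridPoint (L : ℝ) (M : ℕ) (k : Fin M) : ℝ := -L + (k : ℕ) * (2 * L / M)

/-- The discrete modes `l = -M/2, …, M/2 - 1` (`M` even). -/
def modes (M : ℕ) : Finset ℤ := Finset.Ico (-((M : ℤ) / 2)) ((M : ℤ) / 2)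

/-- The discrete Fourier coefficient `(1/M) ∑_{k=0}^{M-1} φ_k e^{-i u_l (x_k + L)}`. -/
def discreteCoeff (L : ℝ) {M : ℕ} (φ : Fin M → ℂ) (l : ℤ) : ℂ :=
  (1 / (M : ℂ)) * ∑ k : Fin M,
    φ k * Complex.exp (-Complex.I * ((freq L l * (gridPoint L M k + L) : ℝ) : ℂ))

/-- The kinetic half step: multiplication of the `l`-th discrete Fourier coefficient by
`e^{-i u_l² τ / 4}`. -/
def kineticHalfStep (L τ : ℝ) {M : ℕ} (φ : Fin M → ℂ) : Fin M → ℂ := fun k =>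
  ∑ l ∈ modes M, Complex.exp (-Complex.I * ((freq L l ^ 2 * τ / 4 : ℝ) : ℂ)) *
    discreteCoeff L φ l * Complex.exp (Complex.I * ((freq L l * (gridPoint L M k + L) : ℝ) : ℂ))

/-- The potential step: pointwise multiplication by `e^{-i [W(x_k) + α |φ_k|²] τ}`. -/
def potentialStep {L : ℝ} (α τ : ℝ) (W : C(Torus L, ℝ)) {M : ℕ} (φ : Fin M → ℂ) :
    Fin M → ℂ := fun k =>
  Complex.exp (-Complex.I *
    (((W (gridPoint L M k : Torus L) + α * ‖φ k‖ ^ 2) * τ : ℝ) : ℂ)) * φ k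

/-- The numerical solution `(ψ^n_k)_k` of the Strang splitting scheme with potential `W`. -/
def tsfp {L : ℝ} (α τ : ℝ) (W : C(Torus L, ℝ)) (ψin : C(Torus L, ℂ)) (M : ℕ) :
    ℕ → Fin M → ℂ
  | 0 => fun k => ψin (gridPoint L M k : Torus L)
  | n + 1 => kineticHalfStep L τ
      (potentialStep α τ W (kineticHalfStep L τ (tsfp α τ W ψin M n)))

/-- The trigonometric interpolant `I_M φ (x) = ∑_l φ̃_l e^{i u_l (x + L)}` on the torus;
`fourier l x = e^{i u_l x}`. -/
def interp {L : ℝ} {M : ℕ} (φ : Fin M → ℂ) : Torus L → ℂ := fun x =>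
  ∑ l ∈ modes M, discreteCoeff L φ l * fourier l (x + ((L : ℝ) : Torus L))

end RandomNLS

end

open RandomNLS

/-!
The estimate is that of a second order splitting scheme combined with a spectral discretization; the
parameter `ξ` enters only through bounds for the potential in `H^s(𝕋)`, and the assumptions on the
data make these uniform in `m` and `ξ` (`DataAssumptions.truncPotential_le`).

**Function spaces.** Everything takes place in the algebra `HOne L` of continuous functions whose
Fourier coefficients lie in the weighted space `ℓ²((1 + u_l²)^{1/2})`. Norm estimates in `H^σ` are
relations `SobBound σ f B`, resting on the product inequality for weighted convolutions
(`SobBound.mul`, and its tame form `SeqBound.mul_tame`).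

**Uniform regularity of the exact solution.** A weak solution satisfies Duhamel's formula
coefficient by coefficient (`IsNLSSolution.isMild`). By the tame estimate the cubic nonlinearity is
bounded in `H^s` linearly in the `H^s` norm once the `H¹` norm is controlled; a Gronwall argument,
run with truncated weights for which all norms are finite, then propagates `H^s` regularity
(`exists_persistence`). As the weak solution is `H^5`, its mass and energy are conserved
(`IsMild.mass_eq`, `IsMild.energy_eq`); conservation follows because both change by `O(τ²)` over
time steps of length `τ`. The quartic part of the energy is absorbed by interpolation between `L²`
and `H¹` (`exists_sum_norm_le_add`), which gives an `H¹` bound depending only on the data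
(`exists_apriori`), and a second use of persistence makes the `H^s` bound uniform too.

**Local error.** Duhamel's formula writes `ψ(t + τ) - S(τ) ψ(t)`, with `S` the free flow, as the
integral over `[0, τ]` of `r ↦ S(τ - r) N(ψ(t + r))`, with `N` the nonlinearity. Each time
derivative costs two derivatives in space, so on solutions bounded in `H^5` this integrand has
second differences of order `r²` in `H¹` (`exists_secondBound`); this is where `s ≥ 5` is used.
Hence the midpoint rule is exact up to `O(τ³)` (`IsMild.midpoint`). The potential step changes
`S(τ/2) ψ(t)` by an increment that the midpoint rule also evaluates up to `O(τ³)`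
(`exists_stepIncr_midpoint`), and at the midpoint the two arguments of `N` differ by `O(τ²)`. Thus
one step of the splitting has error `O(τ³)` (`exists_local_error`).

**Global error.** On the grid the potential step is followed by trigonometric interpolation, whose
error in `H¹` is `O(h^{s-1})` by aliasing (`SobBound.interpolate_sub_proj`). Applied to the
potential step minus the identity, whose `H^s` size is `O(τ)`, it contributes `O(τ h^{s-1})` per
step. The step map is Lipschitz on bounded sets of `H¹` with constant `1 + O(τ)`, and the induction
in `exists_global_error` sums the errors and keeps the numerical solution bounded in `H¹`.
-/

namespace RandomNLS

open MeasureTheory Filter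

/-! ### Weighted `ℓ²` bounds for sequences of Fourier coefficients -/

/-- `SeqBound w a B` says that the weighted `ℓ²` norm `(∑ (w l ‖a l‖)²)^(1/2)` is at most `B`.
Working with the relation rather than with the norm makes summability part of every bound. -/
def SeqBound (w : ℤ → ℝ) (a : ℤ → ℂ) (B : ℝ) : Prop :=
  0 ≤ B ∧ ∀ F : Finset ℤ, ∑ l ∈ F, (w l * ‖a l‖) ^ 2 ≤ B ^ 2

theorem SeqBound.nonneg {w : ℤ → ℝ} {a : ℤ → ℂ} {B : ℝ} (h : SeqBound w a B) : 0 ≤ B := h.1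

theorem SeqBound.mono {w : ℤ → ℝ} {a : ℤ → ℂ} {B B' : ℝ} (h : SeqBound w a B) (hB : B ≤ B') :
    SeqBound w a B' :=
  ⟨h.1.trans hB, fun F => (h.2 F).trans (pow_le_pow_left₀ h.1 hB 2)⟩

theorem SeqBound.term_le {w : ℤ → ℝ} {a : ℤ → ℂ} {B : ℝ} (h : SeqBound w a B) (l : ℤ) :
    w l * ‖a l‖ ≤ B := by
  have := h.2 {l}
  simp only [Finset.sum_singleton] at this
  exact abs_le_of_sq_le_sq' this h.1 |>.2

/-- Comparison of bounds: termwise domination up to a constant factor. -/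
theorem SeqBound.of_le {w w' : ℤ → ℝ} {a b : ℤ → ℂ} {A k : ℝ} (h : SeqBound w a A) (hk : 0 ≤ k)
    (hw' : ∀ l, 0 ≤ w' l) (hab : ∀ l, w' l * ‖b l‖ ≤ k * (w l * ‖a l‖)) :
    SeqBound w' b (k * A) := by
  refine ⟨mul_nonneg hk h.1, fun F => ?_⟩
  calc ∑ l ∈ F, (w' l * ‖b l‖) ^ 2 ≤ ∑ l ∈ F, (k * (w l * ‖a l‖)) ^ 2 :=
        Finset.sum_le_sum fun l _ => pow_le_pow_left₀ (mul_nonneg (hw' l) (norm_nonneg _)) (hab l) 2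
    _ = k ^ 2 * ∑ l ∈ F, (w l * ‖a l‖) ^ 2 := by
        rw [Finset.mul_sum]; exact Finset.sum_congr rfl fun l _ => by ring
    _ ≤ k ^ 2 * A ^ 2 := mul_le_mul_of_nonneg_left (h.2 F) (sq_nonneg k)
    _ = (k * A) ^ 2 := by ring

/-- Minkowski's inequality in a form convenient for termwise estimates. -/
theorem SeqBound.of_le_add {w w₁ w₂ : ℤ → ℝ} {a b c : ℤ → ℂ} {A B : ℝ} (ha : SeqBound w₁ a A)
    (hb : SeqBound w₂ b B) (hw : ∀ l, 0 ≤ w l)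
    (h : ∀ l, w l * ‖c l‖ ≤ w₁ l * ‖a l‖ + w₂ l * ‖b l‖) : SeqBound w c (A + B) := by
  refine ⟨add_nonneg ha.1 hb.1, fun F => ?_⟩
  set x : ℤ → ℝ := fun l => w₁ l * ‖a l‖
  set y : ℤ → ℝ := fun l => w₂ l * ‖b l‖
  have h1 : (∑ l ∈ F, x l * y l) ^ 2 ≤ (A * B) ^ 2 := by
    rw [mul_pow]
    exact (Finset.sum_mul_sq_le_sq_mul_sq F x y).trans
      (mul_le_mul (ha.2 F) (hb.2 F) (Finset.sum_nonneg fun _ _ => sq_nonneg _) (sq_nonneg A))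
  have h2 : ∑ l ∈ F, x l * y l ≤ A * B := (abs_le_of_sq_le_sq' h1 (mul_nonneg ha.1 hb.1)).2
  calc ∑ l ∈ F, (w l * ‖c l‖) ^ 2 ≤ ∑ l ∈ F, (x l + y l) ^ 2 :=
        Finset.sum_le_sum fun l _ => pow_le_pow_left₀ (mul_nonneg (hw l) (norm_nonneg _)) (h l) 2
    _ = ∑ l ∈ F, x l ^ 2 + 2 * ∑ l ∈ F, x l * y l + ∑ l ∈ F, y l ^ 2 := by
        rw [Finset.mul_sum, ← Finset.sum_add_distrib, ← Finset.sum_add_distrib]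
        exact Finset.sum_congr rfl fun l _ => by ring
    _ ≤ A ^ 2 + 2 * (A * B) + B ^ 2 := by
        gcongr
        · exact ha.2 F
        · exact hb.2 F
    _ = (A + B) ^ 2 := by ring

theorem SeqBound.add {w : ℤ → ℝ} {a b : ℤ → ℂ} {A B : ℝ} (ha : SeqBound w a A)
    (hb : SeqBound w b B) (hw : ∀ l, 0 ≤ w l) : SeqBound w (a + b) (A + B) :=
  ha.of_le_add hb hw fun l => by
    rw [← mul_add]; exact mul_le_mul_of_nonneg_left (norm_add_le _ _) (hw l)

theorem SeqBound.zero (w : ℤ → ℝ) : SeqBound w 0 0 := ⟨le_rfl, fun F => by simp⟩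

/-- The bounds are closed under coefficientwise limits. -/
theorem SeqBound.of_tendsto {ι : Type*} {f : Filter ι} [f.NeBot] {w : ℤ → ℝ} {a : ι → ℤ → ℂ}
    {a' : ℤ → ℂ} {B : ι → ℝ} {B' : ℝ} (h : ∀ᶠ i in f, SeqBound w (a i) (B i))
    (ha : ∀ l, Tendsto (fun i => a i l) f (𝓝 (a' l))) (hB : Tendsto B f (𝓝 B')) :
    SeqBound w a' B' := by
  refine ⟨ge_of_tendsto hB (h.mono fun i hi => hi.1), fun F => ?_⟩
  refine le_of_tendsto_of_tendsto (tendsto_finsetSum F fun l _ =>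
    (((ha l).norm).const_mul (w l)).pow 2) (hB.pow 2) (h.mono fun i hi => hi.2 F)

theorem SeqBound.iff_tsum {w : ℤ → ℝ} (hw : ∀ l, 0 ≤ w l) {a : ℤ → ℂ} {B : ℝ} (hB : 0 ≤ B) :
    SeqBound w a B ↔
      ∑' l, (ENNReal.ofReal (w l) * ENNReal.ofReal ‖a l‖) ^ 2 ≤ ENNReal.ofReal B ^ 2 := by
  have key : ∀ F : Finset ℤ, ∑ l ∈ F, (ENNReal.ofReal (w l) * ENNReal.ofReal ‖a l‖) ^ 2 =
      ENNReal.ofReal (∑ l ∈ F, (w l * ‖a l‖) ^ 2) := fun F => by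
    rw [ENNReal.ofReal_sum_of_nonneg fun _ _ => sq_nonneg _]
    refine Finset.sum_congr rfl fun l _ => ?_
    rw [ENNReal.ofReal_pow (mul_nonneg (hw l) (norm_nonneg _)), ENNReal.ofReal_mul (hw l)]
  rw [ENNReal.tsum_eq_iSup_sum, iSup_le_iff]
  simp only [key, ← ENNReal.ofReal_pow hB, ENNReal.ofReal_le_ofReal_iff (sq_nonneg B)]
  exact ⟨fun h => h.2, fun h => ⟨hB, h⟩⟩

/-- The Cauchy–Schwarz inequality for sums with values in `[0, ∞]`. -/
theorem ENNReal_tsum_mul_sq_le {ι : Type*} (x y : ι → ℝ≥0∞) :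
    (∑' i, x i * y i) ^ 2 ≤ (∑' i, x i ^ 2) * ∑' i, y i ^ 2 := by
  let _ : MeasurableSpace ι := ⊤
  have h := ENNReal.lintegral_mul_le_Lp_mul_Lq (Measure.count : Measure ι)
    Real.HolderConjugate.two_two (f := x) (g := y) measurable_from_top.aemeasurable
    measurable_from_top.aemeasurable
  simp only [lintegral_count, Pi.mul_apply] at h
  have h' := pow_le_pow_left' h 2
  refine h'.trans (le_of_eq ?_)
  rw [mul_pow, ← ENNReal.rpow_natCast, ← ENNReal.rpow_natCast, ← ENNReal.rpow_mul,
    ← ENNReal.rpow_mul]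
  norm_num

/-- Young's inequality `ℓ¹ * ℓ² ⊆ ℓ²`. -/
theorem ENNReal_young (b a : ℤ → ℝ≥0∞) :
    ∑' l, (∑' k, b k * a (l - k)) ^ 2 ≤ (∑' k, b k) ^ 2 * ∑' l, a l ^ 2 := by
  have hsq : ∀ z : ℝ≥0∞, (z ^ (1 / 2 : ℝ)) ^ 2 = z := fun z => by
    rw [← ENNReal.rpow_natCast, ← ENNReal.rpow_mul]; norm_num
  calc ∑' l, (∑' k, b k * a (l - k)) ^ 2
      ≤ ∑' l, (∑' k, b k) * ∑' k, b k * a (l - k) ^ 2 := by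
        refine ENNReal.tsum_le_tsum fun l => ?_
        have h := ENNReal_tsum_mul_sq_le (fun k => b k ^ (1 / 2 : ℝ))
          (fun k => b k ^ (1 / 2 : ℝ) * a (l - k))
        simp only [mul_pow, hsq] at h
        refine le_trans (le_of_eq ?_) h
        congr 1
        refine tsum_congr fun k => ?_
        rw [← mul_assoc, ← sq, hsq]
    _ = (∑' k, b k) * ∑' k, ∑' l, b k * a (l - k) ^ 2 := by
        rw [ENNReal.tsum_mul_left, ENNReal.tsum_comm]
    _ = (∑' k, b k) * ∑' k, b k * ∑' l, a l ^ 2 := by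
        congr 1
        refine tsum_congr fun k => ?_
        rw [ENNReal.tsum_mul_left]
        congr 1
        exact (Equiv.subRight k).tsum_eq (fun l => a l ^ 2)
    _ = (∑' k, b k) ^ 2 * ∑' l, a l ^ 2 := by
        rw [ENNReal.tsum_mul_right, sq, mul_assoc]

/-! ### Sobolev weights -/

/-- The Sobolev weight `(1 + u_l²)^(σ/2)`. -/
noncomputable def weight (L σ : ℝ) (l : ℤ) : ℝ := (1 + freq L l ^ 2) ^ (σ / 2)

theorem one_le_one_add_sq (x : ℝ) : 1 ≤ 1 + x ^ 2 := by nlinarith [sq_nonneg x]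

theorem weight_pos (L σ : ℝ) (l : ℤ) : 0 < weight L σ l :=
  Real.rpow_pos_of_pos (by positivity) _

theorem weight_nonneg (L σ : ℝ) (l : ℤ) : 0 ≤ weight L σ l := (weight_pos L σ l).le

theorem one_le_weight (L : ℝ) {σ : ℝ} (hσ : 0 ≤ σ) (l : ℤ) : 1 ≤ weight L σ l :=
  Real.one_le_rpow (one_le_one_add_sq _) (by positivity)

theorem weight_le_weight (L : ℝ) {σ σ' : ℝ} (h : σ ≤ σ') (l : ℤ) : weight L σ l ≤ weight L σ' l :=
  Real.rpow_le_rpow_of_exponent_le (one_le_one_add_sq _) (by linarith)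

theorem weight_add (L σ σ' : ℝ) (l : ℤ) : weight L (σ + σ') l = weight L σ l * weight L σ' l := by
  unfold weight
  rw [add_div, Real.rpow_add (by positivity)]

theorem weight_two (L : ℝ) (l : ℤ) : weight L 2 l = 1 + freq L l ^ 2 := by
  unfold weight; norm_num

theorem weight_zero (L : ℝ) (l : ℤ) : weight L 0 l = 1 := by
  unfold weight; norm_num

theorem seqBound_of_finite {L σ : ℝ} (s : Finset ℤ) {a : ℤ → ℂ} (ha : ∀ l ∉ s, a l = 0) :
    SeqBound (weight L σ) a (Real.sqrt (∑ l ∈ s, (weight L σ l * ‖a l‖) ^ 2)) := by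
  refine ⟨Real.sqrt_nonneg _, fun F => ?_⟩
  rw [Real.sq_sqrt (Finset.sum_nonneg fun _ _ => sq_nonneg _)]
  rw [← Finset.sum_inter_add_sum_sdiff F s]
  have : ∑ l ∈ F \ s, (weight L σ l * ‖a l‖) ^ 2 = 0 :=
    Finset.sum_eq_zero fun l hl => by rw [ha l (Finset.mem_sdiff.1 hl).2]; simp
  rw [this, add_zero]
  exact Finset.sum_le_sum_of_subset_of_nonneg Finset.inter_subset_right fun _ _ _ => sq_nonneg _

theorem rpow_le_weight {L σ : ℝ} (hσ : 0 ≤ σ) {l : ℤ} {y : ℝ} (hy : 0 ≤ y) (h : y ≤ |freq L l|) :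
    y ^ σ ≤ weight L σ l := by
  have h1 : y ^ σ = (y ^ 2) ^ (σ / 2) := by
    rw [← Real.rpow_natCast, ← Real.rpow_mul hy]; congr 1; push_cast; ring
  rw [h1, weight]
  refine Real.rpow_le_rpow (sq_nonneg y) ?_ (by positivity)
  have : y ^ 2 ≤ freq L l ^ 2 := by rw [← sq_abs (freq L l)]; exact pow_le_pow_left₀ hy h 2
  linarith

theorem freq_neg (L : ℝ) (l : ℤ) : freq L (-l) = -freq L l := by
  unfold freq; push_cast; ring

theorem freq_add (L : ℝ) (k l : ℤ) : freq L (k + l) = freq L k + freq L l := by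
  unfold freq; push_cast; ring

theorem freq_zero (L : ℝ) : freq L 0 = 0 := by simp [freq]

theorem weight_at_zero (L σ : ℝ) : weight L σ 0 = 1 := by simp [weight, freq_zero]

theorem weight_sq (L σ : ℝ) (l : ℤ) : weight L σ l ^ 2 = (1 + freq L l ^ 2) ^ σ := by
  unfold weight
  rw [← Real.rpow_natCast, ← Real.rpow_mul (by positivity)]
  congr 1; push_cast; ring

/-- Weights that are even, nonnegative and subadditive up to the factor `κ`; the corresponding
weighted `ℓ²` spaces intersected with the Wiener algebra are algebras. -/
structure IsAlgWeight (w : ℤ → ℝ) (κ : ℝ) : Prop where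
  nonneg : ∀ l, 0 ≤ w l
  neg : ∀ l, w (-l) = w l
  add_le : ∀ k l, w (k + l) ≤ κ * (w k + w l)

theorem isAlgWeight_weight (L : ℝ) {σ : ℝ} (hσ : 0 ≤ σ) :
    IsAlgWeight (weight L σ) (4 ^ (σ / 2)) where
  nonneg := weight_nonneg L σ
  neg l := by simp [weight, freq_neg]
  add_le k l := by
    have hmax : ∀ a b : ℝ, (1 + (a + b) ^ 2) ^ (σ / 2) ≤
        4 ^ (σ / 2) * ((1 + a ^ 2) ^ (σ / 2) + (1 + b ^ 2) ^ (σ / 2)) := by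
      intro a b
      rcases le_total (a ^ 2) (b ^ 2) with h | h
      · have : (1 + (a + b) ^ 2) ^ (σ / 2) ≤ (4 * (1 + b ^ 2)) ^ (σ / 2) :=
          Real.rpow_le_rpow (by positivity) (by nlinarith [sq_nonneg (a - b)]) (by positivity)
        rw [Real.mul_rpow (by norm_num) (by positivity)] at this
        refine this.trans (mul_le_mul_of_nonneg_left ?_ (by positivity))
        have : 0 ≤ (1 + a ^ 2) ^ (σ / 2) := by positivity
        linarith
      · have : (1 + (a + b) ^ 2) ^ (σ / 2) ≤ (4 * (1 + a ^ 2)) ^ (σ / 2) :=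
          Real.rpow_le_rpow (by positivity) (by nlinarith [sq_nonneg (a - b)]) (by positivity)
        rw [Real.mul_rpow (by norm_num) (by positivity)] at this
        refine this.trans (mul_le_mul_of_nonneg_left ?_ (by positivity))
        have : 0 ≤ (1 + b ^ 2) ^ (σ / 2) := by positivity
        linarith
    unfold weight
    rw [freq_add]
    exact hmax _ _

/-- Truncating a weight at height `K` preserves its subadditivity, with the same constant. -/
theorem IsAlgWeight.truncate {w : ℤ → ℝ} {κ : ℝ} (h : IsAlgWeight w κ) (hκ : 1 ≤ κ) {K : ℝ}
    (hK : 0 ≤ K) : IsAlgWeight (fun l => min (w l) K) κ where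
  nonneg l := le_min (h.nonneg l) hK
  neg l := by simp only [h.neg]
  add_le k l := by
    have hk := h.nonneg k
    have hl := h.nonneg l
    have hkl := h.add_le k l
    rcases le_total (w k) K with h1 | h1
    · rcases le_total (w l) K with h2 | h2
      · rw [min_eq_left h1, min_eq_left h2]
        exact (min_le_left _ _).trans hkl
      · rw [min_eq_left h1, min_eq_right h2]
        refine (min_le_right _ _).trans ?_
        nlinarith
    · rw [min_eq_right h1]
      refine (min_le_right _ _).trans ?_
      have : 0 ≤ min (w l) K := le_min hl hK
      nlinarith

theorem summable_weight_neg_two (L : ℝ) (hL : 0 < L) :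
    Summable fun l : ℤ => (weight L 1 l)⁻¹ ^ 2 := by
  have h1 : Summable fun l : ℤ => (L / Real.pi) ^ 2 * (1 / (l : ℝ) ^ 2) :=
    (Real.summable_one_div_int_pow.mpr one_lt_two).mul_left _
  refine Summable.of_norm_bounded_eventually h1 ?_
  rw [Filter.eventually_cofinite]
  refine (Set.finite_singleton (0 : ℤ)).subset fun l hl => ?_
  by_contra hl0
  apply hl
  have hl0' : (l : ℝ) ≠ 0 := by exact_mod_cast hl0
  have hpos : 0 < freq L l ^ 2 := by unfold freq; have := Real.pi_pos; positivity
  rw [inv_pow, weight_sq, Real.rpow_one, Real.norm_of_nonneg (by positivity)]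
  have : (L / Real.pi) ^ 2 * (1 / (l : ℝ) ^ 2) = (freq L l ^ 2)⁻¹ := by
    unfold freq; field_simp
  rw [this]
  exact inv_anti₀ hpos (by linarith)

/-- The embedding constant of `H¹` into the Wiener algebra. -/
noncomputable def wienerConst (L : ℝ) : ℝ := Real.sqrt (∑' l : ℤ, (weight L 1 l)⁻¹ ^ 2)

theorem wienerConst_nonneg (L : ℝ) : 0 ≤ wienerConst L := Real.sqrt_nonneg _

theorem sum_norm_le_of_weight {L : ℝ} {a : ℤ → ℂ} {B S : ℝ} (h : SeqBound (weight L 1) a B)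
    (F : Finset ℤ) (hS : 0 ≤ S) (hF : ∑ l ∈ F, (weight L 1 l)⁻¹ ^ 2 ≤ S ^ 2) :
    ∑ l ∈ F, ‖a l‖ ≤ S * B := by
  have h1 := Finset.sum_mul_sq_le_sq_mul_sq F (fun l => (weight L 1 l)⁻¹)
    (fun l => weight L 1 l * ‖a l‖)
  have h2 : ∑ l ∈ F, (weight L 1 l)⁻¹ * (weight L 1 l * ‖a l‖) = ∑ l ∈ F, ‖a l‖ :=
    Finset.sum_congr rfl fun l _ => inv_mul_cancel_left₀ (weight_pos L 1 l).ne' _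
  rw [h2] at h1
  have h3 : (∑ l ∈ F, ‖a l‖) ^ 2 ≤ (S * B) ^ 2 := by
    rw [mul_pow]
    exact h1.trans (mul_le_mul hF (h.2 F) (Finset.sum_nonneg fun _ _ => sq_nonneg _) (sq_nonneg S))
  exact (abs_le_of_sq_le_sq' h3 (mul_nonneg hS h.1)).2

theorem SeqBound.sum_norm_le {L : ℝ} (hL : 0 < L) {a : ℤ → ℂ} {B : ℝ}
    (h : SeqBound (weight L 1) a B) (F : Finset ℤ) : ∑ l ∈ F, ‖a l‖ ≤ wienerConst L * B := by
  refine sum_norm_le_of_weight h F (wienerConst_nonneg L) ?_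
  rw [wienerConst, Real.sq_sqrt (tsum_nonneg fun _ => sq_nonneg _)]
  exact (summable_weight_neg_two L hL).sum_le_tsum F fun _ _ => sq_nonneg _

theorem SeqBound.summable {L : ℝ} (hL : 0 < L) {a : ℤ → ℂ} {B : ℝ}
    (h : SeqBound (weight L 1) a B) : Summable a :=
  .of_norm (summable_of_sum_le (fun _ => norm_nonneg _) (h.sum_norm_le hL))

/-- Interpolation between `L²` and `H¹`: the Wiener norm is bounded by the `L²` norm up to an
arbitrarily small multiple of the `H¹` norm. -/
theorem exists_sum_norm_le_add {L : ℝ} (hL : 0 < L) {ε : ℝ} (hε : 0 < ε) :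
    ∃ C, 0 ≤ C ∧ ∀ (a : ℤ → ℂ) (A B : ℝ), SeqBound (weight L 0) a A → SeqBound (weight L 1) a B →
      ∀ F : Finset ℤ, ∑ l ∈ F, ‖a l‖ ≤ C * A + ε * B := by
  have hs := summable_weight_neg_two L hL
  obtain ⟨F₀, hF₀⟩ := hs.vanishing (Metric.ball_mem_nhds (0 : ℝ) (pow_pos hε 2))
  refine ⟨Real.sqrt F₀.card, Real.sqrt_nonneg _, fun a A B hA hB F => ?_⟩
  -- low modes are estimated in `L²`; the high modes, outside `F₀`, carry little weight in `H¹`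
  rw [← Finset.sum_inter_add_sum_sdiff F F₀]
  refine add_le_add ?_ ?_
  · have h1 := Finset.sum_mul_sq_le_sq_mul_sq (F ∩ F₀) (fun _ => (1 : ℝ)) (fun l => ‖a l‖)
    have h2 := hA.2 (F ∩ F₀)
    simp only [weight_zero, one_mul] at h2
    simp only [one_mul, one_pow, Finset.sum_const, nsmul_eq_mul, mul_one] at h1
    have h3 : ((F ∩ F₀).card : ℝ) ≤ F₀.card := by
      exact_mod_cast Finset.card_le_card Finset.inter_subset_right
    refine (abs_le_of_sq_le_sq' (?_ : _ ≤ (Real.sqrt F₀.card * A) ^ 2)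
      (mul_nonneg (Real.sqrt_nonneg _) hA.1)).2
    rw [mul_pow, Real.sq_sqrt (Nat.cast_nonneg _)]
    exact h1.trans (mul_le_mul h3 h2 (Finset.sum_nonneg fun _ _ => sq_nonneg _) (Nat.cast_nonneg _))
  · refine sum_norm_le_of_weight hB _ hε.le ?_
    have := hF₀ (F \ F₀) Finset.sdiff_disjoint
    rw [mem_ball_zero_iff, Real.norm_eq_abs] at this
    exact (le_abs_self _).trans this.le

/-! ### Fourier coefficients of continuous functions -/

section

variable {L : ℝ} [Fact (0 < L)]

theorem pos_of_fact : 0 < L := Fact.out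

theorem integrable_continuousMap (f : C(Torus L, ℂ)) : Integrable f AddCircle.haarAddCircle :=
  f.continuous.integrable_of_hasCompactSupport (HasCompactSupport.of_compactSpace _)

theorem norm_fourierCoeff_le (f : C(Torus L, ℂ)) (l : ℤ) : ‖fourierCoeff f l‖ ≤ ‖f‖ := by
  unfold fourierCoeff
  refine (norm_integral_le_of_norm_le_const (C := ‖f‖) (.of_forall fun x => ?_)).trans (by simp)
  rw [norm_smul]
  have h1 : ‖(fourier (-l) : C(Torus L, ℂ)) x‖ ≤ 1 :=
    (ContinuousMap.norm_coe_le_norm _ x).trans (fourier_norm _).le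
  calc _ ≤ 1 * ‖f‖ := mul_le_mul h1 (ContinuousMap.norm_coe_le_norm f x) (norm_nonneg _) zero_le_one
    _ = ‖f‖ := one_mul _

/-- The `l`-th Fourier coefficient as a continuous linear functional on `C(𝕋, ℂ)`. -/
noncomputable def coeffCLM (l : ℤ) : C(Torus L, ℂ) →L[ℂ] ℂ :=
  LinearMap.mkContinuous
    { toFun := fun f => fourierCoeff f l
      map_add' := fun f g => by
        rw [ContinuousMap.coe_add,
          fourierCoeff.add (integrable_continuousMap f) (integrable_continuousMap g)]
        rfl
      map_smul' := fun c f => by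
        rw [ContinuousMap.coe_smul, fourierCoeff.const_smul]; rfl }
    1 fun f => by simpa using norm_fourierCoeff_le f l

@[simp] theorem coeffCLM_apply (l : ℤ) (f : C(Torus L, ℂ)) : coeffCLM l f = fourierCoeff f l := rfl

theorem fourierCoeff_fourier_mul (k l : ℤ) (g : C(Torus L, ℂ)) :
    fourierCoeff (fourier k * g : C(Torus L, ℂ)) l = fourierCoeff g (l - k) := by
  unfold fourierCoeff
  refine integral_congr_ae (.of_forall fun x => ?_)
  simp only [ContinuousMap.coe_mul, Pi.mul_apply, smul_eq_mul]
  rw [← mul_assoc, ← fourier_add]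
  congr 3; ring

/-- The Fourier coefficients of a product are the convolution of the Fourier coefficients. -/
theorem hasSum_fourierCoeff_mul {f : C(Torus L, ℂ)} (hf : Summable (fourierCoeff f))
    (g : C(Torus L, ℂ)) (l : ℤ) :
    HasSum (fun k => fourierCoeff f k * fourierCoeff g (l - k))
      (fourierCoeff (f * g : C(Torus L, ℂ)) l) := by
  have h1 := (hasSum_fourier_series_of_summable hf).mul_right g
  have h2 := (coeffCLM (L := L) l).hasSum h1
  refine (h2.congr_fun ?_ : _)
  intro k
  simp only [smul_mul_assoc, map_smul, coeffCLM_apply,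
    fourierCoeff_fourier_mul, smul_eq_mul]

theorem fourierCoeff_star (f : C(Torus L, ℂ)) (l : ℤ) :
    fourierCoeff (star f : C(Torus L, ℂ)) l = star (fourierCoeff f (-l)) := by
  unfold fourierCoeff
  refine Eq.trans (integral_congr_ae (.of_forall fun x => ?_)) integral_conj
  simp

theorem fourierCoeff_one (l : ℤ) :
    fourierCoeff (1 : C(Torus L, ℂ)) l = if l = 0 then 1 else 0 := by
  have h : (1 : C(Torus L, ℂ)) = fourier 0 := by ext x; simp
  rw [h, fourierCoeff_fourier, Pi.single_apply]

/-- Young's inequality for real sequences. -/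
theorem seqBound_young {b a : ℤ → ℝ} {S A : ℝ} (hb : ∀ k, 0 ≤ b k) (ha : ∀ k, 0 ≤ a k)
    (hbS : ∀ F : Finset ℤ, ∑ k ∈ F, b k ≤ S) (haA : SeqBound (fun _ => 1) (fun l => (a l : ℂ)) A) :
    (∀ l, Summable fun k => b k * a (l - k)) ∧
    SeqBound (fun _ => 1) (fun l => ((∑' k, b k * a (l - k) : ℝ) : ℂ)) (S * A) := by
  have hS : 0 ≤ S := by simpa using hbS ∅
  have hbs : Summable b := summable_of_sum_le hb hbS
  have hle : ∀ l, a l ≤ A := fun l => by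
    have := haA.term_le l
    simpa [abs_of_nonneg (ha l)] using this
  have hsum : ∀ l, Summable fun k => b k * a (l - k) := fun l =>
    Summable.of_nonneg_of_le (fun k => mul_nonneg (hb k) (ha _))
      (fun k => mul_le_mul_of_nonneg_left (hle _) (hb k)) (hbs.mul_right A)
  refine ⟨hsum, ?_⟩
  rw [SeqBound.iff_tsum (fun _ => zero_le_one) (mul_nonneg hS haA.1)]
  have h := ENNReal_young (fun k => ENNReal.ofReal (b k)) (fun k => ENNReal.ofReal (a k))
  have e1 : ∀ l, ∑' k, ENNReal.ofReal (b k) * ENNReal.ofReal (a (l - k)) =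
      ENNReal.ofReal (∑' k, b k * a (l - k)) := fun l => by
    rw [ENNReal.ofReal_tsum_of_nonneg (fun k => mul_nonneg (hb k) (ha _)) (hsum l)]
    exact tsum_congr fun k => (ENNReal.ofReal_mul (hb k)).symm
  have e2 : ∑' l, ENNReal.ofReal (a l) ^ 2 ≤ ENNReal.ofReal A ^ 2 := by
    have := (SeqBound.iff_tsum (fun _ => zero_le_one) haA.1).1 haA
    simpa [abs_of_nonneg (ha _)] using this
  have e3 : ∑' k, ENNReal.ofReal (b k) ≤ ENNReal.ofReal S := by
    rw [← ENNReal.ofReal_tsum_of_nonneg hb hbs]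
    exact ENNReal.ofReal_le_ofReal (hbs.tsum_le_of_sum_le hbS)
  have e4 : ∀ l, ‖((∑' k, b k * a (l - k) : ℝ) : ℂ)‖ = ∑' k, b k * a (l - k) := fun l => by
    rw [Complex.norm_real, Real.norm_of_nonneg (tsum_nonneg fun k => mul_nonneg (hb k) (ha _))]
  simp only [e4, ← e1, ENNReal.ofReal_one, one_mul]
  refine h.trans ?_
  rw [ENNReal.ofReal_mul hS, mul_pow]
  gcongr

/-- The tame product estimate: each factor enters one of the two terms only through its `H¹` norm.
-/
theorem SeqBound.mul_tame {w : ℤ → ℝ} {κ : ℝ} (hw : IsAlgWeight w κ) (hκ : 0 ≤ κ)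
    {f g : C(Torus L, ℂ)} {A A' B B' : ℝ}
    (hf : SeqBound w (fourierCoeff f) A) (hf' : SeqBound (weight L 1) (fourierCoeff f) A')
    (hg : SeqBound w (fourierCoeff g) B) (hg' : SeqBound (weight L 1) (fourierCoeff g) B') :
    SeqBound w (fourierCoeff (f * g : C(Torus L, ℂ)))
      (κ * wienerConst L * (A * B' + A' * B)) := by
  have hL : 0 < L := pos_of_fact
  have conv : ∀ {h : C(Torus L, ℂ)} {D : ℝ}, SeqBound w (fourierCoeff h) D →
      SeqBound (fun _ => 1) (fun l => ((w l * ‖fourierCoeff h l‖ : ℝ) : ℂ)) D := by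
    intro h D hD
    refine ⟨hD.1, fun F => (hD.2 F).trans' (le_of_eq (Finset.sum_congr rfl fun l _ => ?_))⟩
    rw [one_mul, Complex.norm_real, Real.norm_of_nonneg (mul_nonneg (hw.nonneg l) (norm_nonneg _))]
  obtain ⟨s1, y1⟩ := seqBound_young (fun _ => norm_nonneg _)
    (fun l => mul_nonneg (hw.nonneg l) (norm_nonneg _)) (hf'.sum_norm_le hL) (conv hg)
  obtain ⟨s2, y2⟩ := seqBound_young (fun _ => norm_nonneg _)
    (fun l => mul_nonneg (hw.nonneg l) (norm_nonneg _)) (hg'.sum_norm_le hL) (conv hf)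
  have y1' := y1.of_le (w' := fun _ => κ) (b := fun l => _) hκ (fun _ => hκ)
    (fun l => by rw [one_mul])
  have y2' := y2.of_le (w' := fun _ => κ) (b := fun l => _) hκ (fun _ => hκ)
    (fun l => by rw [one_mul])
  refine (y1'.of_le_add y2' hw.nonneg fun l => ?_).mono (le_of_eq (by ring))
  have hs := hasSum_fourierCoeff_mul (hf'.summable hL) g l
  have hnn : ∀ l, (0 : ℝ) ≤ ∑' k, ‖fourierCoeff f k‖ * (w (l - k) * ‖fourierCoeff g (l - k)‖) :=
    fun l => tsum_nonneg fun k =>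
      mul_nonneg (norm_nonneg _) (mul_nonneg (hw.nonneg _) (norm_nonneg _))
  have hnn' : ∀ l, (0 : ℝ) ≤ ∑' k, ‖fourierCoeff g k‖ * (w (l - k) * ‖fourierCoeff f (l - k)‖) :=
    fun l => tsum_nonneg fun k =>
      mul_nonneg (norm_nonneg _) (mul_nonneg (hw.nonneg _) (norm_nonneg _))
  rw [Complex.norm_real, Complex.norm_real, Real.norm_of_nonneg (hnn l),
    Real.norm_of_nonneg (hnn' l)]
  have s2' : Summable fun k => (w k * ‖fourierCoeff f k‖) * ‖fourierCoeff g (l - k)‖ := by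
    refine ((Equiv.subLeft l).summable_iff.mpr (s2 l)).congr fun k => ?_
    simp [mul_comm]
  have t2 : ∑' k, ‖fourierCoeff g k‖ * (w (l - k) * ‖fourierCoeff f (l - k)‖) =
      ∑' k, (w k * ‖fourierCoeff f k‖) * ‖fourierCoeff g (l - k)‖ := by
    rw [← (Equiv.subLeft l).tsum_eq]
    exact tsum_congr fun k => by simp [mul_comm]
  rw [t2, ← hs.tsum_eq, ← mul_add, ← (s1 l).tsum_add s2', ← tsum_mul_left]
  have hterm : ∀ k, w l * ‖fourierCoeff f k * fourierCoeff g (l - k)‖ ≤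
      κ * (‖fourierCoeff f k‖ * (w (l - k) * ‖fourierCoeff g (l - k)‖) +
        (w k * ‖fourierCoeff f k‖) * ‖fourierCoeff g (l - k)‖) := fun k => by
    have h1 := hw.add_le k (l - k)
    rw [add_sub_cancel] at h1
    rw [norm_mul]
    calc _ ≤ κ * (w k + w (l - k)) * (‖fourierCoeff f k‖ * ‖fourierCoeff g (l - k)‖) := by gcongr
      _ = _ := by ring
  have hs3 := ((s1 l).add s2').mul_left κ
  have hsw : Summable fun k => w l * ‖fourierCoeff f k * fourierCoeff g (l - k)‖ :=
    Summable.of_nonneg_of_le (fun k => mul_nonneg (hw.nonneg l) (norm_nonneg _)) hterm hs3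
  rcases (hw.nonneg l).eq_or_lt with h0 | h0
  · rw [← h0, zero_mul]
    exact tsum_nonneg fun k => mul_nonneg hκ (add_nonneg
      (mul_nonneg (norm_nonneg _) (mul_nonneg (hw.nonneg _) (norm_nonneg _)))
      (mul_nonneg (mul_nonneg (hw.nonneg _) (norm_nonneg _)) (norm_nonneg _)))
  · have hsn : Summable fun k => ‖fourierCoeff f k * fourierCoeff g (l - k)‖ :=
      (summable_mul_left_iff h0.ne').1 hsw
    calc _ ≤ w l * ∑' k, ‖fourierCoeff f k * fourierCoeff g (l - k)‖ :=
          mul_le_mul_of_nonneg_left (norm_tsum_le_tsum_norm hsn) h0.le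
      _ = ∑' k, w l * ‖fourierCoeff f k * fourierCoeff g (l - k)‖ := tsum_mul_left.symm
      _ ≤ _ := hsw.tsum_le_tsum hterm hs3

theorem SeqBound.star {w : ℤ → ℝ} (hw : ∀ l, w (-l) = w l) {f : C(Torus L, ℂ)} {A : ℝ}
    (hf : SeqBound w (fourierCoeff f) A) :
    SeqBound w (fourierCoeff (star f : C(Torus L, ℂ))) A := by
  refine ⟨hf.1, fun F => (hf.2 (F.map (Equiv.neg ℤ).toEmbedding)).trans' (le_of_eq ?_)⟩
  rw [Finset.sum_map]
  refine Finset.sum_congr rfl fun l _ => ?_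
  rw [fourierCoeff_star, norm_star]
  simp [hw]

theorem seqBound_one {w : ℤ → ℝ} (hw : w 0 = 1) :
    SeqBound w (fourierCoeff (1 : C(Torus L, ℂ))) 1 := by
  refine ⟨zero_le_one, fun F => ?_⟩
  have : ∀ l, (w l * ‖fourierCoeff (1 : C(Torus L, ℂ)) l‖) ^ 2 = if l = 0 then 1 else 0 := by
    intro l
    rw [fourierCoeff_one]
    split_ifs with h
    · simp [h, hw]
    · simp
  simp only [this, Finset.sum_ite_eq']
  split_ifs <;> norm_num

/-! ### The algebra `H¹(𝕋)` -/

variable (L) in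
/-- The star-algebra `H¹(𝕋)`, realized by continuous functions. -/
def sobolevOne : StarSubalgebra ℂ C(Torus L, ℂ) where
  carrier := {f | ∃ B, SeqBound (weight L 1) (fourierCoeff f) B}
  mul_mem' := by
    rintro f g ⟨A, hA⟩ ⟨B, hB⟩
    exact ⟨_, SeqBound.mul_tame (isAlgWeight_weight L zero_le_one) (by positivity) hA hA hB hB⟩
  add_mem' := by
    rintro f g ⟨A, hA⟩ ⟨B, hB⟩
    refine ⟨_, (hA.add hB (weight_nonneg L 1)).of_le zero_le_one (weight_nonneg L 1) fun l => ?_⟩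
    rw [one_mul, ← coeffCLM_apply, map_add]
    rfl
  algebraMap_mem' := by
    intro r
    refine ⟨_, (seqBound_one (L := L) (weight_at_zero L 1)).of_le (norm_nonneg r)
      (weight_nonneg L 1)
      fun l => ?_⟩
    rw [Algebra.algebraMap_eq_smul_one, ← coeffCLM_apply, map_smul, norm_smul]
    exact le_of_eq (by rw [coeffCLM_apply]; ring)
  star_mem' := by
    rintro f ⟨A, hA⟩
    exact ⟨A, SeqBound.star (L := L) (isAlgWeight_weight L zero_le_one).neg hA⟩

variable (L) in
/-- The elements of `H¹(𝕋)`. -/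
abbrev HOne : Type := sobolevOne L

/-- The sequence of Fourier coefficients of an element of `H¹(𝕋)`. -/
noncomputable def coeff : HOne L →ₗ[ℂ] (ℤ → ℂ) where
  toFun f := fourierCoeff (f : C(Torus L, ℂ))
  map_add' f g := by
    ext l; exact map_add (coeffCLM l) (f : C(Torus L, ℂ)) (g : C(Torus L, ℂ))
  map_smul' c f := by
    ext l; exact map_smul (coeffCLM l) c (f : C(Torus L, ℂ))

theorem coeff_apply (f : HOne L) (l : ℤ) : coeff f l = fourierCoeff (f : C(Torus L, ℂ)) l := rfl

theorem coeff_add (f g : HOne L) (l : ℤ) : coeff (f + g) l = coeff f l + coeff g l := by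
  rw [map_add, Pi.add_apply]

theorem coeff_sub (f g : HOne L) (l : ℤ) : coeff (f - g) l = coeff f l - coeff g l := by
  rw [map_sub, Pi.sub_apply]

theorem coeff_smul (c : ℂ) (f : HOne L) (l : ℤ) : coeff (c • f) l = c * coeff f l := by
  rw [map_smul, Pi.smul_apply, smul_eq_mul]

theorem HOne.exists_bound (f : HOne L) : ∃ B, SeqBound (weight L 1) (coeff f) B := f.2

theorem HOne.summable (f : HOne L) : Summable (coeff f) :=
  let ⟨_, h⟩ := f.exists_bound; h.summable pos_of_fact

theorem HOne.hasSum (f : HOne L) :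
    HasSum (fun l => coeff f l • (fourier l : C(Torus L, ℂ))) (f : C(Torus L, ℂ)) :=
  hasSum_fourier_series_of_summable f.summable

theorem HOne.ext_coeff {f g : HOne L} (h : ∀ l, coeff f l = coeff g l) : f = g := by
  apply Subtype.ext
  have hf := f.hasSum
  simp only [h] at hf
  exact hf.unique g.hasSum

theorem coeff_star (f : HOne L) (l : ℤ) : coeff (star f) l = star (coeff f (-l)) :=
  fourierCoeff_star _ l

theorem hasSum_coeff_mul (f g : HOne L) (l : ℤ) :
    HasSum (fun k => coeff f k * coeff g (l - k)) (coeff (f * g) l) :=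
  hasSum_fourierCoeff_mul f.summable _ l

theorem norm_le_of_sum_coeff_le {f : HOne L} {B : ℝ}
    (h : ∀ F : Finset ℤ, ∑ l ∈ F, ‖coeff f l‖ ≤ B) : ‖(f : C(Torus L, ℂ))‖ ≤ B := by
  refine le_of_tendsto f.hasSum.norm (.of_forall fun F => ?_)
  refine (norm_sum_le _ _).trans ((Finset.sum_le_sum fun l _ => ?_).trans (h F))
  rw [norm_smul, fourier_norm, mul_one]

open Classical in
/-- The element of `H¹(𝕋)` with prescribed Fourier coefficients (and `0` if there is none). -/
noncomputable def ofCoeff (a : ℤ → ℂ) : HOne L :=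
  if h : ∃ f : HOne L, coeff f = a then h.choose else 0

theorem coeff_ofCoeff {a : ℤ → ℂ} {B : ℝ} (h : SeqBound (weight L 1) a B) :
    coeff (ofCoeff a : HOne L) = a := by
  have ex : ∃ f : HOne L, coeff f = a := by
    have hs : Summable fun l => a l • (fourier l : C(Torus L, ℂ)) := by
      refine .of_norm ((h.summable pos_of_fact).norm.congr fun l => ?_)
      rw [norm_smul, fourier_norm, mul_one]
    have hc : fourierCoeff (∑' l, a l • (fourier l : C(Torus L, ℂ)) : C(Torus L, ℂ)) = a := by
      ext l
      have h1 := (coeffCLM (L := L) l).hasSum hs.hasSum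
      rw [← coeffCLM_apply]
      refine h1.unique ?_
      refine (hasSum_ite_eq l (a l)).congr_fun fun k => ?_
      simp only [map_smul, coeffCLM_apply, fourierCoeff_fourier,
        Pi.single_apply, smul_eq_mul]
      by_cases hk : k = l
      · simp [hk]
      · simp [hk, Ne.symm hk]
    exact ⟨⟨∑' l, a l • (fourier l : C(Torus L, ℂ)), B, by rw [hc]; exact h⟩, hc⟩
  rw [ofCoeff, dif_pos ex]
  exact ex.choose_spec

/-- `SobBound σ f B` says that `f` has `H^σ` norm (up to the factor `√(2L)`) at most `B`. -/
def SobBound (σ : ℝ) (f : HOne L) (B : ℝ) : Prop := SeqBound (weight L σ) (coeff f) B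

namespace SobBound

variable {σ : ℝ} {f g : HOne L} {A B : ℝ}

theorem nonneg (h : SobBound σ f A) : 0 ≤ A := h.1

theorem mono (h : SobBound σ f A) (hAB : A ≤ B) : SobBound σ f B := SeqBound.mono h hAB

theorem weaken (h : SobBound σ f A) {σ' : ℝ} (hσ : σ' ≤ σ) : SobBound σ' f A :=
  (SeqBound.of_le h zero_le_one (weight_nonneg L σ') fun l => by
    rw [one_mul]
    exact mul_le_mul_of_nonneg_right (weight_le_weight L hσ l) (norm_nonneg _)).mono
    (one_mul A).le

theorem add (hf : SobBound σ f A) (hg : SobBound σ g B) : SobBound σ (f + g) (A + B) := by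
  have := SeqBound.add hf hg (weight_nonneg L σ)
  rwa [← map_add] at this

theorem smul (hf : SobBound σ f A) (c : ℂ) : SobBound σ (c • f) (‖c‖ * A) :=
  SeqBound.of_le hf (norm_nonneg c) (weight_nonneg L σ) fun l => le_of_eq <| by
    rw [map_smul, Pi.smul_apply, norm_smul]; ring

theorem neg (hf : SobBound σ f A) : SobBound σ (-f) A := by
  have := hf.smul (-1)
  simpa using this

theorem sub (hf : SobBound σ f A) (hg : SobBound σ g B) : SobBound σ (f - g) (A + B) := by
  rw [sub_eq_add_neg]; exact hf.add hg.neg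

theorem sub_comm (h : SobBound σ (f - g) A) : SobBound σ (g - f) A := by
  have := h.neg; rwa [neg_sub] at this

theorem zero : SobBound σ (0 : HOne L) 0 := by
  unfold SobBound; rw [map_zero]; exact SeqBound.zero _

theorem one : SobBound σ (1 : HOne L) 1 := seqBound_one (weight_at_zero L σ)

theorem star (hf : SobBound σ f A) : SobBound σ (star f) A :=
  SeqBound.star (fun l => by simp [weight, freq_neg]) hf

end SobBound

/-- The constant of the product estimate in `H^σ`; it is at least `1`. -/
noncomputable def algConst (L σ : ℝ) : ℝ := 2 * (4 ^ (σ / 2) * wienerConst L) + 1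

theorem one_le_algConst (L σ : ℝ) : 1 ≤ algConst L σ := by
  have := wienerConst_nonneg L
  unfold algConst
  have : 0 ≤ 4 ^ (σ / 2) * wienerConst L := by positivity
  linarith

theorem algConst_pos (L σ : ℝ) : 0 < algConst L σ := zero_lt_one.trans_le (one_le_algConst L σ)

/-- `H^σ(𝕋)` is an algebra for `σ ≥ 1`. -/
theorem SobBound.mul {σ : ℝ} (hσ : 1 ≤ σ) {f g : HOne L} {A B : ℝ} (hf : SobBound σ f A)
    (hg : SobBound σ g B) : SobBound σ (f * g) (algConst L σ * (A * B)) := by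
  have h := SeqBound.mul_tame (isAlgWeight_weight L (zero_le_one.trans hσ)) (by positivity)
    hf (hf.weaken hσ) hg (hg.weaken hσ)
  refine SeqBound.mono h ?_
  have := mul_nonneg hf.1 hg.1
  unfold algConst
  linarith

/-! ### Exponentials in Sobolev spaces -/

theorem SobBound.pow_succ {σ : ℝ} (hσ : 1 ≤ σ) {f : HOne L} {A : ℝ} (hf : SobBound σ f A) (n : ℕ) :
    SobBound σ (f ^ (n + 1)) ((algConst L σ * A) ^ (n + 1)) := by
  have hk := one_le_algConst L σ
  induction n with
  | zero =>
    simp only [zero_add, pow_one]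
    exact hf.mono (by nlinarith [hf.nonneg])
  | succ n ih =>
    rw [_root_.pow_succ f]
    exact (ih.mul hσ hf).mono (le_of_eq (by ring))

theorem SobBound.sum {σ : ℝ} {ι : Type*} (s : Finset ι) {f : ι → HOne L} {A : ι → ℝ}
    (h : ∀ i ∈ s, SobBound σ (f i) (A i)) : SobBound σ (∑ i ∈ s, f i) (∑ i ∈ s, A i) := by
  classical
  induction s using Finset.induction_on with
  | empty => simpa using SobBound.zero
  | insert i s hi ih =>
    rw [Finset.sum_insert hi, Finset.sum_insert hi]
    exact (h i (Finset.mem_insert_self i s)).add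
      (ih fun j hj => h j (Finset.mem_insert_of_mem hj))

/-- Taylor polynomials of the exponential. -/
noncomputable def expTaylor (k : ℕ) (f : HOne L) : HOne L :=
  ∑ j ∈ Finset.range k, ((j.factorial : ℂ)⁻¹) • f ^ j

theorem tendsto_expTaylor (f : HOne L) :
    Tendsto (fun N => (expTaylor N f : C(Torus L, ℂ))) atTop
      (𝓝 (NormedSpace.exp (f : C(Torus L, ℂ)))) := by
  have h := (NormedSpace.exp_series_hasSum_exp' (𝕂 := ℂ) (f : C(Torus L, ℂ))).tendsto_sum_nat
  refine h.congr fun N => ?_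
  simp [expTaylor]

theorem expTaylor_sub_bound {σ : ℝ} (hσ : 1 ≤ σ) {f : HOne L} {A : ℝ} (hf : SobBound σ f A)
    {k N : ℕ} (hk : 1 ≤ k) (hN : k ≤ N) :
    SobBound σ (expTaylor N f - expTaylor k f)
      ((algConst L σ * A) ^ k * Real.exp (algConst L σ * A)) := by
  set y := algConst L σ * A with hy
  have hy0 : 0 ≤ y := mul_nonneg (algConst_pos L σ).le hf.nonneg
  obtain ⟨n, rfl⟩ := Nat.exists_eq_add_of_le hN
  have e : expTaylor (k + n) f - expTaylor k f =
      ∑ i ∈ Finset.range n, (((k + i).factorial : ℂ)⁻¹) • f ^ (k + i) := by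
    rw [expTaylor, expTaylor, Finset.sum_range_add, add_sub_cancel_left]
  rw [e]
  have hterm : ∀ i ∈ Finset.range n, SobBound σ ((((k + i).factorial : ℂ)⁻¹) • f ^ (k + i))
      (y ^ k * (y ^ i / i.factorial)) := by
    intro i _
    obtain ⟨m, hm⟩ : ∃ m, k + i = m + 1 := ⟨k + i - 1, by omega⟩
    have h1 := (hf.pow_succ hσ m).smul (((k + i).factorial : ℂ)⁻¹)
    rw [← hm, ← hy] at h1
    refine h1.mono ?_
    rw [norm_inv, Complex.norm_natCast, pow_add, inv_mul_eq_div, mul_div_assoc]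
    have hfac : (i.factorial : ℝ) ≤ (k + i).factorial := by
      exact_mod_cast Nat.factorial_le (by omega)
    have : (0 : ℝ) < i.factorial := by exact_mod_cast i.factorial_pos
    gcongr
  refine (SobBound.sum _ hterm).mono ?_
  rw [← Finset.mul_sum]
  exact mul_le_mul_of_nonneg_left (Real.sum_le_exp_of_nonneg hy0 n) (pow_nonneg hy0 k)

theorem exp_seqBound {σ : ℝ} (hσ : 1 ≤ σ) {f : HOne L} {A : ℝ} (hf : SobBound σ f A)
    {k : ℕ} (hk : 1 ≤ k) :
    SeqBound (weight L σ)
      (fourierCoeff (NormedSpace.exp (f : C(Torus L, ℂ)) - (expTaylor k f : C(Torus L, ℂ)) :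
        C(Torus L, ℂ)))
      ((algConst L σ * A) ^ k * Real.exp (algConst L σ * A)) := by
  refine SeqBound.of_tendsto (f := atTop) (a := fun N => coeff (expTaylor N f - expTaylor k f))
    ((eventually_ge_atTop k).mono fun N hN => expTaylor_sub_bound hσ hf hk hN) (fun l => ?_)
    tendsto_const_nhds
  exact ((coeffCLM (L := L) l).continuous.tendsto _).comp
    ((tendsto_expTaylor f).sub_const (expTaylor k f : C(Torus L, ℂ)))

/-- The exponential on `H¹(𝕋)`. -/
noncomputable def expH (f : HOne L) : HOne L :=
  ⟨NormedSpace.exp (f : C(Torus L, ℂ)), by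
    obtain ⟨A, hA⟩ := f.exists_bound
    have h : (⟨_, _, exp_seqBound (σ := 1) le_rfl hA le_rfl⟩ : HOne L).1 ∈ sobolevOne L :=
      Subtype.property _
    have := add_mem h (expTaylor 1 f).2
    simpa using this⟩

theorem expH_apply (f : HOne L) (x : Torus L) :
    (expH f : C(Torus L, ℂ)) x = Complex.exp ((f : C(Torus L, ℂ)) x) := by
  rw [Complex.exp_eq_exp_ℂ]
  exact NormedSpace.map_exp (ContinuousMap.evalAlgHom ℂ ℂ x)
    (continuous_eval_const x) (f : C(Torus L, ℂ))

theorem HOne.ext_fun {f g : HOne L}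
    (h : ∀ x, (f : C(Torus L, ℂ)) x = (g : C(Torus L, ℂ)) x) : f = g :=
  Subtype.ext (ContinuousMap.ext h)

theorem expH_add (f g : HOne L) : expH (f + g) = expH f * expH g :=
  HOne.ext_fun fun x => by simp [expH_apply, Complex.exp_add]

theorem expH_zero : expH (0 : HOne L) = 1 := HOne.ext_fun fun x => by simp [expH_apply]

theorem expH_star (f : HOne L) : expH (star f) = star (expH f) :=
  HOne.ext_fun fun x => by simp [expH_apply, ← Complex.exp_conj]

/-- Taylor's formula with remainder for the exponential in `H^σ`. -/
theorem SobBound.exp_sub_taylor {σ : ℝ} (hσ : 1 ≤ σ) {f : HOne L} {A : ℝ} (hf : SobBound σ f A)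
    {k : ℕ} (hk : 1 ≤ k) :
    SobBound σ (expH f - expTaylor k f) ((algConst L σ * A) ^ k * Real.exp (algConst L σ * A)) :=
  exp_seqBound hσ hf hk

theorem SobBound.exp_sub_one {σ : ℝ} (hσ : 1 ≤ σ) {f : HOne L} {A : ℝ} (hf : SobBound σ f A) :
    SobBound σ (expH f - 1) (algConst L σ * A * Real.exp (algConst L σ * A)) := by
  simpa [expTaylor] using hf.exp_sub_taylor hσ le_rfl

/-! ### The free Schrödinger flow -/

/-- The symbol `e^{-i u_l² t / 2}` of the free flow. -/
noncomputable def phase (L t : ℝ) (l : ℤ) : ℂ :=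
  Complex.exp (-Complex.I * ((freq L l ^ 2 * t / 2 : ℝ) : ℂ))

theorem norm_phase (L t : ℝ) (l : ℤ) : ‖phase L t l‖ = 1 := by
  rw [phase, neg_mul, ← mul_neg, mul_comm, ← Complex.ofReal_neg, Complex.norm_exp_ofReal_mul_I]

theorem phase_add (L s t : ℝ) (l : ℤ) : phase L (s + t) l = phase L s l * phase L t l := by
  rw [phase, phase, phase, ← Complex.exp_add]
  congr 1; push_cast; ring

theorem phase_zero (L : ℝ) (l : ℤ) : phase L 0 l = 1 := by simp [phase]

theorem seqBound_phase {σ : ℝ} (t : ℝ) {f : HOne L} {A : ℝ} (hf : SobBound σ f A) :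
    SeqBound (weight L σ) (fun l => phase L t l * coeff f l) A :=
  (SeqBound.of_le hf zero_le_one (weight_nonneg L σ) fun l => by
    rw [norm_mul, norm_phase, one_mul, one_mul]).mono (one_mul A).le

/-- The free Schrödinger flow `e^{i t ∂ₓ² / 2}`. -/
noncomputable def freeFlow (t : ℝ) : HOne L →ₗ[ℂ] HOne L where
  toFun f := ofCoeff fun l => phase L t l * coeff f l
  map_add' f g := by
    obtain ⟨A, hA⟩ := f.exists_bound
    obtain ⟨B, hB⟩ := g.exists_bound
    refine HOne.ext_coeff fun l => ?_
    rw [coeff_add, coeff_ofCoeff (seqBound_phase t (SobBound.add hA hB)),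
      coeff_ofCoeff (seqBound_phase t hA), coeff_ofCoeff (seqBound_phase t hB)]
    simp only [coeff_add, mul_add]
  map_smul' c f := by
    obtain ⟨A, hA⟩ := f.exists_bound
    refine HOne.ext_coeff fun l => ?_
    rw [RingHom.id_apply, coeff_smul, coeff_ofCoeff (seqBound_phase t (SobBound.smul hA c)),
      coeff_ofCoeff (seqBound_phase t hA)]
    simp only [coeff_smul, mul_left_comm]

theorem coeff_freeFlow (t : ℝ) (f : HOne L) (l : ℤ) :
    coeff (freeFlow t f) l = phase L t l * coeff f l := by
  obtain ⟨A, hA⟩ := f.exists_bound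
  exact congrFun (coeff_ofCoeff (seqBound_phase t hA)) l

theorem freeFlow_add (s t : ℝ) (f : HOne L) : freeFlow (s + t) f = freeFlow s (freeFlow t f) :=
  HOne.ext_coeff fun l => by simp only [coeff_freeFlow, phase_add, mul_assoc]

theorem freeFlow_zero (f : HOne L) : freeFlow 0 f = f :=
  HOne.ext_coeff fun l => by rw [coeff_freeFlow, phase_zero, one_mul]

theorem SobBound.freeFlow {σ : ℝ} (t : ℝ) {f : HOne L} {A : ℝ} (hf : SobBound σ f A) :
    SobBound σ (freeFlow t f) A := by
  have := seqBound_phase t hf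
  unfold SobBound
  convert this using 1
  ext l; exact coeff_freeFlow t f l

theorem freq_sq_le_weight (L : ℝ) (l : ℤ) : freq L l ^ 2 ≤ weight L 2 l := by
  rw [weight_two]; linarith

/-- A Fourier multiplier with symbol of order `d` loses `d` derivatives. -/
theorem SobBound.of_symbol {σ d c : ℝ} {f g : HOne L} {A : ℝ} (hf : SobBound (σ + d) f A)
    (hc : 0 ≤ c) {m : ℤ → ℂ} (hm : ∀ l, ‖m l‖ ≤ c * weight L d l)
    (hg : ∀ l, coeff g l = m l * coeff f l) : SobBound σ g (c * A) :=
  SeqBound.of_le hf hc (weight_nonneg L σ) fun l => by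
    rw [hg, norm_mul, weight_add]
    calc weight L σ l * (‖m l‖ * ‖coeff f l‖)
        ≤ weight L σ l * (c * weight L d l * ‖coeff f l‖) := by
          have := weight_nonneg L σ l
          gcongr
          exact hm l
      _ = _ := by ring

theorem SobBound.freeFlow_sub_self {σ : ℝ} (t : ℝ) {f : HOne L} {A : ℝ}
    (hf : SobBound (σ + 2) f A) : SobBound σ (RandomNLS.freeFlow t f - f) (|t| * A) := by
  refine hf.of_symbol (abs_nonneg t) (m := fun l => phase L t l - 1) (fun l => ?_) fun l => by
    rw [map_sub, Pi.sub_apply, coeff_freeFlow]; ring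
  have h := Real.norm_exp_I_mul_ofReal_sub_one_le (x := -(freq L l ^ 2 * t / 2))
  have e : phase L t l = Complex.exp (Complex.I * ((-(freq L l ^ 2 * t / 2) : ℝ) : ℂ)) := by
    rw [phase]; congr 1; push_cast; ring
  rw [e]
  refine h.trans ?_
  rw [Real.norm_eq_abs, abs_neg, abs_div, abs_mul, abs_of_nonneg (sq_nonneg _), abs_two]
  have := freq_sq_le_weight L l
  have := abs_nonneg t
  nlinarith [sq_nonneg (freq L l)]

theorem weight_four (L : ℝ) (l : ℤ) : weight L 4 l = weight L 2 l ^ 2 := by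
  rw [sq, ← weight_add]; norm_num

/-- Bound for the symbol of a second difference or of a second order Taylor remainder. -/
theorem sq_half_le_weight (L t : ℝ) (l : ℤ) :
    (freq L l ^ 2 * t / 2) ^ 2 ≤ t ^ 2 * weight L 4 l := by
  rw [weight_four]
  have h1 := freq_sq_le_weight L l
  have h2 : (freq L l ^ 2) ^ 2 ≤ weight L 2 l ^ 2 := pow_le_pow_left₀ (sq_nonneg _) h1 2
  have h3 : 0 ≤ t ^ 2 := sq_nonneg t
  nlinarith [sq_nonneg (weight L 2 l), mul_le_mul_of_nonneg_left h2 h3,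
    mul_nonneg h3 (sq_nonneg (weight L 2 l))]

theorem norm_exp_sub_one_sub_le (θ : ℝ) :
    ‖Complex.exp (-Complex.I * θ) - 1 + Complex.I * θ‖ ≤ 2 * θ ^ 2 := by
  rcases le_total |θ| 1 with h | h
  · have := Complex.norm_exp_sub_one_sub_id_le (x := -Complex.I * θ) (by simpa using h)
    simp only [neg_mul, sub_neg_eq_add, norm_neg, norm_mul, Complex.norm_I, one_mul,
      Complex.norm_real, Real.norm_eq_abs, sq_abs] at this
    rw [neg_mul]
    nlinarith [sq_nonneg θ]
  · have h1 := Real.norm_exp_I_mul_ofReal_sub_one_le (x := -θ)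
    have h2 : ‖Complex.I * (θ : ℂ)‖ = |θ| := by simp
    have h3 : -Complex.I * (θ : ℂ) = Complex.I * ((-θ : ℝ) : ℂ) := by push_cast; ring
    rw [h3]
    rw [Real.norm_eq_abs, abs_neg] at h1
    have h4 : ‖Complex.exp (Complex.I * ((-θ : ℝ) : ℂ)) - 1 + Complex.I * θ‖ ≤ 2 * |θ| := by
      refine (norm_add_le _ _).trans ?_
      rw [h2]; linarith
    rw [← sq_abs]; nlinarith

/-- The kinetic energy operator `-∂ₓ² / 2`. -/
noncomputable def kinetic (f : HOne L) : HOne L :=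
  ofCoeff fun l => ((freq L l ^ 2 / 2 : ℝ) : ℂ) * coeff f l

theorem norm_kinetic_symbol_le (L : ℝ) (l : ℤ) :
    ‖((freq L l ^ 2 / 2 : ℝ) : ℂ)‖ ≤ 1 * weight L 2 l := by
  rw [Complex.norm_real, Real.norm_of_nonneg (by positivity), one_mul]
  have := freq_sq_le_weight L l
  nlinarith [sq_nonneg (freq L l)]

theorem coeff_kinetic {f : HOne L} {A : ℝ} (hf : SobBound 3 f A) (l : ℤ) :
    coeff (kinetic f) l = ((freq L l ^ 2 / 2 : ℝ) : ℂ) * coeff f l := by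
  refine congrFun (coeff_ofCoeff (B := A) ?_) l
  refine (SeqBound.of_le hf zero_le_one (weight_nonneg L 1) fun l => ?_).mono (one_mul A).le
  have h3 : weight L 3 l = weight L 1 l * weight L 2 l := by rw [← weight_add]; norm_num
  rw [h3, norm_mul, one_mul, mul_assoc]
  have := norm_kinetic_symbol_le L l
  have := weight_nonneg L 1 l
  rw [one_mul] at *
  gcongr

theorem SobBound.kinetic {σ : ℝ} (hσ : 1 ≤ σ) {f : HOne L} {A : ℝ} (hf : SobBound (σ + 2) f A) :
    SobBound σ (kinetic f) A :=
  (hf.of_symbol zero_le_one (norm_kinetic_symbol_le L) fun l =>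
    coeff_kinetic (hf.weaken (by linarith)) l).mono (one_mul A).le

theorem SobBound.freeFlow_taylor {σ : ℝ} (hσ : 1 ≤ σ) (t : ℝ) {f : HOne L} {A : ℝ}
    (hf : SobBound (σ + 4) f A) :
    SobBound σ (RandomNLS.freeFlow t f - f + (Complex.I * t) • RandomNLS.kinetic f)
      (2 * t ^ 2 * A) := by
  refine hf.of_symbol (by positivity)
    (m := fun l => phase L t l - 1 + Complex.I * ((freq L l ^ 2 * t / 2 : ℝ) : ℂ))
    (fun l => ?_) fun l => ?_
  · refine (norm_exp_sub_one_sub_le _).trans ?_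
    have := sq_half_le_weight L t l
    linarith
  · rw [coeff_add, coeff_sub, coeff_smul, coeff_freeFlow,
      coeff_kinetic (hf.weaken (by linarith))]
    push_cast; ring

theorem SobBound.freeFlow_second {σ : ℝ} (t : ℝ) {f : HOne L} {A : ℝ}
    (hf : SobBound (σ + 4) f A) :
    SobBound σ (RandomNLS.freeFlow t f + RandomNLS.freeFlow (-t) f - (f + f))
      (4 * t ^ 2 * A) := by
  refine hf.of_symbol (by positivity)
    (m := fun l => phase L t l + phase L (-t) l - 2) (fun l => ?_) fun l => ?_
  · have h1 := norm_exp_sub_one_sub_le (freq L l ^ 2 * t / 2)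
    have h2 := norm_exp_sub_one_sub_le (freq L l ^ 2 * (-t) / 2)
    have e : phase L t l + phase L (-t) l - 2 =
        (Complex.exp (-Complex.I * ((freq L l ^ 2 * t / 2 : ℝ) : ℂ)) - 1 +
          Complex.I * ((freq L l ^ 2 * t / 2 : ℝ) : ℂ)) +
        (Complex.exp (-Complex.I * ((freq L l ^ 2 * (-t) / 2 : ℝ) : ℂ)) - 1 +
          Complex.I * ((freq L l ^ 2 * (-t) / 2 : ℝ) : ℂ)) := by
      unfold phase; push_cast; ring
    rw [e]
    refine (norm_add_le _ _).trans ?_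
    have h3 := sq_half_le_weight L t l
    have h4 := sq_half_le_weight L (-t) l
    rw [neg_sq] at h4
    linarith
  · rw [coeff_sub, coeff_add, coeff_add, coeff_freeFlow, coeff_freeFlow]; ring

/-! ### Trigonometric interpolation -/

/-- The values of a function on the grid. -/
noncomputable def gridValues (M : ℕ) (f : C(Torus L, ℂ)) : Fin M → ℂ :=
  fun k => f (gridPoint L M k : Torus L)

theorem fourier_coe_eq (l : ℤ) (x : ℝ) :
    (fourier l : C(Torus L, ℂ)) (x : Torus L) =
      Complex.exp (Complex.I * ((freq L l * x : ℝ) : ℂ)) := by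
  have hL : (L : ℂ) ≠ 0 := by exact_mod_cast (pos_of_fact (L := L)).ne'
  rw [fourier_coe_apply]
  congr 1
  unfold freq
  push_cast
  field_simp

/-- Orthogonality of the characters on the grid; since `M` is even, the shift of the grid by `L`
does not enter. -/
theorem sum_grid_character {M : ℕ} (hM : 0 < M) (hE : Even M) (q l : ℤ) :
    (1 / (M : ℂ)) * ∑ k : Fin M, (fourier q : C(Torus L, ℂ)) (gridPoint L M k : Torus L) *
      Complex.exp (-Complex.I * ((freq L l * (gridPoint L M k + L) : ℝ) : ℂ)) *
      Complex.exp (Complex.I * ((freq L l * L : ℝ) : ℂ)) = if (M : ℤ) ∣ q - l then 1 else 0 := by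
  have hL : (L : ℂ) ≠ 0 := by exact_mod_cast (pos_of_fact (L := L)).ne'
  have hM' : (M : ℂ) ≠ 0 := by exact_mod_cast hM.ne'
  set d := q - l with hd
  set ζ : ℂ := Complex.exp (2 * Real.pi * Complex.I * d / M) with hζ
  have hterm : ∀ k : Fin M, (fourier q : C(Torus L, ℂ)) (gridPoint L M k : Torus L) *
      Complex.exp (-Complex.I * ((freq L l * (gridPoint L M k + L) : ℝ) : ℂ)) *
      Complex.exp (Complex.I * ((freq L l * L : ℝ) : ℂ)) =
      Complex.exp (-(Real.pi * Complex.I * d)) * ζ ^ (k : ℕ) := fun k => by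
    rw [fourier_coe_eq, hζ, ← Complex.exp_nat_mul, ← Complex.exp_add, ← Complex.exp_add,
      ← Complex.exp_add]
    congr 1
    unfold gridPoint freq
    rw [hd]
    push_cast
    field_simp
    ring
  rw [Finset.sum_congr rfl fun k _ => hterm k, ← Finset.mul_sum, Fin.sum_univ_eq_sum_range
    (fun k => ζ ^ k)]
  split_ifs with h
  · obtain ⟨c, hc⟩ := h
    obtain ⟨e, he⟩ := hE
    have h1 : ζ = 1 := by
      rw [hζ, Complex.exp_eq_one_iff]
      refine ⟨c, ?_⟩
      rw [hc]; push_cast; field_simp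
    have h2 : Complex.exp (-(Real.pi * Complex.I * d)) = 1 := by
      rw [Complex.exp_eq_one_iff]
      refine ⟨-(e * c), ?_⟩
      rw [hc, he]; push_cast; ring
    rw [h1, h2]
    simp [hM']
  · have h1 : ζ ≠ 1 := by
      rw [hζ, Ne, Complex.exp_eq_one_iff]
      rintro ⟨n, hn⟩
      apply h
      refine ⟨n, ?_⟩
      have h2 : (2 * Real.pi * Complex.I : ℂ) ≠ 0 := Complex.two_pi_I_ne_zero
      have h3 : (d : ℂ) = M * n := by
        have h4 : (2 * Real.pi * Complex.I : ℂ) * d = (2 * Real.pi * Complex.I) * (M * n) := by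
          rw [div_eq_iff hM'] at hn
          rw [hn]; ring
        exact mul_left_cancel₀ h2 h4
      exact_mod_cast h3
    have h2 : ζ ^ M = 1 := by
      rw [hζ, ← Complex.exp_nat_mul, Complex.exp_eq_one_iff]
      exact ⟨d, by field_simp⟩
    rw [geom_sum_eq h1, h2]
    simp

theorem HOne.hasSum_apply (f : HOne L) (x : Torus L) :
    HasSum (fun l => coeff f l * (fourier l : C(Torus L, ℂ)) x) ((f : C(Torus L, ℂ)) x) :=
  has_pointwise_sum_fourier_series_of_summable f.summable x

/-- Aliasing: the discrete Fourier coefficients are the sums of the Fourier coefficients over the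
residue classes modulo `M`. -/
theorem hasSum_discreteCoeff {M : ℕ} (hM : 0 < M) (hE : Even M) (f : HOne L) (l : ℤ) :
    HasSum (fun q => if (M : ℤ) ∣ q - l then coeff f q else 0)
      (discreteCoeff L (gridValues M (f : C(Torus L, ℂ))) l *
        Complex.exp (Complex.I * ((freq L l * L : ℝ) : ℂ))) := by
  have h1 := (hasSum_sum (s := Finset.univ) fun (k : Fin M) _ =>
    (((f.hasSum_apply (gridPoint L M k : Torus L)).mul_right
      (Complex.exp (-Complex.I * ((freq L l * (gridPoint L M k + L) : ℝ) : ℂ)))).mul_right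
      (Complex.exp (Complex.I * ((freq L l * L : ℝ) : ℂ))))).mul_left (1 / (M : ℂ))
  have e : discreteCoeff L (gridValues M (f : C(Torus L, ℂ))) l *
      Complex.exp (Complex.I * ((freq L l * L : ℝ) : ℂ)) = (1 / (M : ℂ)) * ∑ k : Fin M,
        (f : C(Torus L, ℂ)) (gridPoint L M k : Torus L) *
          Complex.exp (-Complex.I * ((freq L l * (gridPoint L M k + L) : ℝ) : ℂ)) *
          Complex.exp (Complex.I * ((freq L l * L : ℝ) : ℂ)) := by
    unfold discreteCoeff
    rw [mul_assoc, Finset.sum_mul]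
    rfl
  rw [e]
  refine h1.congr_fun fun q => ?_
  have h2 : (if (M : ℤ) ∣ q - l then coeff f q else 0) =
      coeff f q * if (M : ℤ) ∣ q - l then 1 else 0 := by split_ifs <;> simp
  rw [h2, ← sum_grid_character (L := L) hM hE q l, Finset.mul_sum, Finset.mul_sum, Finset.mul_sum]
  exact Finset.sum_congr rfl fun k _ => by ring

/-- The trigonometric interpolant of a grid function as an element of `H¹(𝕋)`. -/
noncomputable def interpH {M : ℕ} (φ : Fin M → ℂ) : HOne L :=
  ofCoeff fun l => if l ∈ modes M then
    discreteCoeff L φ l * Complex.exp (Complex.I * ((freq L l * L : ℝ) : ℂ)) else 0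

theorem coeff_interpH {M : ℕ} (φ : Fin M → ℂ) (l : ℤ) :
    coeff (interpH φ : HOne L) l = if l ∈ modes M then
      discreteCoeff L φ l * Complex.exp (Complex.I * ((freq L l * L : ℝ) : ℂ)) else 0 :=
  congrFun (coeff_ofCoeff (seqBound_of_finite (σ := 1) (modes M) fun l hl => by simp [hl])) l

theorem apply_eq_sum_modes {M : ℕ} {f : HOne L} (hf : ∀ l ∉ modes M, coeff f l = 0)
    (x : Torus L) :
    (f : C(Torus L, ℂ)) x = ∑ l ∈ modes M, coeff f l * (fourier l : C(Torus L, ℂ)) x :=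
  (f.hasSum_apply x).unique (hasSum_sum_of_ne_finset_zero fun l hl => by rw [hf l hl, zero_mul])

theorem fourier_apply_add {T : ℝ} (l : ℤ) (x y : AddCircle T) :
    (fourier l : C(AddCircle T, ℂ)) (x + y) =
      (fourier l : C(AddCircle T, ℂ)) x * (fourier l : C(AddCircle T, ℂ)) y := by
  simp [fourier_apply, smul_add, AddCircle.toCircle_add]

theorem interpH_apply {M : ℕ} (φ : Fin M → ℂ) (x : Torus L) :
    ((interpH φ : HOne L) : C(Torus L, ℂ)) x = interp φ x := by
  rw [apply_eq_sum_modes (fun l hl => by rw [coeff_interpH, if_neg hl]), interp]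
  refine Finset.sum_congr rfl fun l hl => ?_
  rw [coeff_interpH, if_pos hl, fourier_apply_add, fourier_coe_eq l L]
  ring

/-- The interpolation operator `I_M`. -/
noncomputable def interpolate (M : ℕ) (f : HOne L) : HOne L :=
  interpH (gridValues M (f : C(Torus L, ℂ)))

theorem interpolate_sub {M : ℕ} (f g : HOne L) :
    interpolate M (f - g) = interpolate M f - interpolate M g := by
  refine HOne.ext_coeff fun l => ?_
  rw [coeff_sub, interpolate, interpolate, interpolate, coeff_interpH, coeff_interpH,
    coeff_interpH]
  split_ifs
  · rw [← sub_mul]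
    congr 1
    unfold discreteCoeff
    rw [← mul_sub, ← Finset.sum_sub_distrib]
    congr 1
    refine Finset.sum_congr rfl fun k _ => ?_
    rw [← sub_mul]
    rfl
  · simp

theorem seqBound_proj {σ : ℝ} (M : ℕ) {f : HOne L} {A : ℝ} (hf : SobBound σ f A) :
    SeqBound (weight L σ) (fun l => if l ∈ modes M then coeff f l else 0) A :=
  (SeqBound.of_le hf zero_le_one (weight_nonneg L σ) fun l => by
    rw [one_mul]
    refine mul_le_mul_of_nonneg_left ?_ (weight_nonneg L σ l)
    split_ifs <;> simp).mono (one_mul A).le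

/-- The `L²`-orthogonal projection `P_M` onto the trigonometric polynomials with modes in
`modes M`. -/
noncomputable def proj (M : ℕ) (f : HOne L) : HOne L :=
  ofCoeff fun l => if l ∈ modes M then coeff f l else 0

theorem coeff_proj (M : ℕ) (f : HOne L) (l : ℤ) :
    coeff (proj M f) l = if l ∈ modes M then coeff f l else 0 := by
  obtain ⟨A, hA⟩ := f.exists_bound
  exact congrFun (coeff_ofCoeff (seqBound_proj M hA)) l

theorem SobBound.proj {σ : ℝ} (M : ℕ) {f : HOne L} {A : ℝ} (hf : SobBound σ f A) :
    SobBound σ (proj M f) A := by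
  have := seqBound_proj M hf
  unfold SobBound
  convert this using 1
  ext l; exact coeff_proj M f l

theorem proj_sub (M : ℕ) (f g : HOne L) : proj M (f - g) = proj M f - proj M g :=
  HOne.ext_coeff fun l => by
    simp only [coeff_proj, coeff_sub]; split_ifs <;> simp

theorem proj_add (M : ℕ) (f g : HOne L) : proj M (f + g) = proj M f + proj M g :=
  HOne.ext_coeff fun l => by
    simp only [coeff_proj, coeff_add]; split_ifs <;> simp

theorem proj_freeFlow (M : ℕ) (t : ℝ) (f : HOne L) :
    proj M (freeFlow t f) = freeFlow t (proj M f) :=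
  HOne.ext_coeff fun l => by
    simp only [coeff_proj, coeff_freeFlow]; split_ifs <;> simp

theorem mem_modes {M : ℕ} {l : ℤ} : l ∈ modes M ↔ -((M : ℤ) / 2) ≤ l ∧ l < (M : ℤ) / 2 :=
  Finset.mem_Ico

/-- `I_M` reproduces trigonometric polynomials. -/
theorem interpolate_eq_self {M : ℕ} (hM : 0 < M) (hE : Even M) {f : HOne L}
    (hf : ∀ l ∉ modes M, coeff f l = 0) : interpolate M f = f := by
  refine HOne.ext_coeff fun l => ?_
  rw [interpolate, coeff_interpH]
  split_ifs with hl
  · refine (hasSum_discreteCoeff hM hE f l).unique ?_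
    refine (hasSum_ite_eq l (coeff f l)).congr_fun fun q => ?_
    by_cases hq : q = l
    · simp [hq]
    · rw [if_neg hq]
      split_ifs with hd
      · refine hf q fun hqm => hq ?_
        rw [mem_modes] at hqm hl
        obtain ⟨c, hc⟩ := hd
        obtain ⟨e, he⟩ := hE
        have h1 : |(M : ℤ) * c| < M := by rw [abs_lt]; omega
        rw [abs_mul, abs_of_pos (by exact_mod_cast hM : (0 : ℤ) < M)] at h1
        have h2 : |c| < 1 := by
          by_contra! h
          nlinarith
        rw [Int.abs_lt_one_iff] at h2
        rw [h2] at hc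
        omega
      · rfl
  · exact (hf l hl).symm

/-- Modes with `|l| ≥ j M / 2` have frequencies of size at least `j / h`. -/
theorem le_abs_freq {M : ℕ} (hM : 0 < M) (l : ℤ) {j : ℝ} (h : j * M ≤ 2 * |(l : ℝ)|) :
    j / (2 * L / M) ≤ |freq L l| := by
  have hL : 0 < L := pos_of_fact
  have hM' : (0 : ℝ) < M := by exact_mod_cast hM
  have hpi := Real.pi_gt_three
  unfold freq
  rw [abs_div, abs_mul, abs_of_pos Real.pi_pos, abs_of_pos hL, div_le_div_iff₀ (by positivity) hL]
  have e : Real.pi * |(l : ℝ)| * (2 * L / M) = Real.pi * (2 * |(l : ℝ)|) * L / M := by ring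
  rw [e, le_div_iff₀ hM']
  have : j * M * L ≤ Real.pi * (2 * |(l : ℝ)|) * L := by
    apply mul_le_mul_of_nonneg_right _ hL.le
    nlinarith [abs_nonneg (l : ℝ)]
  linarith

/-- The projection error: `σ - 1` powers of the mesh size are gained in `H¹`. -/
theorem SobBound.sub_proj {M : ℕ} (hM : 0 < M) (hE : Even M) {σ : ℝ} (hσ : 1 ≤ σ)
    {f : HOne L} {A : ℝ} (hf : SobBound σ f A) :
    SobBound 1 (f - RandomNLS.proj M f) ((2 * L / M) ^ (σ - 1) * A) := by
  have hL : 0 < L := pos_of_fact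
  have hM' : (0 : ℝ) < M := by exact_mod_cast hM
  set h : ℝ := 2 * L / M with hh
  have hpos : 0 < h := by positivity
  refine SeqBound.of_le hf (by positivity) (weight_nonneg L 1) fun l => ?_
  rw [coeff_sub, coeff_proj]
  split_ifs with hl
  · simp only [sub_self, norm_zero, mul_zero]
    have := weight_nonneg L σ l
    positivity
  · rw [sub_zero]
    have h1 : (1 : ℝ) * M ≤ 2 * |(l : ℝ)| := by
      rw [mem_modes] at hl
      obtain ⟨e, he⟩ := hE
      have : (M : ℤ) ≤ 2 * |l| := by
        rcases abs_cases l with ⟨h, _⟩ | ⟨h, _⟩ <;> omega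
      rw [one_mul]; exact_mod_cast this
    have h2 := le_abs_freq (L := L) hM l h1
    have h3 := rpow_le_weight (L := L) (sub_nonneg.2 hσ) (by positivity) h2
    have h4 : weight L σ l = weight L (σ - 1) l * weight L 1 l := by rw [← weight_add]; ring_nf
    rw [← hh, one_div, Real.inv_rpow hpos.le] at h3
    rw [h4]
    have h5 : 0 < h ^ (σ - 1) := Real.rpow_pos_of_pos hpos _
    have h6 : 1 ≤ h ^ (σ - 1) * weight L (σ - 1) l := by
      have := mul_le_mul_of_nonneg_left h3 h5.le
      rwa [mul_inv_cancel₀ h5.ne'] at this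
    have h7 := mul_nonneg (weight_nonneg L 1 l) (norm_nonneg (coeff f l))
    nlinarith

/-- The constant of the aliasing estimate. -/
noncomputable def aliasConst : ℝ :=
  Real.sqrt ((1 + Real.pi ^ 2) * ∑' j : ℤ, 1 / (j : ℝ) ^ 2)

theorem aliasConst_nonneg : 0 ≤ aliasConst := Real.sqrt_nonneg _

theorem hasSum_coeff_interpolate_sub_proj {M : ℕ} (hM : 0 < M) (hE : Even M) (f : HOne L) {l : ℤ}
    (hl : l ∈ modes M) :
    HasSum (fun j : ℤ => if j = 0 then 0 else coeff f (l + j * M))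
      (coeff (interpolate M f - proj M f) l) := by
  have hM' : (M : ℤ) ≠ 0 := by exact_mod_cast hM.ne'
  have hinj : Function.Injective fun j : ℤ => l + j * M := fun a b hab =>
    mul_right_cancel₀ hM' (add_left_cancel hab)
  have h1 := hasSum_discreteCoeff hM hE f l
  rw [← hinj.hasSum_iff] at h1
  · rw [coeff_sub, coeff_proj, if_pos hl, interpolate, coeff_interpH, if_pos hl]
    refine (h1.sub (hasSum_ite_eq (0 : ℤ) (coeff f l))).congr_fun fun j => ?_
    by_cases hj : j = 0 <;> simp [hj]
  · intro q hq
    rw [if_neg]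
    rintro ⟨c, hc⟩
    exact hq ⟨c, by simp only; linarith⟩

/-- The aliasing error: on `H^σ`, `σ ≥ 1`, interpolation and projection differ in `H¹` by
`O(h^(σ - 1))`. -/
theorem SobBound.interpolate_sub_proj {M : ℕ} (hM : 0 < M) (hE : Even M)
    (hh : 2 * L / M ≤ 1) {σ : ℝ} (hσ : 1 ≤ σ)
    {f : HOne L} {A : ℝ} (hf : SobBound σ f A) :
    SobBound 1 (interpolate M f - RandomNLS.proj M f)
      (aliasConst * (2 * L / M) ^ (σ - 1) * A) := by
  have hL : 0 < L := pos_of_fact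
  have hM' : (0 : ℝ) < M := by exact_mod_cast hM
  set h : ℝ := 2 * L / M with hhdef
  have hpos : 0 < h := by positivity
  have hD : 0 ≤ aliasConst * h ^ (σ - 1) := mul_nonneg aliasConst_nonneg (by positivity)
  have hZ : Summable fun j : ℤ => 1 / (j : ℝ) ^ 2 :=
    Real.summable_one_div_int_pow.mpr one_lt_two
  set Y : ℤ → ℝ≥0∞ := fun q =>
    (ENNReal.ofReal (weight L σ q) * ENNReal.ofReal ‖coeff f q‖) ^ 2 with hY
  have hYA : ∑' q, Y q ≤ ENNReal.ofReal A ^ 2 :=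
    (SeqBound.iff_tsum (weight_nonneg L σ) hf.1).1 hf
  set g := interpolate M f - RandomNLS.proj M f with hg
  have hterm : ∀ l ∈ modes M, (ENNReal.ofReal (weight L 1 l) * ENNReal.ofReal ‖coeff g l‖) ^ 2 ≤
      ENNReal.ofReal (aliasConst * h ^ (σ - 1)) ^ 2 * ∑' j : ℤ, Y (l + j * M) := by
    intro l hl
    have hs := hasSum_coeff_interpolate_sub_proj hM hE f hl
    rw [mem_modes] at hl
    have hlM : 2 * |(l : ℝ)| ≤ M := by
      have : 2 * |l| ≤ (M : ℤ) := by rcases abs_cases l with ⟨h, _⟩ | ⟨h, _⟩ <;> omega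
      exact_mod_cast this
    -- the modes hit by aliasing are large
    have hq : ∀ j : ℤ, j ≠ 0 → (weight L σ (l + j * M))⁻¹ ≤ h ^ σ * |(j : ℝ)|⁻¹ := by
      intro j hj
      have hj1 : (1 : ℝ) ≤ |(j : ℝ)| := by exact_mod_cast Int.one_le_abs hj
      have h1 : |(j : ℝ)| * M ≤ 2 * |((l + j * M : ℤ) : ℝ)| := by
        push_cast
        have h2 : |(j : ℝ) * M| ≤ |(l : ℝ) + j * M| + |(l : ℝ)| := by
          have := abs_sub ((l : ℝ) + j * M) l
          rwa [add_sub_cancel_left] at this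
        rw [abs_mul, abs_of_pos hM'] at h2
        nlinarith
      have h2 := le_abs_freq (L := L) hM _ h1
      have h3 := rpow_le_weight (L := L) (zero_le_one.trans hσ) (by positivity) h2
      rw [← hhdef, Real.div_rpow (abs_nonneg _) hpos.le] at h3
      have h4 : |(j : ℝ)| ≤ |(j : ℝ)| ^ σ := by
        simpa using Real.rpow_le_rpow_of_exponent_le hj1 hσ
      have h5 : 0 < h ^ σ := Real.rpow_pos_of_pos hpos _
      have h6 : |(j : ℝ)| / h ^ σ ≤ weight L σ (l + j * M) :=
        le_trans (div_le_div_of_nonneg_right h4 h5.le) h3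
      have h7 : (h ^ σ * |(j : ℝ)|⁻¹) = (|(j : ℝ)| / h ^ σ)⁻¹ := by rw [inv_div]; rfl
      rw [h7]
      exact inv_anti₀ (by positivity) h6
    set x : ℤ → ℝ≥0∞ := fun j => ENNReal.ofReal (h ^ σ * |(j : ℝ)|⁻¹) with hx
    set y : ℤ → ℝ≥0∞ := fun j =>
      ENNReal.ofReal (weight L σ (l + j * M)) * ENNReal.ofReal ‖coeff f (l + j * M)‖ with hy
    have e1 : ENNReal.ofReal ‖coeff g l‖ ≤ ∑' j, x j * y j := by
      have hsn : Summable fun j : ℤ => ‖if j = 0 then 0 else coeff f (l + j * M)‖ :=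
        hs.summable.norm
      rw [← hs.tsum_eq]
      refine (ENNReal.ofReal_le_ofReal (norm_tsum_le_tsum_norm hsn)).trans ?_
      rw [ENNReal.ofReal_tsum_of_nonneg (fun _ => norm_nonneg _) hsn]
      refine ENNReal.tsum_le_tsum fun j => ?_
      by_cases hj : j = 0
      · simp [hj]
      · rw [if_neg hj, hx, hy]
        simp only
        have hw := weight_pos L σ (l + j * M)
        rw [← mul_assoc, ← ENNReal.ofReal_mul (by positivity), ← ENNReal.ofReal_mul (by positivity)]
        refine ENNReal.ofReal_le_ofReal ?_
        have h1 := mul_le_mul_of_nonneg_right (hq j hj) hw.le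
        rw [inv_mul_cancel₀ hw.ne'] at h1
        have := mul_le_mul_of_nonneg_right h1 (norm_nonneg (coeff f (l + j * M)))
        linarith
    have e2 : ∑' j, x j ^ 2 = ENNReal.ofReal ((h ^ σ) ^ 2 * ∑' j : ℤ, 1 / (j : ℝ) ^ 2) := by
      rw [← tsum_mul_left, ENNReal.ofReal_tsum_of_nonneg (fun j => by positivity) (hZ.mul_left _)]
      refine tsum_congr fun j => ?_
      rw [hx]; simp only
      rw [← ENNReal.ofReal_pow (by positivity)]
      congr 1
      rw [mul_pow, inv_pow, sq_abs, one_div]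
    have e3 : weight L 1 l ^ 2 * ((h ^ σ) ^ 2 * ∑' j : ℤ, 1 / (j : ℝ) ^ 2) ≤
        (aliasConst * h ^ (σ - 1)) ^ 2 := by
      have hz0 : 0 ≤ ∑' j : ℤ, 1 / (j : ℝ) ^ 2 := tsum_nonneg fun j => by positivity
      have h1 : weight L 1 l ^ 2 * h ^ 2 ≤ 1 + Real.pi ^ 2 := by
        rw [weight_sq, Real.rpow_one]
        have h2 : |freq L l * h| ≤ Real.pi := by
          unfold freq
          rw [hhdef, abs_mul, abs_div, abs_mul, abs_of_pos Real.pi_pos, abs_of_pos hL,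
            abs_of_pos hpos]
          have : Real.pi * |(l : ℝ)| / L * (2 * L / M) = Real.pi * (2 * |(l : ℝ)| / M) := by
            field_simp
          rw [this]
          have h3 : 2 * |(l : ℝ)| / M ≤ 1 := (div_le_one hM').2 hlM
          nlinarith [Real.pi_pos]
        have h3 : (freq L l * h) ^ 2 ≤ Real.pi ^ 2 := by
          rw [← sq_abs]; exact pow_le_pow_left₀ (abs_nonneg _) h2 2
        nlinarith
      have h2 : h ^ σ = h ^ (σ - 1) * h := by
        rw [← Real.rpow_add_one hpos.ne']; ring_nf
      rw [mul_pow, aliasConst, Real.sq_sqrt (by positivity), h2]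
      calc weight L 1 l ^ 2 * ((h ^ (σ - 1) * h) ^ 2 * ∑' j : ℤ, 1 / (j : ℝ) ^ 2)
          = (weight L 1 l ^ 2 * h ^ 2) * (∑' j : ℤ, 1 / (j : ℝ) ^ 2) * (h ^ (σ - 1)) ^ 2 := by ring
        _ ≤ _ := by gcongr
    calc (ENNReal.ofReal (weight L 1 l) * ENNReal.ofReal ‖coeff g l‖) ^ 2
        ≤ (ENNReal.ofReal (weight L 1 l) * ∑' j, x j * y j) ^ 2 := by gcongr
      _ ≤ ENNReal.ofReal (weight L 1 l) ^ 2 * ((∑' j, x j ^ 2) * ∑' j, y j ^ 2) := by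
          rw [mul_pow]; gcongr; exact ENNReal_tsum_mul_sq_le x y
      _ ≤ _ := by
          rw [← mul_assoc, e2, ← ENNReal.ofReal_pow (weight_nonneg L 1 l),
            ← ENNReal.ofReal_mul (sq_nonneg _), ← ENNReal.ofReal_pow hD]
          gcongr
  refine (SeqBound.iff_tsum (weight_nonneg L 1) (mul_nonneg hD hf.1)).2 ?_
  rw [tsum_eq_sum (s := modes M) fun l hl => by
    rw [hg, coeff_sub, coeff_proj, interpolate, coeff_interpH, if_neg hl, if_neg hl]; simp]
  refine (Finset.sum_le_sum hterm).trans ?_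
  rw [← Finset.mul_sum, ENNReal.ofReal_mul hD, mul_pow]
  gcongr
  refine le_trans ?_ hYA
  -- the residue classes of the modes are disjoint
  have hinj : Function.Injective fun p : modes M × ℤ => (p.1 : ℤ) + p.2 * M := by
    rintro ⟨⟨a, ha⟩, j⟩ ⟨⟨b, hb⟩, k⟩ hab
    simp only at hab
    rw [mem_modes] at ha hb
    have hMz : (0 : ℤ) < M := by exact_mod_cast hM
    have hjk : j = k := by
      by_contra hne
      have h1 : (1 : ℤ) ≤ |j - k| := Int.one_le_abs (sub_ne_zero.2 hne)
      have h2 : |(j - k) * M| < M := by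
        rw [abs_lt]; constructor <;> · rw [sub_mul]; omega
      rw [abs_mul, abs_of_pos hMz] at h2
      nlinarith
    subst hjk
    have : a = b := by omega
    subst this
    rfl
  calc ∑ l ∈ modes M, ∑' j : ℤ, Y (l + j * M)
      = ∑' l : modes M, ∑' j : ℤ, Y (l + j * M) :=
        (Finset.tsum_subtype (modes M) fun l => ∑' j : ℤ, Y (l + j * M)).symm
    _ = ∑' p : modes M × ℤ, Y ((p.1 : ℤ) + p.2 * M) :=
        (ENNReal.tsum_prod (f := fun (l : modes M) (j : ℤ) => Y (l + j * M))).symm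
    _ ≤ ∑' q, Y q := ENNReal.tsum_comp_le_tsum_of_injective hinj Y

/-- Interpolation is bounded on `H¹`, uniformly in the grid. -/
theorem SobBound.interpolate {M : ℕ} (hM : 0 < M) (hE : Even M) (hh : 2 * L / M ≤ 1)
    {f : HOne L} {A : ℝ}
    (hf : SobBound 1 f A) : SobBound 1 (interpolate M f) ((aliasConst + 1) * A) := by
  have h := (hf.interpolate_sub_proj hM hE hh le_rfl).add (hf.proj M)
  rw [sub_add_cancel, sub_self, Real.rpow_zero] at h
  exact h.mono (by linarith)

end

/-! ### Time integrals -/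

/-- Minkowski's integral inequality for weighted `ℓ²` norms. -/
theorem SeqBound.of_integral {w : ℤ → ℝ} {g : ℝ → ℤ → ℂ} {a b : ℝ}
    (hab : a ≤ b) {k : ℝ → ℝ} (hg : ∀ t ∈ Set.Icc a b, SeqBound w (g t) (k t))
    (hc : ∀ l, ContinuousOn (fun t => g t l) (Set.Icc a b)) (hk : ContinuousOn k (Set.Icc a b))
    {f : ℤ → ℂ} (hf : ∀ l, f l = ∫ t in a..b, g t l) : SeqBound w f (∫ t in a..b, k t) := by
  have hK : 0 ≤ ∫ t in a..b, k t :=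
    intervalIntegral.integral_nonneg hab fun t ht => (hg t ht).nonneg
  refine ⟨hK, fun F => ?_⟩
  set X := ∑ l ∈ F, (w l * ‖f l‖) ^ 2 with hX
  have hX0 : 0 ≤ X := Finset.sum_nonneg fun _ _ => sq_nonneg _
  have hgi : ∀ l, IntervalIntegrable (fun t => g t l) volume a b := fun l =>
    ContinuousOn.intervalIntegrable_of_Icc hab (hc l)
  have hki : IntervalIntegrable k volume a b := hk.intervalIntegrable_of_Icc hab
  have hqi : ∀ l, IntervalIntegrable (fun t => w l ^ 2 * (Star.star (f l) * g t l).re)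
      volume a b := by
    intro l
    have h1 : ContinuousOn (fun t => w l ^ 2 * (Star.star (f l) * g t l).re) (Set.Icc a b) :=
      continuousOn_const.mul (Complex.continuous_re.comp_continuousOn
        (continuousOn_const.mul (hc l)))
    exact h1.intervalIntegrable_of_Icc hab
  have e1 : X = ∫ t in a..b, ∑ l ∈ F, w l ^ 2 * (Star.star (f l) * g t l).re := by
    rw [intervalIntegral.integral_finsetSum fun l _ => hqi l]
    refine Finset.sum_congr rfl fun l _ => ?_
    rw [intervalIntegral.integral_const_mul]
    have h1 := Complex.reCLM.intervalIntegral_comp_comm ((hgi l).const_mul (Star.star (f l)))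
    simp only [Complex.reCLM_apply] at h1
    rw [h1, intervalIntegral.integral_const_mul, ← hf l, mul_pow]
    congr 1
    have h2 := Complex.conj_mul' (f l)
    rw [← starRingEnd_apply, h2]
    norm_cast
  have h2 : ∀ t ∈ Set.Icc a b, ∑ l ∈ F, w l ^ 2 * (Star.star (f l) * g t l).re ≤
      Real.sqrt X * k t := by
    intro t ht
    have hcs := Finset.sum_mul_sq_le_sq_mul_sq F (fun l => |w l| * ‖f l‖)
      (fun l => |w l| * ‖g t l‖)
    simp only [mul_pow, sq_abs] at hcs
    simp only [← mul_pow] at hcs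
    have h3 : (∑ l ∈ F, |w l| * ‖f l‖ * (|w l| * ‖g t l‖)) ^ 2 ≤ (Real.sqrt X * k t) ^ 2 := by
      rw [mul_pow, Real.sq_sqrt hX0]
      exact hcs.trans (mul_le_mul_of_nonneg_left ((hg t ht).2 F) hX0)
    refine le_trans (Finset.sum_le_sum fun l _ => ?_) (abs_le_of_sq_le_sq' h3
      (mul_nonneg (Real.sqrt_nonneg _) (hg t ht).nonneg)).2
    have h4 : (Star.star (f l) * g t l).re ≤ ‖f l‖ * ‖g t l‖ := by
      refine (Complex.re_le_norm _).trans ?_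
      rw [norm_mul, norm_star]
    calc w l ^ 2 * (Star.star (f l) * g t l).re ≤ w l ^ 2 * (‖f l‖ * ‖g t l‖) :=
          mul_le_mul_of_nonneg_left h4 (sq_nonneg _)
      _ = _ := by rw [← sq_abs]; ring
  have h3 : X ≤ Real.sqrt X * ∫ t in a..b, k t := by
    rw [← intervalIntegral.integral_const_mul]
    conv_lhs => rw [e1]
    have hsum := IntervalIntegrable.sum F fun l _ => hqi l
    rw [Finset.sum_fn] at hsum
    exact intervalIntegral.integral_mono_on hab hsum (hki.const_mul _) h2
  rcases hX0.eq_or_lt with h0 | h0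
  · rw [← h0]; positivity
  · have h4 : 0 < Real.sqrt X := Real.sqrt_pos.2 h0
    have h5 : Real.sqrt X ≤ ∫ t in a..b, k t := by
      have h6 := Real.mul_self_sqrt hX0
      by_contra! hlt
      nlinarith
    calc X = Real.sqrt X ^ 2 := (Real.sq_sqrt hX0).symm
      _ ≤ _ := pow_le_pow_left₀ h4.le h5 2

/-- A common constant for the product estimates in `H¹`, `H³` and `H⁵`. -/
noncomputable def scaleConst (L : ℝ) : ℝ := 4 * (algConst L 1 + algConst L 3 + algConst L 5)

theorem le_scaleConst (L : ℝ) : 4 * algConst L 1 ≤ scaleConst L ∧ 4 * algConst L 3 ≤ scaleConst L ∧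
    4 * algConst L 5 ≤ scaleConst L := by
  have h1 := one_le_algConst L 1
  have h3 := one_le_algConst L 3
  have h5 := one_le_algConst L 5
  unfold scaleConst
  refine ⟨?_, ?_, ?_⟩ <;> linarith

section

variable {L : ℝ} [Fact (0 < L)]

theorem SobBound.of_integral {σ : ℝ} {g : ℝ → HOne L} {a b : ℝ} (hab : a ≤ b) {K : ℝ}
    (hg : ∀ t ∈ Set.Icc a b, SobBound σ (g t) K)
    (hc : ∀ l, ContinuousOn (fun t => coeff (g t) l) (Set.Icc a b))
    {f : HOne L} (hf : ∀ l, coeff f l = ∫ t in a..b, coeff (g t) l) :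
    SobBound σ f ((b - a) * K) := by
  have := SeqBound.of_integral hab (g := fun t => coeff (g t)) (k := fun _ => K) hg hc
    continuousOn_const hf
  rwa [intervalIntegral.integral_const, smul_eq_mul] at this

/-! ### The nonlinearity and mild solutions -/

/-- The right-hand side `-i (W f + α |f|² f)` of the equation in the interaction picture. -/
noncomputable def nonlin (α : ℝ) (W f : HOne L) : HOne L :=
  -Complex.I • (W * f + (α : ℂ) • (f * star f * f))

/-- A bound for the nonlinearity in an algebra with product constant `k`. -/
noncomputable def cubicBound (α k R B : ℝ) : ℝ := k * (R * B) + |α| * (k * (k * (B * B) * B))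

theorem cubicBound_nonneg {α k R B : ℝ} (hk : 0 ≤ k) (hR : 0 ≤ R) (hB : 0 ≤ B) :
    0 ≤ cubicBound α k R B := by unfold cubicBound; positivity

theorem SobBound.nonlin {σ : ℝ} (hσ : 1 ≤ σ) (α : ℝ) {W f : HOne L} {R B : ℝ}
    (hW : SobBound σ W R) (hf : SobBound σ f B) :
    SobBound σ (nonlin α W f) (cubicBound α (algConst L σ) R B) := by
  have h := ((hW.mul hσ hf).add ((((hf.mul hσ hf.star).mul hσ hf).smul (α : ℂ)))).smul (-Complex.I)
  refine h.mono (le_of_eq ?_)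
  simp [cubicBound]

/-- Mild solutions: Duhamel's formula in the interaction picture, coefficient by coefficient. -/
structure IsMild (α T : ℝ) (W : HOne L) (ψ : ℝ → HOne L) : Prop where
  real : star W = W
  cont : ∀ l, ContinuousOn (fun t => coeff (nonlin α W (ψ t)) l) (Set.Icc 0 T)
  duhamel : ∀ a ∈ Set.Icc 0 T, ∀ b ∈ Set.Icc 0 T, a ≤ b → ∀ l,
    coeff (freeFlow (-b) (ψ b)) l - coeff (freeFlow (-a) (ψ a)) l =
      ∫ t in a..b, coeff (freeFlow (-t) (nonlin α W (ψ t))) l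

/-! ### Regularity in time in the scale `H⁵ ⊂ H³ ⊂ H¹` -/

/-- Curves bounded in `H⁵` and Lipschitz continuous in `H³` on `[0, T]`. -/
structure LipBound (T : ℝ) (a : ℝ → HOne L) (A : ℝ) : Prop where
  bound : ∀ t ∈ Set.Icc 0 T, SobBound 5 (a t) A
  lip : ∀ t ∈ Set.Icc 0 T, ∀ t' ∈ Set.Icc 0 T, SobBound 3 (a t - a t') (A * |t - t'|)

/-- Curves that moreover have second differences of order `r²` in `H¹`. As in `LipBound`, each order
in time costs two derivatives in space; second differences replace second time derivatives. -/
structure SecondBound (T : ℝ) (a : ℝ → HOne L) (A : ℝ) : Prop extends LipBound T a A where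
  second : ∀ t r : ℝ, 0 ≤ r → t ∈ Set.Icc 0 T → t - r ∈ Set.Icc 0 T → t + r ∈ Set.Icc 0 T →
    SobBound 1 (a (t + r) + a (t - r) - (a t + a t)) (A * r ^ 2)

section Scale

variable {T A B : ℝ} {a b : ℝ → HOne L}

theorem LipBound.mono (h : LipBound T a A) (hAB : A ≤ B) : LipBound T a B where
  bound t ht := (h.bound t ht).mono hAB
  lip t ht t' ht' := (h.lip t ht t' ht').mono (mul_le_mul_of_nonneg_right hAB (abs_nonneg _))

theorem SecondBound.mono (h : SecondBound T a A) (hAB : A ≤ B) : SecondBound T a B where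
  toLipBound := h.toLipBound.mono hAB
  second t r hr h1 h2 h3 :=
    (h.second t r hr h1 h2 h3).mono (mul_le_mul_of_nonneg_right hAB (sq_nonneg _))

theorem LipBound.mul (ha : LipBound T a A) (hb : LipBound T b B) :
    LipBound T (fun t => a t * b t) (scaleConst L * (A * B)) where
  bound t ht := by
    have h := (ha.bound t ht).mul (by norm_num) (hb.bound t ht)
    refine h.mono ?_
    have hAB := mul_nonneg (ha.bound t ht).nonneg (hb.bound t ht).nonneg
    exact mul_le_mul_of_nonneg_right (by linarith [le_scaleConst L, algConst_pos L 5]) hAB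
  lip t ht t' ht' := by
    have h1 := (ha.lip t ht t' ht').mul (by norm_num) ((hb.bound t ht).weaken (by norm_num))
    have h2 := ((ha.bound t' ht').weaken (by norm_num)).mul (by norm_num) (hb.lip t ht t' ht')
    have e : a t * b t - a t' * b t' = (a t - a t') * b t + a t' * (b t - b t') := by ring
    rw [e]
    refine (h1.add h2).mono ?_
    have hAB := mul_nonneg (mul_nonneg (ha.bound t ht).nonneg (hb.bound t ht).nonneg)
      (abs_nonneg (t - t'))
    have hk := (le_scaleConst L).2.1
    have := algConst_pos L 3
    nlinarith [mul_le_mul_of_nonneg_right hk hAB, mul_nonneg this.le hAB]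

theorem SecondBound.mul (ha : SecondBound T a A) (hb : SecondBound T b B) :
    SecondBound T (fun t => a t * b t) (scaleConst L * (A * B)) where
  toLipBound := ha.toLipBound.mul hb.toLipBound
  second t r hr h1 h2 h3 := by
    have l1 := ((ha.lip _ h3 _ h1).weaken (σ' := 1) (by norm_num)).mul le_rfl
      ((hb.lip _ h3 _ h1).weaken (by norm_num))
    have l2 := ((ha.lip _ h2 _ h1).weaken (σ' := 1) (by norm_num)).mul le_rfl
      ((hb.lip _ h2 _ h1).weaken (by norm_num))
    have l3 := (ha.second t r hr h1 h2 h3).mul le_rfl ((hb.bound t h1).weaken (by norm_num))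
    have l4 := ((ha.bound t h1).weaken (by norm_num)).mul le_rfl (hb.second t r hr h1 h2 h3)
    have e : a (t + r) * b (t + r) + a (t - r) * b (t - r) - (a t * b t + a t * b t) =
        (a (t + r) - a t) * (b (t + r) - b t) + (a (t - r) - a t) * (b (t - r) - b t) +
        (a (t + r) + a (t - r) - (a t + a t)) * b t +
        a t * (b (t + r) + b (t - r) - (b t + b t)) := by ring
    rw [e]
    refine (((l1.add l2).add l3).add l4).mono ?_
    rw [add_sub_cancel_left, sub_sub_cancel_left, abs_neg, abs_of_nonneg hr]
    have hAB := mul_nonneg (mul_nonneg (ha.bound t h1).nonneg (hb.bound t h1).nonneg)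
      (sq_nonneg r)
    have hk := (le_scaleConst L).1
    nlinarith [mul_le_mul_of_nonneg_right hk hAB]

theorem LipBound.add (ha : LipBound T a A) (hb : LipBound T b B) :
    LipBound T (fun t => a t + b t) (A + B) where
  bound t ht := (ha.bound t ht).add (hb.bound t ht)
  lip t ht t' ht' := by
    rw [add_sub_add_comm, add_mul]
    exact (ha.lip t ht t' ht').add (hb.lip t ht t' ht')

theorem SecondBound.add (ha : SecondBound T a A) (hb : SecondBound T b B) :
    SecondBound T (fun t => a t + b t) (A + B) where
  toLipBound := ha.toLipBound.add hb.toLipBound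
  second t r hr h1 h2 h3 := by
    have e : a (t + r) + b (t + r) + (a (t - r) + b (t - r)) - (a t + b t + (a t + b t)) =
        (a (t + r) + a (t - r) - (a t + a t)) + (b (t + r) + b (t - r) - (b t + b t)) := by ring
    rw [e, add_mul]
    exact (ha.second t r hr h1 h2 h3).add (hb.second t r hr h1 h2 h3)

theorem LipBound.smul (ha : LipBound T a A) (c : ℂ) :
    LipBound T (fun t => c • a t) (‖c‖ * A) where
  bound t ht := (ha.bound t ht).smul c
  lip t ht t' ht' := by
    rw [← smul_sub, mul_assoc]
    exact (ha.lip t ht t' ht').smul c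

theorem SecondBound.smul (ha : SecondBound T a A) (c : ℂ) :
    SecondBound T (fun t => c • a t) (‖c‖ * A) where
  toLipBound := ha.toLipBound.smul c
  second t r hr h1 h2 h3 := by
    rw [← smul_add, ← smul_add, ← smul_sub, mul_assoc]
    exact (ha.second t r hr h1 h2 h3).smul c

theorem LipBound.star (ha : LipBound T a A) : LipBound T (fun t => star (a t)) A where
  bound t ht := (ha.bound t ht).star
  lip t ht t' ht' := by
    have e : Star.star (a t) - Star.star (a t') = Star.star (a t - a t') := (star_sub _ _).symm
    rw [e]
    exact (ha.lip t ht t' ht').star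

theorem SecondBound.star (ha : SecondBound T a A) : SecondBound T (fun t => star (a t)) A where
  toLipBound := ha.toLipBound.star
  second t r hr h1 h2 h3 := by
    have e : Star.star (a (t + r)) + Star.star (a (t - r)) - (Star.star (a t) + Star.star (a t)) =
        Star.star (a (t + r) + a (t - r) - (a t + a t)) := by
      rw [star_sub, star_add, star_add]
    rw [e]
    exact (ha.second t r hr h1 h2 h3).star

theorem secondBound_const {f : HOne L} (hf : SobBound 5 f A) : SecondBound T (fun _ => f) A where
  bound _ _ := hf
  lip t _ t' _ := by
    rw [sub_self]
    exact SobBound.zero.mono (mul_nonneg hf.nonneg (abs_nonneg _))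
  second t r hr _ _ _ := by
    rw [sub_self]
    exact SobBound.zero.mono (mul_nonneg hf.nonneg (sq_nonneg _))

/-- The regularity scale is preserved by the free flow, since `e^{i t ∂ₓ² / 2} - 1` is of order `t`
at the cost of two derivatives. The constant `7` is the one needed for second differences, where
four terms contribute. -/
theorem LipBound.freeFlow {c : ℝ} (hc : |c| ≤ 1) (ha : LipBound T a A) :
    LipBound T (fun t => freeFlow (c * t) (a t)) (7 * A) where
  bound t ht := ((ha.bound t ht).freeFlow (c * t)).mono (by linarith [(ha.bound t ht).nonneg])
  lip t ht t' ht' := by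
    have hA := (ha.bound t ht).nonneg
    have e : RandomNLS.freeFlow (c * t) (a t) - RandomNLS.freeFlow (c * t') (a t') =
        RandomNLS.freeFlow (c * t) (a t - a t') + RandomNLS.freeFlow (c * t')
          (RandomNLS.freeFlow (c * (t - t')) (a t') - a t') := by
      rw [map_sub, map_sub, ← freeFlow_add]
      have : c * t' + c * (t - t') = c * t := by ring
      rw [this]; abel
    rw [e]
    have h1 := (ha.lip t ht t' ht').freeFlow (c * t)
    have h2 := (SobBound.freeFlow_sub_self (σ := 3) (c * (t - t'))
      ((ha.bound t' ht').weaken (by norm_num))).freeFlow (c * t')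
    refine (h1.add h2).mono ?_
    rw [abs_mul]
    have h3 : |c| * |t - t'| ≤ |t - t'| := mul_le_of_le_one_left (abs_nonneg _) hc
    nlinarith [mul_le_mul_of_nonneg_right h3 hA, mul_nonneg hA (abs_nonneg (t - t'))]

theorem SecondBound.freeFlow {c : ℝ} (hc : |c| ≤ 1) (ha : SecondBound T a A) :
    SecondBound T (fun t => freeFlow (c * t) (a t)) (7 * A) where
  toLipBound := ha.toLipBound.freeFlow hc
  second t r hr h1 h2 h3 := by
    have hA := (ha.bound t h1).nonneg
    have e : RandomNLS.freeFlow (c * (t + r)) (a (t + r)) +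
        RandomNLS.freeFlow (c * (t - r)) (a (t - r)) -
        (RandomNLS.freeFlow (c * t) (a t) + RandomNLS.freeFlow (c * t) (a t)) =
        RandomNLS.freeFlow (c * t)
          ((RandomNLS.freeFlow (c * r) (a (t + r) - a t) - (a (t + r) - a t)) +
          (RandomNLS.freeFlow (-(c * r)) (a (t - r) - a t) - (a (t - r) - a t)) +
          (RandomNLS.freeFlow (c * r) (a t) + RandomNLS.freeFlow (-(c * r)) (a t) - (a t + a t)) +
          (a (t + r) + a (t - r) - (a t + a t))) := by
      have e1 : c * (t + r) = c * t + c * r := by ring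
      have e2 : c * (t - r) = c * t + -(c * r) := by ring
      rw [e1, e2, freeFlow_add, freeFlow_add]
      simp only [map_add, map_sub]
      abel
    rw [e]
    have l1 := SobBound.freeFlow_sub_self (σ := 1) (c * r)
      ((ha.lip _ h3 _ h1).weaken (by norm_num))
    have l2 := SobBound.freeFlow_sub_self (σ := 1) (-(c * r))
      ((ha.lip _ h2 _ h1).weaken (by norm_num))
    have l3 := SobBound.freeFlow_second (σ := 1) (c * r) ((ha.bound t h1).weaken (by norm_num))
    have l4 := ha.second t r hr h1 h2 h3
    refine (SobBound.freeFlow (c * t) (((l1.add l2).add l3).add l4)).mono ?_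
    rw [add_sub_cancel_left, sub_sub_cancel_left, abs_neg, abs_neg, abs_mul, abs_of_nonneg hr,
      mul_pow, ← sq_abs c]
    have h4 : |c| ^ 2 ≤ 1 := by nlinarith [abs_nonneg c]
    have h5 := mul_nonneg hA (sq_nonneg r)
    nlinarith [mul_le_mul_of_nonneg_right hc h5, mul_le_mul_of_nonneg_right h4 h5]

theorem LipBound.nonlin (α : ℝ) {W : HOne L} {R : ℝ} (hW : SobBound 5 W R) (ha : LipBound T a A) :
    LipBound T (fun t => nonlin α W (a t)) (cubicBound α (scaleConst L) R A) := by
  have hW' : LipBound T (fun _ => W) R := (secondBound_const hW).toLipBound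
  refine (((hW'.mul ha).add (((ha.mul ha.star).mul ha).smul (α : ℂ))).smul (-Complex.I)).mono
    (le_of_eq ?_)
  simp [cubicBound]

theorem SecondBound.nonlin (α : ℝ) {W : HOne L} {R : ℝ} (hW : SobBound 5 W R)
    (ha : SecondBound T a A) :
    SecondBound T (fun t => nonlin α W (a t)) (cubicBound α (scaleConst L) R A) := by
  refine ((((secondBound_const hW).mul ha).add
    (((ha.mul ha.star).mul ha).smul (α : ℂ))).smul (-Complex.I)).mono (le_of_eq ?_)
  simp [cubicBound]

end Scale

theorem continuous_phase (L : ℝ) (l : ℤ) : Continuous fun t => phase L t l := by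
  unfold phase; fun_prop

section Mild

variable {α T : ℝ} {W : HOne L} {ψ : ℝ → HOne L}

theorem IsMild.continuousOn_coeff (h : IsMild α T W ψ) (l : ℤ) :
    ContinuousOn (fun t => coeff (freeFlow (-t) (nonlin α W (ψ t))) l) (Set.Icc 0 T) := by
  simp only [coeff_freeFlow]
  exact ((continuous_phase L l).comp continuous_neg).continuousOn.mul (h.cont l)

theorem Icc_subset_of_mem {a b : ℝ} (ha : a ∈ Set.Icc 0 T) (hb : b ∈ Set.Icc 0 T) :
    Set.Icc a b ⊆ Set.Icc 0 T := Set.Icc_subset_Icc ha.1 hb.2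

theorem IsMild.increment_bound (h : IsMild α T W ψ) {σ K a b : ℝ} (ha : a ∈ Set.Icc 0 T)
    (hb : b ∈ Set.Icc 0 T) (hab : a ≤ b)
    (hG : ∀ t ∈ Set.Icc a b, SobBound σ (nonlin α W (ψ t)) K) :
    SobBound σ (freeFlow (-b) (ψ b) - freeFlow (-a) (ψ a)) ((b - a) * K) :=
  SobBound.of_integral hab (fun t ht => (hG t ht).freeFlow (-t))
    (fun l => (h.continuousOn_coeff l).mono (Icc_subset_of_mem ha hb))
    fun l => by rw [coeff_sub]; exact h.duhamel a ha b hb hab l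

/-- The increments of the interaction picture over `[t, t + r]` and `[t - r, t]`, as integrals over
`[0, r]`. -/
theorem IsMild.increments (h : IsMild α T W ψ) {t r : ℝ} (hr : 0 ≤ r) (h1 : t ∈ Set.Icc 0 T)
    (h2 : t - r ∈ Set.Icc 0 T) (h3 : t + r ∈ Set.Icc 0 T) (l : ℤ) :
    (∫ ρ in (0 : ℝ)..r, coeff (freeFlow (-(t + ρ)) (nonlin α W (ψ (t + ρ)))) l =
      coeff (freeFlow (-(t + r)) (ψ (t + r))) l - coeff (freeFlow (-t) (ψ t)) l) ∧
    (∫ ρ in (0 : ℝ)..r, coeff (freeFlow (-(t - ρ)) (nonlin α W (ψ (t - ρ)))) l =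
      coeff (freeFlow (-t) (ψ t)) l - coeff (freeFlow (-(t - r)) (ψ (t - r))) l) ∧
    ContinuousOn (fun ρ => coeff (freeFlow (-(t + ρ)) (nonlin α W (ψ (t + ρ)))) l) (Set.Icc 0 r) ∧
    ContinuousOn (fun ρ => coeff (freeFlow (-(t - ρ)) (nonlin α W (ψ (t - ρ)))) l)
      (Set.Icc 0 r) := by
  refine ⟨?_, ?_, ?_, ?_⟩
  · rw [intervalIntegral.integral_comp_add_left
      (fun ρ => coeff (freeFlow (-ρ) (nonlin α W (ψ ρ))) l) t, add_zero]
    exact (h.duhamel _ h1 _ h3 (by linarith) l).symm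
  · rw [intervalIntegral.integral_comp_sub_left
      (fun ρ => coeff (freeFlow (-ρ) (nonlin α W (ψ ρ))) l) t, sub_zero]
    exact (h.duhamel _ h2 _ h1 (by linarith) l).symm
  · refine (h.continuousOn_coeff l).comp (t := Set.Icc 0 T) (f := fun ρ => t + ρ)
      (by fun_prop) fun ρ hρ => ?_
    exact ⟨by linarith [h1.1, hρ.1], by linarith [h3.2, hρ.2]⟩
  · refine (h.continuousOn_coeff l).comp (t := Set.Icc 0 T) (f := fun ρ => t - ρ)
      (by fun_prop) fun ρ hρ => ?_
    exact ⟨by linarith [h2.1, hρ.2], by linarith [h1.2, hρ.1]⟩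

/-- A mild solution that is bounded in `H⁵`, and its nonlinearity in the interaction picture, are
twice differentiable in time in the sense of `SecondBound`, with uniform constants. -/
theorem exists_secondBound (L : ℝ) [Fact (0 < L)] (α R B : ℝ) : ∃ C, ∀ (T : ℝ) (W : HOne L)
    (ψ : ℝ → HOne L), IsMild α T W ψ → SobBound 5 W R → (∀ t ∈ Set.Icc 0 T, SobBound 5 (ψ t) B) →
    SecondBound T ψ C ∧ SecondBound T (fun t => freeFlow (-t) (nonlin α W (ψ t))) C := by
  set N₀ := cubicBound α (algConst L 5) R B
  set B₁ := 7 * (B + |N₀|) with hB₁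
  set G₁ := 7 * cubicBound α (scaleConst L) R B₁
  set B₂ := 7 * (B + |N₀| + 2 * |G₁|)
  set G₂ := 7 * cubicBound α (scaleConst L) R B₂
  refine ⟨max B₂ G₂, fun T W ψ h hW hψ => ?_⟩
  have neg_one_mul_flow : ∀ (t : ℝ) (f : HOne L), freeFlow (-1 * t) f = freeFlow (-t) f :=
    fun t f => by rw [neg_one_mul]
  set v : ℝ → HOne L := fun t => freeFlow (-t) (ψ t) with hv
  have hψv : ψ = fun t => freeFlow (1 * t) (v t) := by
    funext t
    rw [hv]; simp only
    rw [← freeFlow_add, one_mul, add_neg_cancel, freeFlow_zero]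
  -- in turn: `v` is Lipschitz, so `ψ` and the nonlinearity are; hence, by Duhamel's formula, `v`
  -- has second differences of order `r²`, so `ψ` and the nonlinearity have them too
  have hN : ∀ t ∈ Set.Icc 0 T, SobBound 5 (nonlin α W (ψ t)) N₀ := fun t ht =>
    hW.nonlin (by norm_num) α (hψ t ht)
  have hvinc : ∀ a ∈ Set.Icc 0 T, ∀ b ∈ Set.Icc 0 T, a ≤ b →
      SobBound 3 (v b - v a) ((B + |N₀|) * |b - a|) := fun a ha b hb hab => by
    refine ((h.increment_bound ha hb hab fun t ht => hN t (Icc_subset_of_mem ha hb ht)).weaken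
      (by norm_num)).mono ?_
    rw [abs_of_nonneg (sub_nonneg.2 hab), mul_comm]
    refine mul_le_mul_of_nonneg_right ?_ (sub_nonneg.2 hab)
    linarith [(hψ a ha).nonneg, le_abs_self N₀]
  have hvL : LipBound T v (B + |N₀|) :=
    { bound := fun t ht => ((hψ t ht).freeFlow (-t)).mono (by linarith [abs_nonneg N₀])
      lip := fun t ht t' ht' => by
        rcases le_total t t' with hle | hle
        · rw [abs_sub_comm]
          exact (hvinc t ht t' ht' hle).sub_comm
        · exact hvinc t' ht' t ht hle }
  have hψL : LipBound T ψ B₁ := by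
    rw [hψv]; exact hvL.freeFlow (by simp)
  have hGL : LipBound T (fun t => freeFlow (-t) (nonlin α W (ψ t))) G₁ := by
    have := (hψL.nonlin α hW).freeFlow (c := -1) (by simp)
    simpa only [neg_one_mul_flow] using this
  have hvS : SecondBound T v (B + |N₀| + 2 * |G₁|) :=
    { toLipBound := hvL.mono (by linarith [abs_nonneg G₁])
      second := fun t r hr h1 h2 h3 => by
        have hinc := h.increments hr h1 h2 h3
        have key := SobBound.of_integral hr (σ := 3) (K := |G₁| * (2 * r))
          (g := fun ρ => freeFlow (-(t + ρ)) (nonlin α W (ψ (t + ρ))) -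
            freeFlow (-(t - ρ)) (nonlin α W (ψ (t - ρ)))) (f := v (t + r) + v (t - r) - (v t + v t))
          (fun ρ hρ => by
            have m1 : t + ρ ∈ Set.Icc 0 T :=
              ⟨by linarith [h1.1, hρ.1], by linarith [h3.2, hρ.2]⟩
            have m2 : t - ρ ∈ Set.Icc 0 T :=
              ⟨by linarith [h2.1, hρ.2], by linarith [h1.2, hρ.1]⟩
            refine (hGL.lip _ m1 _ m2).mono ?_
            have e : t + ρ - (t - ρ) = 2 * ρ := by ring
            rw [e, abs_of_nonneg (by linarith [hρ.1])]
            exact mul_le_mul (le_abs_self _) (by linarith [hρ.2]) (by linarith [hρ.1])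
              (abs_nonneg _))
          (fun l => by
            simp only [coeff_sub]
            exact (hinc l).2.2.1.sub (hinc l).2.2.2)
          (fun l => by
            simp only [coeff_sub, coeff_add]
            rw [intervalIntegral.integral_sub
              ((hinc l).2.2.1.intervalIntegrable_of_Icc hr)
              ((hinc l).2.2.2.intervalIntegrable_of_Icc hr), (hinc l).1, (hinc l).2.1]
            ring)
        refine (key.weaken (by norm_num)).mono ?_
        have hB := (hψ t h1).nonneg
        have := mul_nonneg (add_nonneg hB (abs_nonneg N₀)) (sq_nonneg r)
        nlinarith }
  have hψS : SecondBound T ψ B₂ := by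
    rw [hψv]; exact hvS.freeFlow (by simp)
  have hGS : SecondBound T (fun t => freeFlow (-t) (nonlin α W (ψ t))) G₂ := by
    have := (hψS.nonlin α hW).freeFlow (c := -1) (by simp)
    simpa only [neg_one_mul_flow] using this
  exact ⟨hψS.mono (le_max_left _ _), hGS.mono (le_max_right _ _)⟩

/-- The midpoint rule for Duhamel's integral. -/
theorem IsMild.midpoint (h : IsMild α T W ψ) {C : ℝ}
    (hG : SecondBound T (fun t => freeFlow (-t) (nonlin α W (ψ t))) C) {t r : ℝ} (hr : 0 ≤ r)
    (h1 : t ∈ Set.Icc 0 T) (h2 : t - r ∈ Set.Icc 0 T) (h3 : t + r ∈ Set.Icc 0 T) :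
    SobBound 1 (freeFlow (-(t + r)) (ψ (t + r)) - freeFlow (-(t - r)) (ψ (t - r)) -
      ((2 * r : ℝ) : ℂ) • freeFlow (-t) (nonlin α W (ψ t))) (C * r ^ 3) := by
  have hinc := h.increments hr h1 h2 h3
  have hC : 0 ≤ C := (hG.bound t h1).nonneg
  refine (SobBound.of_integral hr (σ := 1) (K := C * r ^ 2)
    (g := fun ρ => freeFlow (-(t + ρ)) (nonlin α W (ψ (t + ρ))) +
      freeFlow (-(t - ρ)) (nonlin α W (ψ (t - ρ))) -
      (freeFlow (-t) (nonlin α W (ψ t)) + freeFlow (-t) (nonlin α W (ψ t))))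
    (fun ρ hρ => ?_) (fun l => ?_) (fun l => ?_)).mono (le_of_eq (by ring))
  · have m1 : t + ρ ∈ Set.Icc 0 T := ⟨by linarith [h1.1, hρ.1], by linarith [h3.2, hρ.2]⟩
    have m2 : t - ρ ∈ Set.Icc 0 T := ⟨by linarith [h2.1, hρ.2], by linarith [h1.2, hρ.1]⟩
    exact (hG.second t ρ hρ.1 h1 m2 m1).mono
      (mul_le_mul_of_nonneg_left (pow_le_pow_left₀ hρ.1 hρ.2 2) hC)
  · simp only [coeff_sub, coeff_add]
    exact ((hinc l).2.2.1.add (hinc l).2.2.2).sub continuousOn_const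
  · simp only [coeff_sub, coeff_add, coeff_smul]
    have i1 := (hinc l).2.2.1.intervalIntegrable_of_Icc (μ := volume) hr
    have i2 := (hinc l).2.2.2.intervalIntegrable_of_Icc (μ := volume) hr
    rw [intervalIntegral.integral_sub (i1.add i2) intervalIntegrable_const,
      intervalIntegral.integral_add i1 i2, (hinc l).1, (hinc l).2.1,
      intervalIntegral.integral_const]
    simp only [sub_zero, Complex.real_smul]
    push_cast
    ring

/-- The rectangle rule for Duhamel's integral. -/
theorem IsMild.rectangle (h : IsMild α T W ψ) {C : ℝ}
    (hG : LipBound T (fun t => freeFlow (-t) (nonlin α W (ψ t))) C) {a b c : ℝ} (hab : a ≤ b)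
    (ha : a ∈ Set.Icc 0 T) (hb : b ∈ Set.Icc 0 T) (hc : c ∈ Set.Icc a b) :
    SobBound 3 (freeFlow (-b) (ψ b) - freeFlow (-a) (ψ a) -
      ((b - a : ℝ) : ℂ) • freeFlow (-c) (nonlin α W (ψ c))) (C * (b - a) ^ 2) := by
  have hC : 0 ≤ C := (hG.bound a ha).nonneg
  have hsub := Icc_subset_of_mem ha hb
  have hcont := fun l => (h.continuousOn_coeff l).mono hsub
  refine (SobBound.of_integral hab (σ := 3) (K := C * (b - a))
    (g := fun ρ => freeFlow (-ρ) (nonlin α W (ψ ρ)) - freeFlow (-c) (nonlin α W (ψ c)))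
    (fun ρ hρ => ?_) (fun l => ?_) (fun l => ?_)).mono (le_of_eq (by ring))
  · refine (hG.lip ρ (hsub hρ) c (hsub hc)).mono (mul_le_mul_of_nonneg_left ?_ hC)
    rw [abs_le]
    exact ⟨by linarith [hρ.1, hc.2], by linarith [hρ.2, hc.1]⟩
  · simp only [coeff_sub]
    exact (hcont l).sub continuousOn_const
  · simp only [coeff_sub, coeff_smul]
    rw [intervalIntegral.integral_sub ((hcont l).intervalIntegrable_of_Icc hab)
      intervalIntegrable_const, ← h.duhamel a ha b hb hab l, intervalIntegral.integral_const,
      Complex.real_smul]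

end Mild

/-! ### The potential step -/

/-- The generator `-i (W + α |φ|²)` of the potential step. -/
noncomputable def stepGen (α : ℝ) (W φ : HOne L) : HOne L :=
  -Complex.I • (W + (α : ℂ) • (φ * star φ))

/-- The increment `(e^{-i τ (W + α |φ|²)} - 1) φ` of the potential step. -/
noncomputable def stepIncr (α τ : ℝ) (W φ : HOne L) : HOne L :=
  (expH ((τ : ℂ) • stepGen α W φ) - 1) * φ

theorem nonlin_eq (α : ℝ) (W f : HOne L) : nonlin α W f = stepGen α W f * f := by
  rw [nonlin, stepGen, smul_mul_assoc, add_mul, smul_mul_assoc]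

theorem star_stepGen {α : ℝ} {W : HOne L} (hW : star W = W) (φ : HOne L) :
    star (stepGen α W φ) = -stepGen α W φ := by
  rw [stepGen, star_smul, star_add, star_smul, star_mul, star_star, hW]
  simp [add_comm]

/-- A bound for the generator in an algebra with product constant `k`. -/
noncomputable def genBound (α k R B : ℝ) : ℝ := R + |α| * (k * (B * B))

theorem genBound_nonneg {α k R B : ℝ} (hk : 0 ≤ k) (hR : 0 ≤ R) (hB : 0 ≤ B) :
    0 ≤ genBound α k R B := by unfold genBound; positivity

theorem SobBound.stepGen {σ : ℝ} (hσ : 1 ≤ σ) (α : ℝ) {W φ : HOne L} {R B : ℝ}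
    (hW : SobBound σ W R) (hφ : SobBound σ φ B) :
    SobBound σ (stepGen α W φ) (genBound α (algConst L σ) R B) := by
  refine ((hW.add ((hφ.mul hσ hφ.star).smul (α : ℂ))).smul (-Complex.I)).mono (le_of_eq ?_)
  simp [genBound]

theorem SobBound.real_smul {σ : ℝ} {f : HOne L} {A τ : ℝ} (hf : SobBound σ f A) (hτ : 0 ≤ τ) :
    SobBound σ ((τ : ℂ) • f) (τ * A) := by
  have := hf.smul (τ : ℂ)
  rwa [Complex.norm_real, Real.norm_of_nonneg hτ] at this

/-- The remainder bound for the exponential of a multiple `τ • f`, `τ ≤ 1`. -/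
theorem SobBound.exp_smul_sub_taylor {σ : ℝ} (hσ : 1 ≤ σ) {f : HOne L} {A τ : ℝ}
    (hf : SobBound σ f A) (hτ : 0 ≤ τ) (hτ1 : τ ≤ 1) {k : ℕ} (hk : 1 ≤ k) :
    SobBound σ (expH ((τ : ℂ) • f) - expTaylor k ((τ : ℂ) • f))
      ((algConst L σ * A) ^ k * Real.exp (algConst L σ * A) * τ ^ k) := by
  refine ((hf.real_smul hτ).exp_sub_taylor hσ hk).mono ?_
  have hA := mul_nonneg (algConst_pos L σ).le hf.nonneg
  have e : algConst L σ * (τ * A) = algConst L σ * A * τ := by ring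
  rw [e, mul_pow, mul_right_comm]
  have : algConst L σ * A * τ ≤ algConst L σ * A := mul_le_of_le_one_right hA hτ1
  gcongr

theorem expTaylor_one (f : HOne L) : expTaylor 1 f = 1 := by simp [expTaylor]

theorem expTaylor_two (f : HOne L) : expTaylor 2 f = 1 + f := by
  simp [expTaylor, Finset.sum_range_succ]

theorem expTaylor_three_add_self (h : HOne L) : expTaylor 3 (h + h) = 1 + (h + h) + 2 * h ^ 2 := by
  have e : (h + h) ^ 2 = (2 : ℂ) • (2 * h ^ 2) := by rw [two_smul]; ring
  rw [expTaylor, Finset.sum_range_succ, Finset.sum_range_succ, Finset.sum_range_one, e, smul_smul]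
  simp

/-- The increment of the potential step is of order `τ`. -/
theorem exists_stepIncr_bound (L : ℝ) [Fact (0 < L)] (α : ℝ) {σ R B : ℝ} (hσ : 1 ≤ σ)
    (hR : 0 ≤ R) (hB : 0 ≤ B) : ∃ C, 0 ≤ C ∧ ∀ (W φ : HOne L) (τ : ℝ), 0 ≤ τ → τ ≤ 1 →
      SobBound σ W R → SobBound σ φ B → SobBound σ (stepIncr α τ W φ) (C * τ) := by
  set k := algConst L σ
  have hk : 0 ≤ k := (algConst_pos L σ).le
  set g := genBound α k R B
  have hg : 0 ≤ g := genBound_nonneg hk hR hB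
  refine ⟨k * ((k * g) ^ 1 * Real.exp (k * g) * B), by positivity, fun W φ τ h0 h1 hW hφ => ?_⟩
  have := ((hW.stepGen hσ α hφ).exp_smul_sub_taylor hσ h0 h1 le_rfl).mul hσ hφ
  rw [expTaylor_one] at this
  exact this.mono (le_of_eq (by ring))

theorem SobBound.min {σ : ℝ} {f : HOne L} {A B : ℝ} (hA : SobBound σ f A) (hB : SobBound σ f B) :
    SobBound σ f (min A B) := by
  rcases min_cases A B with ⟨h, _⟩ | ⟨h, _⟩ <;> rw [h] <;> assumption

/-- The increment of the potential step is Lipschitz continuous with constant `O(τ)`. -/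
theorem exists_stepIncr_lipschitz (L : ℝ) [Fact (0 < L)] (α : ℝ) {R B : ℝ} (hR : 0 ≤ R)
    (hB : 0 ≤ B) : ∃ C, 0 ≤ C ∧ ∀ (W φ φ' : HOne L) (τ D : ℝ), 0 ≤ τ → τ ≤ 1 → SobBound 1 W R →
      SobBound 1 φ B → SobBound 1 φ' B → SobBound 1 (φ - φ') D →
      SobBound 1 (stepIncr α τ W φ - stepIncr α τ W φ') (C * τ * D) := by
  set k := algConst L 1
  have hk : 0 ≤ k := (algConst_pos L 1).le
  set g := genBound α k R B
  have hg : 0 ≤ g := genBound_nonneg hk hR hB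
  set E := k * g * Real.exp (k * g)
  have hE : 0 ≤ E := by positivity
  set p := |α| * (2 * k * B)
  have hp : 0 ≤ p := by positivity
  set P := k * p * Real.exp (k * (p * (2 * B)))
  have hP : 0 ≤ P := by positivity
  refine ⟨k * E + k * (k * ((E + 1) * P) * B), by positivity,
    fun W φ φ' τ D h0 h1 hW hφ hφ' hD => ?_⟩
  have hD' := hD.min (hφ.sub hφ')
  set D' := Min.min D (B + B)
  have hD'0 : 0 ≤ D' := hD'.nonneg
  have hDD : D' ≤ D := min_le_left _ _
  have hDB : D' ≤ 2 * B := (min_le_right _ _).trans (by linarith)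
  set x := (τ : ℂ) • stepGen α W φ with hx
  set x' := (τ : ℂ) • stepGen α W φ' with hx'
  have e1 : stepIncr α τ W φ - stepIncr α τ W φ' =
      (expH x - 1) * (φ - φ') + (expH x' * (expH (x - x') - 1)) * φ' := by
    have : expH x = expH x' * expH (x - x') := by rw [← expH_add]; congr 1; ring
    rw [stepIncr, stepIncr, ← hx, ← hx', this]
    ring
  have b1 : SobBound 1 (expH x - 1) (E * τ) := by
    have := (hW.stepGen le_rfl α hφ).exp_smul_sub_taylor le_rfl h0 h1 le_rfl
    rw [expTaylor_one, pow_one, pow_one] at this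
    exact this
  have b2 : SobBound 1 (expH x') (E + 1) := by
    have := (hW.stepGen le_rfl α hφ').exp_smul_sub_taylor le_rfl h0 h1 le_rfl
    rw [expTaylor_one, pow_one, pow_one] at this
    have h2 := this.add SobBound.one
    rw [sub_add_cancel] at h2
    exact h2.mono (by linarith [mul_le_of_le_one_right hE h1])
  have b3 : SobBound 1 (x - x') (τ * (p * D')) := by
    have e : x - x' = (τ : ℂ) • (-Complex.I • ((α : ℂ) •
        ((φ - φ') * star φ + φ' * star (φ - φ')))) := by
      have e3 : (φ - φ') * star φ + φ' * star (φ - φ') = φ * star φ - φ' * star φ' := by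
        rw [star_sub]; ring
      rw [hx, hx', ← smul_sub, stepGen, stepGen, ← smul_sub, e3, smul_sub (α : ℂ)]
      congr 2
      abel
    rw [e]
    refine (((((hD'.mul le_rfl hφ.star).add (hφ'.mul le_rfl hD'.star)).smul (α : ℂ)).smul
      (-Complex.I)).real_smul h0).mono (le_of_eq ?_)
    simp only [norm_neg, Complex.norm_I, one_mul, Complex.norm_real, Real.norm_eq_abs]
    ring
  have b4 : SobBound 1 (expH (x - x') - 1) (P * (τ * D')) := by
    refine (b3.exp_sub_one le_rfl).mono ?_
    have h2 : τ * (p * D') ≤ p * (2 * B) := by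
      calc τ * (p * D') ≤ 1 * (p * (2 * B)) := by gcongr
        _ = _ := one_mul _
    calc k * (τ * (p * D')) * Real.exp (k * (τ * (p * D')))
        ≤ k * (τ * (p * D')) * Real.exp (k * (p * (2 * B))) := by gcongr
      _ = _ := by ring
  rw [e1]
  refine ((b1.mul le_rfl hD').add ((b2.mul le_rfl b4).mul le_rfl hφ')).mono ?_
  calc k * (E * τ * D') + k * (k * ((E + 1) * (P * (τ * D'))) * B)
      = (k * E + k * (k * ((E + 1) * P) * B)) * τ * D' := by ring
    _ ≤ _ := by gcongr

/-- The result `e^{-i τ (W + α |φ|²)} φ` of the potential step. -/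
noncomputable def stepFlow (α τ : ℝ) (W φ : HOne L) : HOne L :=
  expH ((τ : ℂ) • stepGen α W φ) * φ

/-- The potential step preserves the modulus, hence the generator. -/
theorem stepGen_stepFlow {α τ : ℝ} {W : HOne L} (hW : star W = W) (φ : HOne L) :
    stepGen α W (stepFlow α τ W φ) = stepGen α W φ := by
  have h1 : star ((τ : ℂ) • stepGen α W φ) = -((τ : ℂ) • stepGen α W φ) := by
    rw [star_smul, star_stepGen hW, smul_neg]; simp
  have h2 : expH ((τ : ℂ) • stepGen α W φ) * expH (star ((τ : ℂ) • stepGen α W φ)) = 1 := by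
    rw [h1, ← expH_add, add_neg_cancel, expH_zero]
  have h3 : stepFlow α τ W φ * star (stepFlow α τ W φ) = φ * star φ := by
    rw [stepFlow, star_mul, ← expH_star]
    calc _ = (expH ((τ : ℂ) • stepGen α W φ) * expH (star ((τ : ℂ) • stepGen α W φ))) *
          (φ * star φ) := by ring
      _ = _ := by rw [h2, one_mul]
  rw [stepGen, h3, stepGen]

/-- The midpoint rule for the potential step. -/
theorem exists_stepIncr_midpoint (L : ℝ) [Fact (0 < L)] (α : ℝ) {R B : ℝ} (hR : 0 ≤ R)
    (hB : 0 ≤ B) : ∃ C, 0 ≤ C ∧ ∀ (W φ : HOne L) (τ : ℝ), star W = W → 0 ≤ τ → τ ≤ 1 →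
      SobBound 1 W R → SobBound 1 φ B →
      SobBound 1 (stepIncr α τ W φ - (τ : ℂ) • nonlin α W (stepFlow α (τ / 2) W φ)) (C * τ ^ 3) ∧
      SobBound 1 (stepFlow α (τ / 2) W φ - φ - ((τ / 2 : ℝ) : ℂ) • nonlin α W φ) (C * τ ^ 2) ∧
      SobBound 1 (stepFlow α (τ / 2) W φ) C := by
  set k := algConst L 1
  have hk : 0 ≤ k := (algConst_pos L 1).le
  set g := genBound α k R B
  have hg : 0 ≤ g := genBound_nonneg hk hR hB
  set E := Real.exp (k * g)
  have hE : 0 ≤ E := Real.exp_nonneg _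
  set C₁ := k * (((k * g) ^ 3 * E + k * (g * ((k * g) ^ 2 * E))) * B)
  set C₂ := k * ((k * g) ^ 2 * E * B)
  set C₃ := k * ((k * g * E + 1) * B)
  have hC₁ : 0 ≤ C₁ := by positivity
  have hC₂ : 0 ≤ C₂ := by positivity
  have hC₃ : 0 ≤ C₃ := by positivity
  refine ⟨C₁ + C₂ + C₃, by positivity, fun W φ τ hreal h0 h1 hW hφ => ?_⟩
  have hgen := hW.stepGen le_rfl α hφ
  set x := stepGen α W φ with hx
  set h := ((τ / 2 : ℝ) : ℂ) • x with hh
  have h2 : (τ : ℂ) • x = h + h := by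
    rw [hh, ← add_smul]; congr 1; push_cast; ring
  have hτ2 : 0 ≤ τ / 2 := by linarith
  have hτ2' : τ / 2 ≤ 1 := by linarith
  have b3 := hgen.exp_smul_sub_taylor le_rfl h0 h1 (k := 3) (by norm_num)
  have b2 := hgen.exp_smul_sub_taylor le_rfl hτ2 hτ2' (k := 2) (by norm_num)
  have b1 := hgen.exp_smul_sub_taylor le_rfl hτ2 hτ2' (k := 1) (by norm_num)
  have by' := hgen.real_smul h0
  rw [h2] at b3 by'
  rw [← hh] at b2 b1
  have hb2 : (k * g) ^ 2 * E * (τ / 2) ^ 2 ≤ (k * g) ^ 2 * E * τ ^ 2 := by gcongr; linarith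
  have b2' := b2.mono hb2
  have hflow : stepFlow α (τ / 2) W φ = expH h * φ := rfl
  refine ⟨?_, ?_, ?_⟩
  · have e : stepIncr α τ W φ - (τ : ℂ) • nonlin α W (stepFlow α (τ / 2) W φ) =
        ((expH (h + h) - expTaylor 3 (h + h)) - (h + h) * (expH h - expTaylor 2 h)) * φ := by
      rw [nonlin_eq, stepGen_stepFlow hreal, ← smul_mul_assoc, ← hx, h2, hflow, stepIncr, ← hx, h2,
        expTaylor_three_add_self, expTaylor_two]
      ring
    rw [e]
    refine ((b3.sub (by'.mul le_rfl b2')).mul le_rfl hφ).mono ?_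
    calc k * (((k * g) ^ 3 * E * τ ^ 3 + k * (τ * g * ((k * g) ^ 2 * E * τ ^ 2))) * B)
        = C₁ * τ ^ 3 := by ring
      _ ≤ (C₁ + C₂ + C₃) * τ ^ 3 := by gcongr; linarith
  · have e : stepFlow α (τ / 2) W φ - φ - ((τ / 2 : ℝ) : ℂ) • nonlin α W φ =
        (expH h - expTaylor 2 h) * φ := by
      rw [nonlin_eq, ← smul_mul_assoc, ← hx, ← hh, hflow, expTaylor_two]
      ring
    rw [e]
    refine (b2'.mul le_rfl hφ).mono ?_
    calc k * ((k * g) ^ 2 * E * τ ^ 2 * B) = C₂ * τ ^ 2 := by ring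
      _ ≤ (C₁ + C₂ + C₃) * τ ^ 2 := by gcongr; linarith
  · have h3 := (b1.add SobBound.one).mul le_rfl hφ
    rw [expTaylor_one, sub_add_cancel] at h3
    rw [hflow]
    refine h3.mono ?_
    have : (k * g) ^ 1 * E * (τ / 2) ^ 1 ≤ k * g * E := by
      rw [pow_one, pow_one]; exact mul_le_of_le_one_right (by positivity) hτ2'
    calc k * (((k * g) ^ 1 * E * (τ / 2) ^ 1 + 1) * B) ≤ C₃ :=
          mul_le_mul_of_nonneg_left (mul_le_mul_of_nonneg_right (by linarith) hB) hk
      _ ≤ _ := by linarith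

theorem exists_nonlin_lipschitz (L : ℝ) [Fact (0 < L)] (α : ℝ) {R B : ℝ} (hR : 0 ≤ R)
    (hB : 0 ≤ B) : ∃ C, 0 ≤ C ∧ ∀ (W f g : HOne L) (D : ℝ), SobBound 1 W R →
      SobBound 1 f B → SobBound 1 g B → SobBound 1 (f - g) D →
      SobBound 1 (nonlin α W f - nonlin α W g) (C * D) := by
  set k := algConst L 1
  have hk : 0 ≤ k := (algConst_pos L 1).le
  refine ⟨k * R + |α| * (3 * (k * (k * (B * B)))), by positivity, fun W f g D hW hf hg hD => ?_⟩
  have e : nonlin α W f - nonlin α W g = -Complex.I • (W * (f - g) + (α : ℂ) •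
      ((f - g) * star f * f + g * star (f - g) * f + g * star g * (f - g))) := by
    have e1 : (f - g) * star f * f + g * star (f - g) * f + g * star g * (f - g) =
        f * star f * f - g * star g * g := by rw [star_sub]; ring
    rw [e1, nonlin, nonlin, ← smul_sub, smul_sub (α : ℂ)]
    congr 1
    ring
  rw [e]
  have b := (((hD.mul le_rfl hf.star).mul le_rfl hf).add
    ((hg.mul le_rfl hD.star).mul le_rfl hf)).add ((hg.mul le_rfl hg.star).mul le_rfl hD)
  refine (((hW.mul le_rfl hD).add (b.smul (α : ℂ))).smul (-Complex.I)).mono (le_of_eq ?_)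
  simp only [norm_neg, Complex.norm_I, one_mul, Complex.norm_real, Real.norm_eq_abs]
  ring

/-! ### The local error of the Strang splitting -/

/-- Over one time step, a mild solution agrees with the splitting scheme up to `O(τ³)` in `H¹`.
Both Duhamel integrals are evaluated by the midpoint rule; at the midpoint, the solution and the
half potential step differ by `O(τ²)` only. -/
theorem exists_local_error (L : ℝ) [Fact (0 < L)] (α : ℝ) {R B : ℝ} (hR : 0 ≤ R) (hB : 0 ≤ B) :
    ∃ C, 0 ≤ C ∧ ∀ (T : ℝ) (W : HOne L) (ψ : ℝ → HOne L), IsMild α T W ψ → SobBound 5 W R →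
      (∀ t ∈ Set.Icc 0 T, SobBound 5 (ψ t) B) → ∀ a τ : ℝ, 0 ≤ τ → τ ≤ 1 → a ∈ Set.Icc 0 T →
      a + τ ∈ Set.Icc 0 T →
      SobBound 1 (ψ (a + τ) - (freeFlow τ (ψ a) +
        freeFlow (τ / 2) (stepIncr α τ W (freeFlow (τ / 2) (ψ a))))) (C * τ ^ 3) := by
  obtain ⟨C₀, hC₀⟩ := exists_secondBound L α R B
  obtain ⟨C₁, hC₁0, hC₁⟩ := exists_stepIncr_midpoint L α hR hB
  obtain ⟨C₂, hC₂0, hC₂⟩ := exists_nonlin_lipschitz L α hR (B := B + C₁) (by linarith)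
  set N := cubicBound α (algConst L 1) R B
  have hN0 : 0 ≤ N := cubicBound_nonneg (algConst_pos L 1).le hR hB
  set C₃ := |C₀| + C₂ * N + C₁
  have hC₃0 : 0 ≤ C₃ := by positivity
  refine ⟨|C₀| + C₂ * C₃ + C₁, by positivity, fun T W ψ h hW hψ a τ h0 h1 ha hb => ?_⟩
  obtain ⟨-, hG⟩ := hC₀ T W ψ h hW hψ
  have hG' := hG.mono (le_abs_self C₀)
  have hW1 : SobBound 1 W R := hW.weaken (by norm_num)
  set m := a + τ / 2 with hm
  have hmT : m ∈ Set.Icc 0 T := ⟨by linarith [ha.1], by linarith [hb.2]⟩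
  have hψ1 : ∀ t ∈ Set.Icc 0 T, SobBound 1 (ψ t) B := fun t ht => (hψ t ht).weaken (by norm_num)
  have ea : m - τ / 2 = a := by rw [hm]; ring
  have eb : m + τ / 2 = a + τ := by rw [hm]; ring
  have hmid := h.midpoint hG' (t := m) (r := τ / 2) (by linarith) hmT (by rwa [ea]) (by rwa [eb])
  rw [ea, eb] at hmid
  set φ := freeFlow (τ / 2) (ψ a) with hφdef
  have hφ : SobBound 1 φ B := (hψ1 a ha).freeFlow _
  obtain ⟨s1, s2, s3⟩ := hC₁ W φ τ h.real h0 h1 hW1 hφ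
  set χ := stepFlow α (τ / 2) W φ with hχ
  -- the solution at the midpoint
  have ham : a ≤ m := by linarith
  have hema : m - a = τ / 2 := by rw [hm]; ring
  have hrect := ((h.rectangle hG'.toLipBound ham ha hmT ⟨ham, le_rfl⟩).weaken
    (σ' := 1) (by norm_num)).freeFlow m
  have hflow : ∀ f : HOne L, freeFlow m (freeFlow (-m) f) = f := fun f => by
    rw [← freeFlow_add, add_neg_cancel, freeFlow_zero]
  have hflow' : freeFlow m (freeFlow (-a) (ψ a)) = φ := by
    rw [← freeFlow_add, hφdef]; rw [← sub_eq_add_neg, hema]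
  rw [map_sub, map_sub, map_smul, hflow, hflow, hflow', hema] at hrect
  have hinc := (h.increment_bound ha hmT ham (σ := 1) (K := N) fun t ht =>
    hW1.nonlin le_rfl α (hψ1 t (Icc_subset_of_mem ha hmT ht))).freeFlow m
  rw [map_sub, hflow, hflow', hema] at hinc
  have hBle : B ≤ B + C₁ := by linarith
  have hN1 := hC₂ W (ψ m) φ _ hW1 ((hψ1 m hmT).mono hBle) (hφ.mono hBle) hinc
  have hD : SobBound 1 (ψ m - χ) (C₃ * τ ^ 2) := by
    have e : ψ m - χ = (ψ m - φ - ((τ / 2 : ℝ) : ℂ) • nonlin α W (ψ m)) +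
        ((τ / 2 : ℝ) : ℂ) • (nonlin α W (ψ m) - nonlin α W φ) -
        (χ - φ - ((τ / 2 : ℝ) : ℂ) • nonlin α W φ) := by rw [smul_sub]; abel
    rw [e]
    refine ((hrect.add (hN1.real_smul (by linarith : 0 ≤ τ / 2))).sub s2).mono ?_
    have p1 : 0 ≤ C₂ * N * τ ^ 2 := by positivity
    have p2 : 0 ≤ |C₀| * τ ^ 2 := by positivity
    have e2 : |C₀| * (τ / 2) ^ 2 + τ / 2 * (C₂ * (τ / 2 * N)) + C₁ * τ ^ 2 =
        (|C₀| * τ ^ 2) / 4 + (C₂ * N * τ ^ 2) / 4 + C₁ * τ ^ 2 := by ring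
    rw [e2]
    have e3 : C₃ * τ ^ 2 = |C₀| * τ ^ 2 + C₂ * N * τ ^ 2 + C₁ * τ ^ 2 := by ring
    linarith
  have hN2 := hC₂ W (ψ m) χ _ hW1 ((hψ1 m hmT).mono hBle) (s3.mono (by linarith)) hD
  -- transport to the end of the step
  have hend := hmid.freeFlow (a + τ)
  have f1 : freeFlow (a + τ) (freeFlow (-(a + τ)) (ψ (a + τ))) = ψ (a + τ) := by
    rw [← freeFlow_add, add_neg_cancel, freeFlow_zero]
  have f2 : freeFlow (a + τ) (freeFlow (-a) (ψ a)) = freeFlow τ (ψ a) := by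
    rw [← freeFlow_add]; congr 2; ring
  have f3 : freeFlow (a + τ) (freeFlow (-m) (nonlin α W (ψ m))) =
      freeFlow (τ / 2) (nonlin α W (ψ m)) := by
    rw [← freeFlow_add]; congr 2; rw [hm]; ring
  have f4 : 2 * (τ / 2) = τ := by ring
  rw [f4, map_sub, map_sub, map_smul, f1, f2, f3] at hend
  have e : ψ (a + τ) - (freeFlow τ (ψ a) + freeFlow (τ / 2) (stepIncr α τ W φ)) =
      (ψ (a + τ) - freeFlow τ (ψ a) - (τ : ℂ) • freeFlow (τ / 2) (nonlin α W (ψ m))) +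
      freeFlow (τ / 2) ((τ : ℂ) • (nonlin α W (ψ m) - nonlin α W χ)) -
      freeFlow (τ / 2) (stepIncr α τ W φ - (τ : ℂ) • nonlin α W χ) := by
    rw [smul_sub, map_sub, map_sub, map_smul, map_smul]; abel
  rw [e]
  refine ((hend.add ((hN2.real_smul h0).freeFlow (τ / 2))).sub (s1.freeFlow (τ / 2))).mono ?_
  have p2 : 0 ≤ |C₀| * τ ^ 3 := by positivity
  have e2 : |C₀| * (τ / 2) ^ 3 + τ * (C₂ * (C₃ * τ ^ 2)) + C₁ * τ ^ 3 =
      (|C₀| * τ ^ 3) / 8 + C₂ * C₃ * τ ^ 3 + C₁ * τ ^ 3 := by ring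
  rw [e2]
  have e3 : (|C₀| + C₂ * C₃ + C₁) * τ ^ 3 = |C₀| * τ ^ 3 + C₂ * C₃ * τ ^ 3 + C₁ * τ ^ 3 := by ring
  linarith

/-! ### Stability and the global error -/

/-- The increment form of one step of the fully discrete scheme. -/
theorem interpolate_stepFlow {M : ℕ} (hM : 0 < M) (hE : Even M) (α τ : ℝ) (W : HOne L) {f : HOne L}
    (hf : ∀ l ∉ modes M, coeff f l = 0) :
    freeFlow (τ / 2) (interpolate M (stepFlow α τ W (freeFlow (τ / 2) f))) =
      freeFlow τ f + freeFlow (τ / 2) (interpolate M (stepIncr α τ W (freeFlow (τ / 2) f))) := by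
  set φ := freeFlow (τ / 2) f with hφ
  have h1 : interpolate M φ = φ := interpolate_eq_self hM hE fun l hl => by
    rw [hφ, coeff_freeFlow, hf l hl, mul_zero]
  have h2 : stepIncr α τ W φ = stepFlow α τ W φ - φ := by rw [stepIncr, stepFlow]; ring
  have h3 : freeFlow (τ / 2) φ = freeFlow τ f := by rw [hφ, ← freeFlow_add, add_halves]
  rw [h2, interpolate_sub, h1, map_sub, h3]
  abel

/-- Convergence of the scheme for mild solutions with uniform `H^s` bounds. -/
theorem exists_global_error (L : ℝ) [Fact (0 < L)] (α : ℝ) {s T R B : ℝ} (hs : 5 ≤ s) (hT : 0 < T)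
    (hR : 0 ≤ R) (hB : 0 ≤ B) :
    ∃ τ₀ > (0 : ℝ), ∃ h₀ > (0 : ℝ), ∃ C > (0 : ℝ), ∀ (W : HOne L) (ψ : ℝ → HOne L),
      IsMild α T W ψ → SobBound s W R → (∀ t ∈ Set.Icc 0 T, SobBound s (ψ t) B) →
      ∀ τ : ℝ, 0 < τ → τ ≤ τ₀ → ∀ M : ℕ, 0 < M → Even M → 2 * L / M ≤ h₀ →
      ∀ F : ℕ → HOne L, F 0 = interpolate M (ψ 0) →
      (∀ n, F (n + 1) =
        freeFlow (τ / 2) (interpolate M (stepFlow α τ W (freeFlow (τ / 2) (F n))))) →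
      ∀ n : ℕ, n * τ ≤ T →
        SobBound 1 (F n - ψ (n * τ)) (C * (τ ^ 2 + (2 * L / M) ^ (s - 1))) := by
  have hL : 0 < L := pos_of_fact
  have hs1 : 1 ≤ s := by linarith
  obtain ⟨Cl, hCl0, hCl⟩ := exists_local_error L α hR hB
  obtain ⟨Cz, hCz0, hCz⟩ := exists_stepIncr_bound L α hs1 hR hB
  obtain ⟨CL, hCL0, hCL⟩ := exists_stepIncr_lipschitz L α hR (B := B + 1) (by linarith)
  set D := aliasConst
  have hD : 0 ≤ D := aliasConst_nonneg
  set C₀ := D * B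
  set C₁ := (D + 1) * CL
  set C₂ := D * Cz + CL * B + Cl
  have hC₀ : 0 ≤ C₀ := by positivity
  have hC₁ : 0 ≤ C₁ := by positivity
  have hC₂ : 0 ≤ C₂ := by positivity
  set K := Real.exp (C₁ * T) * (C₀ + C₂ * T) with hK
  have hK0 : 0 ≤ K := by positivity
  set δ := 1 / (2 * (K + 1)) with hδ
  have hδ0 : 0 < δ := by positivity
  have hδ1 : δ ≤ 1 := by
    rw [hδ, div_le_one (by positivity)]; linarith
  refine ⟨δ, hδ0, δ, hδ0, K + B + 1, by positivity, ?_⟩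
  intro W ψ h hW hψ τ hτ hττ M hM hE hh F hF0 hF
  have hM' : (0 : ℝ) < M := by exact_mod_cast hM
  set η := 2 * L / M with hη
  have hη0 : 0 < η := by positivity
  have hη1 : η ≤ 1 := hh.trans hδ1
  have hτ1 : τ ≤ 1 := hττ.trans hδ1
  set p := η ^ (s - 1) with hp
  have hp0 : 0 ≤ p := Real.rpow_nonneg hη0.le _
  set ε := τ ^ 2 + p with hε
  have hε0 : 0 ≤ ε := by positivity
  -- the error is small enough for the numerical solution to stay in a fixed ball of `H¹`
  have hKε : K * ε ≤ 1 := by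
    have h1 : τ ^ 2 ≤ δ := by nlinarith
    have h2 : p ≤ δ := by
      have : p ≤ η ^ (1 : ℝ) := Real.rpow_le_rpow_of_exponent_ge hη0 hη1 (by linarith)
      rw [Real.rpow_one] at this
      exact this.trans hh
    have h3 : ε ≤ 1 / (K + 1) := by
      have : δ + δ = 1 / (K + 1) := by rw [hδ]; field_simp; norm_num
      linarith
    calc K * ε ≤ K * (1 / (K + 1)) := mul_le_mul_of_nonneg_left h3 hK0
      _ ≤ 1 := by rw [mul_one_div, div_le_one (by linarith)]; linarith
  have hW1 : SobBound 1 W R := hW.weaken hs1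
  have hψ1 : ∀ t ∈ Set.Icc 0 T, SobBound 1 (ψ t) B := fun t ht => (hψ t ht).weaken hs1
  have hsupp : ∀ n, ∀ l ∉ modes M, coeff (F n) l = 0 := by
    intro n l hl
    cases n with
    | zero => rw [hF0, interpolate, coeff_interpH, if_neg hl]
    | succ n => rw [hF, coeff_freeFlow, interpolate, coeff_interpH, if_neg hl, mul_zero]
  have hmem : ∀ n : ℕ, (n : ℝ) * τ ≤ T → (n : ℝ) * τ ∈ Set.Icc 0 T := fun n hn =>
    ⟨by positivity, hn⟩
  have hbound : ∀ n : ℕ, (n : ℝ) * τ ≤ T →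
      Real.exp (C₁ * (n * τ)) * (C₀ + C₂ * (n * τ)) * ε ≤ K * ε := fun n hn => by
    rw [hK]; gcongr
  have main : ∀ n : ℕ, (n : ℝ) * τ ≤ T → SobBound 1 (F n - proj M (ψ (n * τ)))
      (Real.exp (C₁ * (n * τ)) * (C₀ + C₂ * (n * τ)) * ε) := by
    intro n
    induction n with
    | zero =>
      intro hn
      have h0 := hmem 0 hn
      simp only [Nat.cast_zero, zero_mul, mul_zero, Real.exp_zero, one_mul, add_zero] at h0 ⊢
      rw [hF0]
      refine ((hψ 0 h0).interpolate_sub_proj hM hE hη1 hs1).mono ?_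
      calc D * p * B = C₀ * p := by ring
        _ ≤ C₀ * ε := by gcongr; rw [hε]; linarith [sq_nonneg τ]
    | succ n ih =>
      intro hn1
      have e1 : ((n + 1 : ℕ) : ℝ) * τ = n * τ + τ := by push_cast; ring
      rw [e1] at hn1 ⊢
      have hn : (n : ℝ) * τ ≤ T := by linarith
      have ih' := ih hn
      set t := (n : ℝ) * τ with ht
      have htT : t ∈ Set.Icc 0 T := hmem n hn
      have ht1T : t + τ ∈ Set.Icc 0 T := ⟨by linarith [htT.1], hn1⟩
      set e := Real.exp (C₁ * t) * (C₀ + C₂ * t) * ε with he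
      have he1 : e ≤ 1 := (hbound n hn).trans hKε
      have he0 : 0 ≤ e := ih'.nonneg
      set P := proj M (ψ t) with hP
      have hPs : SobBound s P B := (hψ t htT).proj M
      have hPB : SobBound 1 P (B + 1) := (hPs.weaken hs1).mono (by linarith)
      have hFB : SobBound 1 (F n) (B + 1) := by
        have := (hPs.weaken hs1).add ih'
        rw [add_sub_cancel] at this
        exact this.mono (by linarith)
      have hψB : SobBound 1 (ψ t) (B + 1) := (hψ1 t htT).mono (by linarith)
      set φF := freeFlow (τ / 2) (F n) with hφF
      set φP := freeFlow (τ / 2) P with hφP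
      set φψ := freeFlow (τ / 2) (ψ t) with hφψ
      have hloc := hCl T W ψ h (hW.weaken hs) (fun t ht => (hψ t ht).weaken hs)
          t τ hτ.le hτ1 htT ht1T
      have d1 : SobBound 1 (φF - φP) e := by
        rw [hφF, hφP, ← map_sub]; exact ih'.freeFlow _
      have d2 : SobBound 1 (φP - φψ) (p * B) := by
        rw [hφψ, hφP, ← map_sub]
        exact (((hψ t htT).sub_proj hM hE hs1).sub_comm).freeFlow _
      have b1 := (hCL W φF φP τ e hτ.le hτ1 hW1 (hFB.freeFlow _) (hPB.freeFlow _) d1).interpolate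
        hM hE hη1
      have b2 := (hCz W φP τ hτ.le hτ1 hW (hPs.freeFlow _)).interpolate_sub_proj hM hE hη1 hs1
      have b3 := (hCL W φP φψ τ _ hτ.le hτ1 hW1 (hPB.freeFlow _) (hψB.freeFlow _) d2).proj M
      rw [interpolate_sub] at b1
      rw [proj_sub] at b3
      have key : F (n + 1) - proj M (ψ (t + τ)) =
          freeFlow τ (F n - P) +
          freeFlow (τ / 2) (interpolate M (stepIncr α τ W φF) - interpolate M (stepIncr α τ W φP)) +
          freeFlow (τ / 2) (interpolate M (stepIncr α τ W φP) - proj M (stepIncr α τ W φP)) +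
          freeFlow (τ / 2) (proj M (stepIncr α τ W φP) - proj M (stepIncr α τ W φψ)) -
          proj M (ψ (t + τ) - (freeFlow τ (ψ t) + freeFlow (τ / 2) (stepIncr α τ W φψ))) := by
        rw [hF, interpolate_stepFlow hM hE α τ W (hsupp n), ← hφF, proj_sub, proj_add,
          proj_freeFlow, proj_freeFlow, ← hP]
        simp only [map_sub]
        abel
      rw [key]
      refine (((((ih'.freeFlow τ).add (b1.freeFlow _)).add (b2.freeFlow _)).add
        (b3.freeFlow _)).sub (hloc.proj M)).mono ?_
      have hstep : e + (D + 1) * (CL * τ * e) + D * p * (Cz * τ) + CL * τ * (p * B) + Cl * τ ^ 3 ≤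
          (1 + C₁ * τ) * e + C₂ * τ * ε := by
        have : C₂ * τ * ε = D * p * (Cz * τ) + CL * τ * (p * B) + Cl * τ ^ 3 +
            (D * Cz + CL * B) * τ * τ ^ 2 + Cl * τ * p := by rw [hε]; ring
        have h1 : 0 ≤ (D * Cz + CL * B) * τ * τ ^ 2 := by positivity
        have h2 : 0 ≤ Cl * τ * p := by positivity
        rw [this]
        have h3 : (D + 1) * (CL * τ * e) = C₁ * τ * e := by ring
        linarith
      refine hstep.trans ?_
      have hexp : 1 + C₁ * τ ≤ Real.exp (C₁ * τ) := by
        rw [add_comm]; exact Real.add_one_le_exp _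
      have hexp2 : 1 ≤ Real.exp (C₁ * (t + τ)) :=
        Real.one_le_exp (mul_nonneg hC₁ ht1T.1)
      calc (1 + C₁ * τ) * e + C₂ * τ * ε
          ≤ Real.exp (C₁ * τ) * e + Real.exp (C₁ * (t + τ)) * (C₂ * τ * ε) := by
            have h1 : 0 ≤ C₂ * τ * ε := by positivity
            have h2 := mul_le_mul_of_nonneg_right hexp he0
            have h3 := mul_le_mul_of_nonneg_right hexp2 h1
            linarith
        _ = Real.exp (C₁ * (t + τ)) * (C₀ + C₂ * (t + τ)) * ε := by
            rw [he, mul_add C₁, Real.exp_add]; ring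
  intro n hn
  have hfin := ((main n hn).mono (hbound n hn)).sub ((hψ _ (hmem n hn)).sub_proj hM hE hs1)
  have e : F n - proj M (ψ (n * τ)) - (ψ (n * τ) - proj M (ψ (n * τ))) = F n - ψ (n * τ) := by abel
  rw [e] at hfin
  refine hfin.mono ?_
  have h1 : p * B ≤ B * ε := by
    rw [mul_comm]; gcongr; rw [hε]; linarith [sq_nonneg τ]
  calc K * ε + p * B ≤ K * ε + B * ε := by linarith
    _ ≤ (K + B + 1) * ε := by linarith

/-! ### Persistence of regularity -/

/-- The nonlinearity is affine in the highest norm, with constants controlled by the `H¹` norm. -/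
theorem exists_nonlin_tame (L : ℝ) [Fact (0 < L)] (α : ℝ) {κ R B : ℝ} (hκ : 0 ≤ κ) (hR : 0 ≤ R)
    (hB : 0 ≤ B) : ∃ b c, 0 ≤ b ∧ 0 ≤ c ∧ ∀ (w : ℤ → ℝ) (W f : HOne L) (Y : ℝ), IsAlgWeight w κ →
      SeqBound w (coeff W) R → SobBound 1 W R → SeqBound w (coeff f) Y → SobBound 1 f B →
      SeqBound w (coeff (nonlin α W f)) (b * Y + c) := by
  set k := κ * wienerConst L
  have hk : 0 ≤ k := mul_nonneg hκ (wienerConst_nonneg L)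
  set a := algConst L 1
  have ha : 0 ≤ a := (algConst_pos L 1).le
  refine ⟨k * R + |α| * (k * (2 * k * B * B + a * (B * B))), k * (R * B), by positivity,
    by positivity, fun w W f Y hw hW hW1 hf hf1 => ?_⟩
  have hfs : SeqBound w (coeff (star f)) Y := SeqBound.star hw.neg hf
  have h1 : SeqBound w (coeff (W * f)) (k * (R * B + R * Y)) :=
    SeqBound.mul_tame hw hκ hW hW1 hf hf1
  have h2 : SeqBound w (coeff (f * star f)) (k * (Y * B + B * Y)) :=
    SeqBound.mul_tame hw hκ hf hf1 hfs hf1.star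
  have h3 : SeqBound w (coeff (f * star f * f))
      (k * (k * (Y * B + B * Y) * B + a * (B * B) * Y)) :=
    SeqBound.mul_tame hw hκ h2 (hf1.mul le_rfl hf1.star) hf hf1
  have h4 := h3.of_le (k := |α|) (b := coeff ((α : ℂ) • (f * star f * f))) (abs_nonneg _)
    hw.nonneg fun l => by
      rw [coeff_smul, norm_mul, Complex.norm_real, Real.norm_eq_abs]; exact le_of_eq (by ring)
  refine (h1.of_le_add h4 (c := coeff (nonlin α W f)) hw.nonneg fun l => ?_).mono
    (le_of_eq (by ring))
  rw [nonlin, coeff_smul, norm_mul, norm_neg, Complex.norm_I, one_mul, coeff_add, ← mul_add]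
  exact mul_le_mul_of_nonneg_left (norm_add_le _ _) (hw.nonneg l)

/-- A mild solution that is bounded in `H¹` and starts in `H^s` stays bounded in `H^s`. For the
weights truncated at height `K` the norm is finite from the start, and the Duhamel formula
improves every exponential bound `Γ e^{βt}` to `(A' + Γ/2) e^{βt}`; hence the bound
`2 A' e^{βt}`, which does not depend on `K`. -/
theorem exists_persistence (L : ℝ) [Fact (0 < L)] (α : ℝ) {s T R B A : ℝ} (hs : 1 ≤ s) (hT : 0 ≤ T)
    (hR : 0 ≤ R) (hB : 0 ≤ B) (hA : 0 ≤ A) : ∃ B', 0 ≤ B' ∧ ∀ (W : HOne L) (ψ : ℝ → HOne L),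
      IsMild α T W ψ → SobBound s W R → SobBound s (ψ 0) A →
      (∀ t ∈ Set.Icc 0 T, SobBound 1 (ψ t) B) → ∀ t ∈ Set.Icc 0 T, SobBound s (ψ t) B' := by
  set κ : ℝ := 4 ^ (s / 2)
  have hκ : 1 ≤ κ := Real.one_le_rpow (by norm_num) (by linarith)
  obtain ⟨b, c, hb, hc, hN⟩ := exists_nonlin_tame L α (κ := κ) (zero_le_one.trans hκ) hR hB
  set β := 2 * b + 1 with hβ
  have hβ0 : 0 < β := by positivity
  set A' := A + c * T
  have hA' : 0 ≤ A' := by positivity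
  refine ⟨2 * A' * Real.exp (β * T), by positivity, fun W ψ h hW hψ0 hψ => ?_⟩
  have trunc : ∀ K : ℝ, 0 ≤ K → ∀ t ∈ Set.Icc 0 T,
      SeqBound (fun l => min (weight L s l) K) (coeff (ψ t)) (2 * A' * Real.exp (β * t)) := by
    intro K hK
    set w : ℤ → ℝ := fun l => min (weight L s l) K with hw
    have hwA : IsAlgWeight w κ :=
      (isAlgWeight_weight L (by linarith)).truncate hκ hK
    have hle : ∀ (f : HOne L) (Y : ℝ), SobBound s f Y → SeqBound w (coeff f) Y := fun f Y hf =>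
      (SeqBound.of_le hf zero_le_one hwA.nonneg fun l => by
        rw [one_mul]
        exact mul_le_mul_of_nonneg_right (min_le_left _ _) (norm_nonneg _)).mono (one_mul Y).le
    have step : ∀ Γ : ℝ, (∀ t ∈ Set.Icc 0 T, SeqBound w (coeff (ψ t)) (Γ * Real.exp (β * t))) →
        ∀ t ∈ Set.Icc 0 T, SeqBound w (coeff (ψ t)) ((A' + Γ / 2) * Real.exp (β * t)) := by
      intro Γ hΓ t ht
      have h0 : (0 : ℝ) ∈ Set.Icc 0 T := ⟨le_rfl, hT⟩
      have hΓ0 : 0 ≤ Γ := by simpa using (hΓ 0 h0).nonneg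
      have hsub := Icc_subset_of_mem h0 ht
      have hph : ∀ (r : ℝ) (f : HOne L) (Y : ℝ), SeqBound w (coeff f) Y →
          SeqBound w (coeff (freeFlow r f)) Y := fun r f Y hf =>
        (hf.of_le zero_le_one hwA.nonneg fun l => by
          rw [coeff_freeFlow, norm_mul, norm_phase, one_mul, one_mul]).mono (one_mul Y).le
      have hint := SeqBound.of_integral (w := w) ht.1
        (g := fun ρ => coeff (freeFlow (-ρ) (nonlin α W (ψ ρ))))
        (k := fun ρ => b * (Γ * Real.exp (β * ρ)) + c)
        (fun ρ hρ => hph _ _ _ (hN w W (ψ ρ) _ hwA (hle _ _ hW) (hW.weaken hs) (hΓ ρ (hsub hρ))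
          (hψ ρ (hsub hρ))))
        (fun l => (h.continuousOn_coeff l).mono hsub) (by fun_prop)
        (f := coeff (freeFlow (-t) (ψ t) - freeFlow (-0) (ψ 0)))
        (fun l => by rw [coeff_sub]; exact h.duhamel 0 h0 t ht ht.1 l)
      have hval : ∫ ρ in (0 : ℝ)..t, (b * (Γ * Real.exp (β * ρ)) + c) =
          b * Γ / β * (Real.exp (β * t) - 1) + c * t := by
        have hd : ∀ ρ ∈ Set.uIcc 0 t, HasDerivAt
            (fun ρ => b * Γ / β * Real.exp (β * ρ) + c * ρ)
            (b * (Γ * Real.exp (β * ρ)) + c) ρ := by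
          intro ρ _
          have h1 : HasDerivAt (fun ρ => Real.exp (β * ρ)) (Real.exp (β * ρ) * (β * 1)) ρ :=
            ((hasDerivAt_id ρ).const_mul β).exp
          convert! (h1.const_mul (b * Γ / β)).add ((hasDerivAt_id ρ).const_mul c) using 1
          field_simp
        rw [intervalIntegral.integral_eq_sub_of_hasDerivAt hd
          (Continuous.intervalIntegrable (by fun_prop) _ _)]
        simp only [mul_zero, Real.exp_zero]
        ring
      rw [hval] at hint
      have hsum := (hph t _ _ hint).of_le_add (hph t _ _ (hph (-0) _ _ (hle _ _ hψ0)))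
        (c := coeff (ψ t)) hwA.nonneg fun l => by
          rw [← mul_add]
          refine mul_le_mul_of_nonneg_left (le_trans (le_of_eq ?_) (norm_add_le _ _)) (hwA.nonneg l)
          rw [← coeff_add, map_sub, sub_add_cancel, ← freeFlow_add, add_neg_cancel, freeFlow_zero]
      refine hsum.mono ?_
      have h1 : 1 ≤ Real.exp (β * t) := Real.one_le_exp (mul_nonneg hβ0.le ht.1)
      have h2 : b * Γ / β ≤ Γ / 2 := by
        rw [div_le_div_iff₀ hβ0 two_pos, hβ]
        nlinarith
      have h3 : b * Γ / β * (Real.exp (β * t) - 1) ≤ Γ / 2 * Real.exp (β * t) :=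
        mul_le_mul h2 (by linarith) (by linarith) (by positivity)
      have h4 : c * t ≤ c * T := mul_le_mul_of_nonneg_left ht.2 hc
      have h5 : A' ≤ A' * Real.exp (β * t) := le_mul_of_one_le_right hA' h1
      have h6 : A' = A + c * T := rfl
      linarith
    have iter : ∀ n : ℕ, ∀ t ∈ Set.Icc 0 T, SeqBound w (coeff (ψ t))
        ((2 * A' + K * B * (1 / 2) ^ n) * Real.exp (β * t)) := by
      intro n
      induction n with
      | zero =>
        intro t ht
        have h1 : SeqBound w (coeff (ψ t)) (K * B) := (hψ t ht).of_le hK hwA.nonneg fun l => by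
          have h2 : w l ≤ K * weight L 1 l := (min_le_right _ _).trans
            (le_mul_of_one_le_right hK (one_le_weight L zero_le_one l))
          calc w l * ‖coeff (ψ t) l‖ ≤ K * weight L 1 l * ‖coeff (ψ t) l‖ := by gcongr
            _ = _ := by ring
        refine h1.mono ?_
        have h2 : 1 ≤ Real.exp (β * t) := Real.one_le_exp (mul_nonneg hβ0.le ht.1)
        have h3 : 0 ≤ K * B := by positivity
        nlinarith
      | succ n ih =>
        intro t ht
        refine (step _ ih t ht).mono (le_of_eq ?_)
        rw [pow_succ]; ring
    intro t ht
    have hlim : Tendsto (fun n : ℕ => (2 * A' + K * B * (1 / 2) ^ n) * Real.exp (β * t)) atTop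
        (𝓝 ((2 * A' + K * B * 0) * Real.exp (β * t))) :=
      ((tendsto_const_nhds.mul (tendsto_pow_atTop_nhds_zero_of_lt_one (by norm_num)
        (by norm_num))).const_add _).mul_const _
    rw [mul_zero, add_zero] at hlim
    exact SeqBound.of_tendsto (a := fun _ : ℕ => coeff (ψ t)) (.of_forall fun n => iter n t ht)
      (fun l => tendsto_const_nhds) hlim
  intro t ht
  refine ⟨by positivity, fun F => ?_⟩
  -- on a finite set of modes, a large truncation height changes nothing
  have hK : ∀ l ∈ F, weight L s l ≤ ∑ l ∈ F, weight L s l := fun l hl =>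
    Finset.single_le_sum (fun l _ => weight_nonneg L s l) hl
  have h1 := (trunc (∑ l ∈ F, weight L s l)
    (Finset.sum_nonneg fun l _ => weight_nonneg L s l) t ht).mono
    (B' := 2 * A' * Real.exp (β * T)) (by gcongr; exact ht.2)
  refine le_trans (le_of_eq (Finset.sum_congr rfl fun l hl => ?_)) (h1.2 F)
  simp only
  rw [min_eq_left (hK l hl)]

/-! ### Conservation of mass and energy -/

/-- The real part of the mean value of a function over the torus. -/
noncomputable def reMean (f : HOne L) : ℝ := (coeff f 0).re

theorem reMean_add (f g : HOne L) : reMean (f + g) = reMean f + reMean g := by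
  rw [reMean, coeff_add, Complex.add_re]; rfl

theorem reMean_sub (f g : HOne L) : reMean (f - g) = reMean f - reMean g := by
  rw [reMean, coeff_sub, Complex.sub_re]; rfl

theorem reMean_star (f : HOne L) : reMean (star f) = reMean f := by
  rw [reMean, coeff_star, neg_zero]; simp [reMean]

theorem abs_reMean_le {f : HOne L} {B : ℝ} (hf : SobBound 1 f B) : |reMean f| ≤ B := by
  have := SeqBound.term_le hf 0
  rw [weight_at_zero, one_mul] at this
  exact (Complex.abs_re_le_norm _).trans this

/-- A purely imaginary multiple of a function with real mean has mean with real part zero. -/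
theorem reMean_I_smul {f : HOne L} (hf : coeff (star f) 0 = coeff f 0) (r : ℝ) :
    reMean ((Complex.I * r) • f) = 0 := by
  rw [coeff_star, neg_zero] at hf
  have him : (coeff f 0).im = 0 := Complex.conj_eq_iff_im.1 hf
  rw [reMean, coeff_smul]
  simp [him]

theorem kinetic_symm {f g : HOne L} {A B : ℝ} (hf : SobBound 3 f A) (hg : SobBound 3 g B) :
    coeff (kinetic f * star g) 0 = coeff (f * star (kinetic g)) 0 := by
  refine (hasSum_coeff_mul (kinetic f) (star g) 0).unique ?_
  refine (hasSum_coeff_mul f (star (kinetic g)) 0).congr_fun fun k => ?_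
  rw [coeff_star, coeff_star, coeff_kinetic hf, coeff_kinetic hg]
  simp only [zero_sub, neg_neg, star_mul', Complex.star_def, Complex.conj_ofReal]
  ring

theorem kinetic_add {f g : HOne L} {A B : ℝ} (hf : SobBound 3 f A) (hg : SobBound 3 g B) :
    kinetic (f + g) = kinetic f + kinetic g :=
  HOne.ext_coeff fun l => by
    rw [coeff_kinetic (hf.add hg), coeff_add, coeff_add, coeff_kinetic hf, coeff_kinetic hg,
      mul_add]

/-- The mass density integrated over the torus. -/
noncomputable def mass (f : HOne L) : ℝ := reMean (f * star f)

/-- The energy `∫ (½ |∂ₓ f|² + W |f|² + ½ α |f|⁴)` with respect to the normalized measure on the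
torus. -/
noncomputable def energy (α : ℝ) (W f : HOne L) : ℝ :=
  reMean (kinetic f * star f + W * (f * star f) +
    ((α / 2 : ℝ) : ℂ) • (f * star f * (f * star f)))

theorem eq_of_abs_sub_le_sq {f : ℝ → ℝ} {T C : ℝ}
    (h : ∀ a ∈ Set.Icc 0 T, ∀ b ∈ Set.Icc 0 T, a ≤ b → |f b - f a| ≤ C * (b - a) ^ 2) :
    ∀ t ∈ Set.Icc 0 T, f t = f 0 := by
  intro t ht
  have key : ∀ n : ℕ, ∀ j : ℕ, j ≤ n + 1 →
      |f (j * (t / (n + 1))) - f 0| ≤ j * (C * (t / (n + 1)) ^ 2) := by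
    intro n j
    have hn : (0 : ℝ) < n + 1 := by positivity
    have hmem : ∀ i : ℕ, i ≤ n + 1 → (i : ℝ) * (t / (n + 1)) ∈ Set.Icc 0 T := fun i hi => by
      have hi' : (i : ℝ) ≤ n + 1 := by exact_mod_cast hi
      have h1 : (i : ℝ) * (t / (n + 1)) ≤ (n + 1) * (t / (n + 1)) :=
        mul_le_mul_of_nonneg_right hi' (div_nonneg ht.1 hn.le)
      rw [mul_div_cancel₀ _ hn.ne'] at h1
      exact ⟨mul_nonneg (Nat.cast_nonneg _) (div_nonneg ht.1 hn.le), h1.trans ht.2⟩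
    induction j with
    | zero => intro _; simp
    | succ j ih =>
      intro hj
      have h1 := ih (by omega)
      have hs0 : 0 ≤ t / (n + 1) := div_nonneg ht.1 hn.le
      have h2 := h _ (hmem j (by omega)) _ (hmem (j + 1) hj) (by push_cast; nlinarith)
      have e : ((j + 1 : ℕ) : ℝ) * (t / (n + 1)) - j * (t / (n + 1)) = t / (n + 1) := by
        push_cast; ring
      rw [e] at h2
      calc _ ≤ |f ((j + 1 : ℕ) * (t / (n + 1))) - f (j * (t / (n + 1)))| +
            |f (j * (t / (n + 1))) - f 0| := abs_sub_le _ _ _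
        _ ≤ C * (t / (n + 1)) ^ 2 + j * (C * (t / (n + 1)) ^ 2) := add_le_add h2 h1
        _ = _ := by push_cast; ring
  have hbd : ∀ n : ℕ, |f t - f 0| ≤ C * t ^ 2 * (1 / ((n : ℝ) + 1)) := fun n => by
    have hn : (0 : ℝ) < n + 1 := by positivity
    have h1 := key n (n + 1) le_rfl
    have e : ((n + 1 : ℕ) : ℝ) * (t / (n + 1)) = t := by push_cast; field_simp
    rw [e] at h1
    refine h1.trans (le_of_eq ?_)
    push_cast; field_simp
  have hlim := tendsto_one_div_add_atTop_nhds_zero_nat (𝕜 := ℝ) |>.const_mul (C * t ^ 2)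
  rw [mul_zero] at hlim
  have h0 := ge_of_tendsto' hlim hbd
  exact sub_eq_zero.1 (abs_eq_zero.1 (le_antisymm h0 (abs_nonneg _)))

/-- First order Taylor expansion of a mild solution in time. -/
theorem IsMild.exists_taylor {α T R B : ℝ} {W : HOne L} {ψ : ℝ → HOne L} (h : IsMild α T W ψ)
    (hW : SobBound 5 W R) (hψ : ∀ t ∈ Set.Icc 0 T, SobBound 5 (ψ t) B) :
    ∃ C, (∀ a ∈ Set.Icc 0 T, ∀ b ∈ Set.Icc 0 T, SobBound 3 (ψ b - ψ a) (C * |b - a|)) ∧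
      ∀ a ∈ Set.Icc 0 T, ∀ b ∈ Set.Icc 0 T, a ≤ b →
      SobBound 1 (ψ b - ψ a + (Complex.I * (b - a : ℝ)) •
        (kinetic (ψ a) + Complex.I • nonlin α W (ψ a))) (C * (b - a) ^ 2) := by
  obtain ⟨C, hC⟩ := exists_secondBound L α R B
  obtain ⟨hψC, hG⟩ := hC T W ψ h hW hψ
  set N := cubicBound α (algConst L 5) R B
  refine ⟨|C| + |N| + 2 * |B|, fun a ha b hb => ?_, fun a ha b hb hab => ?_⟩
  · refine (hψC.lip b hb a ha).mono (mul_le_mul_of_nonneg_right ?_ (abs_nonneg _))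
    linarith [le_abs_self C, abs_nonneg N, abs_nonneg B]
  have hr : 0 ≤ b - a := sub_nonneg.2 hab
  set r := b - a with hrdef
  have hrect := ((h.rectangle hG.toLipBound hab ha hb (c := a) ⟨le_rfl, hab⟩).weaken
    (σ' := 1) (by norm_num)).freeFlow b
  have hN : SobBound 5 (nonlin α W (ψ a)) N := hW.nonlin (by norm_num) α (hψ a ha)
  have h1 := SobBound.freeFlow_sub_self (σ := 1) r (hN.weaken (by norm_num))
  have h2 := SobBound.freeFlow_taylor (σ := 1) le_rfl r ((hψ a ha).weaken (by norm_num))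
  have f1 : freeFlow b (freeFlow (-b) (ψ b)) = ψ b := by
    rw [← freeFlow_add, add_neg_cancel, freeFlow_zero]
  have f2 : ∀ f : HOne L, freeFlow b (freeFlow (-a) f) = freeFlow r f := fun f => by
    rw [← freeFlow_add, ← sub_eq_add_neg]
  rw [map_sub, map_sub, map_smul, f1, f2, f2, ← hrdef] at hrect
  have e : ψ b - ψ a + (Complex.I * (r : ℝ)) •
      (kinetic (ψ a) + Complex.I • nonlin α W (ψ a)) =
      (ψ b - freeFlow r (ψ a) - (r : ℂ) • freeFlow r (nonlin α W (ψ a))) +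
      (r : ℂ) • (freeFlow r (nonlin α W (ψ a)) - nonlin α W (ψ a)) +
      (freeFlow r (ψ a) - ψ a + (Complex.I * r) • kinetic (ψ a)) := by
    have e1 : (Complex.I * (r : ℂ)) • Complex.I • nonlin α W (ψ a) =
        -((r : ℂ) • nonlin α W (ψ a)) := by
      rw [smul_smul, mul_right_comm, Complex.I_mul_I, neg_one_mul, neg_smul]
    rw [smul_add, e1, smul_sub]
    abel
  rw [e]
  refine ((hrect.add (h1.real_smul hr)).add h2).mono ?_
  rw [abs_of_nonneg hr]
  have e2 : C * r ^ 2 + r * (r * N) + 2 * r ^ 2 * B = (C + N + 2 * B) * r ^ 2 := by ring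
  rw [e2]
  refine mul_le_mul_of_nonneg_right ?_ (sq_nonneg r)
  linarith [le_abs_self C, le_abs_self N, le_abs_self B]

/-- The energy gradient `-½ ∂ₓ² f + W f + α |f|² f`. -/
noncomputable def hamiltonian (α : ℝ) (W f : HOne L) : HOne L :=
  kinetic f + Complex.I • nonlin α W f

theorem hamiltonian_eq (α : ℝ) (W f : HOne L) :
    hamiltonian α W f = kinetic f + (W * f + (α : ℂ) • (f * star f * f)) := by
  rw [hamiltonian, nonlin, smul_smul]
  simp

theorem star_density (f : HOne L) : star (f * star f) = f * star f := by
  rw [star_mul, star_star]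

theorem reMean_comm_star (f g : HOne L) : reMean (f * star g) = reMean (g * star f) := by
  rw [← reMean_star, star_mul, star_star]

theorem hamiltonian_mul_star_symm {α : ℝ} {W f : HOne L} {B : ℝ} (hW : star W = W)
    (hf : SobBound 3 f B) : coeff (star (hamiltonian α W f * star f)) 0 =
      coeff (hamiltonian α W f * star f) 0 := by
  have e1 : hamiltonian α W f * star f = kinetic f * star f +
      (W * (f * star f) + (α : ℂ) • (f * star f * (f * star f))) := by
    rw [hamiltonian_eq, add_mul, add_mul, smul_mul_assoc]
    ring_nf
  have e2 : star (W * (f * star f) + (α : ℂ) • (f * star f * (f * star f))) =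
      W * (f * star f) + (α : ℂ) • (f * star f * (f * star f)) := by
    rw [star_add, star_smul, star_mul, star_mul (f * star f), star_density, hW]
    simp [mul_comm]
  have e3 : star (kinetic f * star f) = f * star (kinetic f) := by rw [star_mul, star_star]
  rw [e1, star_add, e2, e3]
  simp only [coeff_add]
  rw [kinetic_symm hf hf]

/-- Mass is conserved: to first order in time, `ψ` changes by `-i` times the energy gradient, whose
pairing with `ψ` is real, so that the mass changes to second order only. -/
theorem IsMild.mass_eq {α T R B : ℝ} {W : HOne L} {ψ : ℝ → HOne L} (h : IsMild α T W ψ)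
    (hW : SobBound 5 W R) (hψ : ∀ t ∈ Set.Icc 0 T, SobBound 5 (ψ t) B) :
    ∀ t ∈ Set.Icc 0 T, mass (ψ t) = mass (ψ 0) := by
  obtain ⟨C, hC1, hC2⟩ := h.exists_taylor hW hψ
  set k := algConst L 1
  refine eq_of_abs_sub_le_sq (f := fun t => mass (ψ t)) (C := 2 * (k * (C * B)) + k * (C * C))
    fun a ha b hb hab => ?_
  set r := b - a with hr
  set u := ψ a
  set D := ψ b - u with hD
  set ε := D + (Complex.I * (r : ℝ)) • hamiltonian α W u with hε
  have hDb : SobBound 1 D (C * r) := by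
    have := (hC1 a ha b hb).weaken (σ' := 1) (by norm_num)
    rwa [← hr, abs_of_nonneg (sub_nonneg.2 hab)] at this
  have hεb : SobBound 1 ε (C * r ^ 2) := hC2 a ha b hb hab
  have hu : SobBound 1 u B := (hψ a ha).weaken (by norm_num)
  have e1 : mass (ψ b) - mass u = 2 * reMean (D * star u) + reMean (D * star D) := by
    have e2 : ψ b * star (ψ b) = u * star u + D * star u + u * star D + D * star D := by
      have : ψ b = u + D := by rw [hD]; abel
      rw [this, star_add]; ring
    rw [mass, mass, e2, reMean_add, reMean_add, reMean_add, reMean_comm_star u D]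
    ring
  have e2 : reMean (D * star u) = reMean (ε * star u) := by
    have : D * star u = ε * star u - (Complex.I * (r : ℝ)) • (hamiltonian α W u * star u) := by
      rw [hε, add_mul, smul_mul_assoc, add_sub_cancel_right]
    rw [this, reMean_sub, reMean_I_smul
      (hamiltonian_mul_star_symm h.real ((hψ a ha).weaken (by norm_num))), sub_zero]
  rw [e1, e2]
  have b1 := abs_reMean_le (hεb.mul le_rfl hu.star)
  have b2 := abs_reMean_le (hDb.mul le_rfl hDb.star)
  calc |2 * reMean (ε * star u) + reMean (D * star D)|
      ≤ 2 * |reMean (ε * star u)| + |reMean (D * star D)| := by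
        refine (abs_add_le _ _).trans ?_
        rw [abs_mul, abs_two]
    _ ≤ 2 * (k * (C * r ^ 2 * B)) + k * (C * r * (C * r)) := by linarith
    _ = _ := by ring

/-- Energy is conserved: its first variation in the direction of `-i` times its own gradient
vanishes, so that it changes to second order in time only. -/
theorem IsMild.energy_eq {α T R B : ℝ} {W : HOne L} {ψ : ℝ → HOne L} (h : IsMild α T W ψ)
    (hW : SobBound 5 W R) (hψ : ∀ t ∈ Set.Icc 0 T, SobBound 5 (ψ t) B) :
    ∀ t ∈ Set.Icc 0 T, energy α W (ψ t) = energy α W (ψ 0) := by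
  obtain ⟨C, hC1, hC2⟩ := h.exists_taylor hW hψ
  set k := algConst L 1
  set N := cubicBound α k R B
  set E := k * (C * B) + k * (B * C) + k * (C * (B + B))
  refine eq_of_abs_sub_le_sq (f := fun t => energy α W (ψ t))
    (C := 2 * (k * ((B + N) * C)) + k * (C * C) + k * (R * (k * (C * C))) +
      |α| * (k * (k * (B * B) * (k * (C * C)))) + |α / 2| * (k * (E * E)))
    fun a ha b hb hab => ?_
  set r := b - a with hr
  set u := ψ a
  set D := ψ b - u with hD
  set X := hamiltonian α W u with hX
  set ε := D + (Complex.I * (r : ℝ)) • X with hε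
  have hr0 : 0 ≤ r := sub_nonneg.2 hab
  have hD3 : SobBound 3 D (C * r) := by
    have := hC1 a ha b hb
    rwa [← hr, abs_of_nonneg hr0] at this
  have hDb : SobBound 1 D (C * r) := hD3.weaken (by norm_num)
  have hDB : SobBound 1 D (B + B) := ((hψ b hb).sub (hψ a ha)).weaken (by norm_num)
  have hεb : SobBound 1 ε (C * r ^ 2) := hC2 a ha b hb hab
  have hu5 := hψ a ha
  have hu3 : SobBound 3 u B := hu5.weaken (by norm_num)
  have hu : SobBound 1 u B := hu5.weaken (by norm_num)
  have hW1 : SobBound 1 W R := hW.weaken (by norm_num)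
  have hkD : SobBound 1 (kinetic D) (C * r) := SobBound.kinetic le_rfl (hD3.weaken (by norm_num))
  have hXb : SobBound 1 X (B + N) := by
    have h1 := (SobBound.kinetic le_rfl (hu3.weaken (by norm_num))).add
      ((hW1.nonlin le_rfl α hu).smul Complex.I)
    rwa [Complex.norm_I, one_mul] at h1
  set η := D * star u + u * star D + D * star D with hη
  have hηb : SobBound 1 η (E * r) :=
    (((hDb.mul le_rfl hu.star).add (hu.mul le_rfl hDb.star)).add
      (hDb.mul le_rfl hDB.star)).mono (le_of_eq (by ring))
  have hψb : ψ b = u + D := by rw [hD]; abel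
  -- expansion of the energy at `ψ b = u + D`
  have c1 : reMean (kinetic (ψ b) * star (ψ b)) = reMean (kinetic u * star u) +
      2 * reMean (kinetic u * star D) + reMean (kinetic D * star D) := by
    have e : kinetic (ψ b) * star (ψ b) = kinetic u * star u + kinetic D * star u +
        kinetic u * star D + kinetic D * star D := by
      rw [hψb, kinetic_add hu3 hD3, star_add]; ring
    have e2 : reMean (kinetic D * star u) = reMean (kinetic u * star D) := by
      rw [reMean, kinetic_symm hD3 hu3, ← reMean, reMean_comm_star]
    rw [e, reMean_add, reMean_add, reMean_add, e2]; ring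
  have hdens : ψ b * star (ψ b) = u * star u + η := by rw [hψb, star_add, hη]; ring
  have c2 : reMean (W * (ψ b * star (ψ b))) = reMean (W * (u * star u)) +
      2 * reMean (W * u * star D) + reMean (W * (D * star D)) := by
    have e : W * (ψ b * star (ψ b)) = W * (u * star u) + star (W * u * star D) +
        W * u * star D + W * (D * star D) := by
      have e2 : star (W * u * star D) = W * (D * star u) := by
        rw [star_mul, star_mul, star_star, h.real]; ring
      rw [hdens, e2, hη]; ring
    rw [e, reMean_add, reMean_add, reMean_add, reMean_star]; ring
  have c3 : reMean (((α / 2 : ℝ) : ℂ) • (ψ b * star (ψ b) * (ψ b * star (ψ b)))) =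
      reMean (((α / 2 : ℝ) : ℂ) • (u * star u * (u * star u))) +
      2 * reMean ((α : ℂ) • (u * star u * u) * star D) +
      reMean ((α : ℂ) • (u * star u * (D * star D))) +
      reMean (((α / 2 : ℝ) : ℂ) • (η * η)) := by
    set q := (α : ℂ) • (u * star u * u) * star D with hq
    have e2 : star q = (α : ℂ) • (u * star u * (D * star u)) := by
      rw [hq, smul_mul_assoc, star_smul, star_mul, star_mul, star_density, star_star]
      simp only [Complex.star_def, Complex.conj_ofReal]
      congr 1; ring
    have e : ((α / 2 : ℝ) : ℂ) • (ψ b * star (ψ b) * (ψ b * star (ψ b))) =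
        ((α / 2 : ℝ) : ℂ) • (u * star u * (u * star u)) + star q + q +
        (α : ℂ) • (u * star u * (D * star D)) + ((α / 2 : ℝ) : ℂ) • (η * η) := by
      have e3 : (α : ℂ) = ((α / 2 : ℝ) : ℂ) + ((α / 2 : ℝ) : ℂ) := by push_cast; ring
      have e4 : star q + q + (α : ℂ) • (u * star u * (D * star D)) =
          ((α / 2 : ℝ) : ℂ) • (u * star u * η + u * star u * η) := by
        rw [smul_add, ← add_smul, ← e3, e2, hq, smul_mul_assoc, ← smul_add, ← smul_add]
        congr 1
        rw [hη]; ring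
      have e5 : ψ b * star (ψ b) * (ψ b * star (ψ b)) = u * star u * (u * star u) +
          (u * star u * η + u * star u * η) + η * η := by rw [hdens]; ring
      rw [e5, smul_add, smul_add, ← e4]
      abel
    rw [e, reMean_add, reMean_add, reMean_add, reMean_add, reMean_star]; ring
  have c4 : reMean (X * star D) = reMean (kinetic u * star D) + reMean (W * u * star D) +
      reMean ((α : ℂ) • (u * star u * u) * star D) := by
    rw [← reMean_add, ← reMean_add, hX, hamiltonian_eq]
    congr 1; ring
  have hden : energy α W (ψ b) - energy α W u = 2 * reMean (X * star D) +
      reMean (kinetic D * star D) + reMean (W * (D * star D)) +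
      reMean ((α : ℂ) • (u * star u * (D * star D))) +
      reMean (((α / 2 : ℝ) : ℂ) • (η * η)) := by
    rw [energy, energy, reMean_add, reMean_add, reMean_add, reMean_add, c1, c2, c3, c4]; ring
  -- the linear part vanishes to first order, since `D` is `-i r` times the energy gradient
  have c5 : reMean (X * star D) = reMean (X * star ε) := by
    have e : X * star D = X * star ε + (Complex.I * (r : ℝ)) • (X * star X) := by
      rw [hε, star_add, star_smul, mul_add, mul_smul_comm]
      simp [add_assoc]
    rw [e, reMean_add, reMean_I_smul (by rw [star_density]), add_zero]
  rw [hden, c5]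
  have b1 := abs_reMean_le (hXb.mul le_rfl hεb.star)
  have b2 := abs_reMean_le (hkD.mul le_rfl hDb.star)
  have hDD := hDb.mul le_rfl hDb.star
  have b3 := abs_reMean_le (hW1.mul le_rfl hDD)
  have b4 := abs_reMean_le (((hu.mul le_rfl hu.star).mul le_rfl hDD).smul (α : ℂ))
  have b5 := abs_reMean_le ((hηb.mul le_rfl hηb).smul ((α / 2 : ℝ) : ℂ))
  rw [Complex.norm_real, Real.norm_eq_abs] at b4 b5
  rw [abs_le] at *
  have e : (2 * (k * ((B + N) * C)) + k * (C * C) + k * (R * (k * (C * C))) +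
      |α| * (k * (k * (B * B) * (k * (C * C)))) + |α / 2| * (k * (E * E))) * r ^ 2 =
      2 * (k * ((B + N) * (C * r ^ 2))) + k * (C * r * (C * r)) +
      k * (R * (k * (C * r * (C * r)))) + |α| * (k * (k * (B * B) * (k * (C * r * (C * r))))) +
      |α / 2| * (k * (E * r * (E * r))) := by ring
  rw [e]
  constructor <;> linarith [b1.1, b1.2, b2.1, b2.2, b3.1, b3.2, b4.1, b4.2, b5.1, b5.2]

/-! ### The a priori bound in `H¹` -/

/-- Parseval's identity. -/
theorem hasSum_mul_star (f g : HOne L) :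
    HasSum (fun k => coeff f k * star (coeff g k)) (coeff (f * star g) 0) := by
  refine (hasSum_coeff_mul f (star g) 0).congr_fun fun k => ?_
  rw [coeff_star, zero_sub, neg_neg]

theorem hasSum_mass (f : HOne L) : HasSum (fun k => ‖coeff f k‖ ^ 2) (mass f) := by
  refine (Complex.hasSum_re (hasSum_mul_star f f)).congr_fun fun k => ?_
  rw [Complex.star_def, Complex.mul_conj']
  norm_cast

theorem hasSum_weight_sq {f : HOne L} {A : ℝ} (hf : SobBound 3 f A) :
    HasSum (fun k => (weight L 1 k * ‖coeff f k‖) ^ 2)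
      (mass f + 2 * reMean (kinetic f * star f)) := by
  have h1 := Complex.hasSum_re (hasSum_mul_star (kinetic f) f)
  refine ((hasSum_mass f).add (h1.mul_left 2)).congr_fun fun k => ?_
  rw [coeff_kinetic hf, mul_assoc, Complex.star_def, Complex.mul_conj', mul_pow, weight_sq,
    Real.rpow_one]
  have : ((freq L k ^ 2 / 2 : ℝ) : ℂ) * (‖coeff f k‖ : ℂ) ^ 2 =
      ((freq L k ^ 2 / 2 * ‖coeff f k‖ ^ 2 : ℝ) : ℂ) := by push_cast; ring
  rw [this, Complex.ofReal_re]
  ring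

theorem seqBound_sqrt {w : ℤ → ℝ} {a : ℤ → ℂ} {S : ℝ} (h : HasSum (fun k => (w k * ‖a k‖) ^ 2) S) :
    SeqBound w a (Real.sqrt S) := by
  have hS : 0 ≤ S := h.nonneg fun _ => sq_nonneg _
  refine ⟨Real.sqrt_nonneg _, fun F => ?_⟩
  rw [Real.sq_sqrt hS]
  exact sum_le_hasSum F (fun _ _ => sq_nonneg _) h

theorem abs_reMean_mul_density_le (g f : HOne L) :
    |reMean (g * (f * star f))| ≤ ‖(g : C(Torus L, ℂ))‖ * mass f := by
  have e0 : ∀ u : HOne L, coeff u 0 = ∫ x : Torus L, (u : C(Torus L, ℂ)) x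
      ∂AddCircle.haarAddCircle := fun u => by
    rw [coeff_apply, fourierCoeff]; simp
  have e1 : mass f = ∫ x : Torus L, ‖(f : C(Torus L, ℂ)) x‖ ^ 2 ∂AddCircle.haarAddCircle := by
    rw [mass, reMean, e0]
    have : (fun x : Torus L => ((f * star f : HOne L) : C(Torus L, ℂ)) x) =
        fun x => ((‖(f : C(Torus L, ℂ)) x‖ ^ 2 : ℝ) : ℂ) := by
      funext x
      simp [Complex.mul_conj']
    rw [this, integral_complex_ofReal, Complex.ofReal_re]
  rw [reMean]
  refine (Complex.abs_re_le_norm _).trans ?_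
  rw [e0, e1, ← integral_const_mul]
  refine norm_integral_le_of_norm_le ?_ (.of_forall fun x => ?_)
  · have hc : Continuous fun x : Torus L =>
        ‖(g : C(Torus L, ℂ))‖ * ‖(f : C(Torus L, ℂ)) x‖ ^ 2 := by fun_prop
    exact hc.integrable_of_hasCompactSupport (HasCompactSupport.of_compactSpace _)
  · have : ‖((g * (f * star f) : HOne L) : C(Torus L, ℂ)) x‖ =
        ‖(g : C(Torus L, ℂ)) x‖ * ‖(f : C(Torus L, ℂ)) x‖ ^ 2 := by
      simp [sq]
    rw [this]
    exact mul_le_mul_of_nonneg_right (ContinuousMap.norm_coe_le_norm _ x) (sq_nonneg _)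

/-- Conservation of mass and energy bounds the `H¹` norm, whatever the sign of `α`: the quartic
term is controlled by the mass and a small multiple of the `H¹` norm. -/
theorem exists_apriori (L : ℝ) [Fact (0 < L)] (α : ℝ) {R A : ℝ} (hR : 0 ≤ R) (hA : 0 ≤ A) :
    ∃ B, 0 ≤ B ∧ ∀ (T B' : ℝ) (W : HOne L) (ψ : ℝ → HOne L), IsMild α T W ψ → SobBound 5 W R →
      SobBound 5 (ψ 0) A → (∀ t ∈ Set.Icc 0 T, SobBound 5 (ψ t) B') →
      ∀ t ∈ Set.Icc 0 T, SobBound 1 (ψ t) B := by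
  have hL : 0 < L := pos_of_fact
  set k := algConst L 1
  have hk : 0 ≤ k := (algConst_pos L 1).le
  set y := |α| * A ^ 2
  have hy : 0 ≤ y := by positivity
  -- `e` is so small that half of the squared `H¹` norm absorbs the quartic part of the energy
  set e := 1 / (2 * (1 + y)) with he
  have he0 : 0 < e := by positivity
  obtain ⟨Ce, hCe0, hCe⟩ := exists_sum_norm_le_add hL he0
  set Q₀ := k * (A * A) + k * (R * (k * (A * A))) +
    |α / 2| * (k * (k * (A * A) * (k * (A * A))))
  have hQ₀ : 0 ≤ Q₀ := by positivity
  set S := 2 * (A ^ 2 + 2 * Q₀ + 2 * (wienerConst L * R * A ^ 2) + 2 * |α| * (A ^ 4 * Ce ^ 2))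
  have hw := wienerConst_nonneg L
  have hS : 0 ≤ S := by positivity
  refine ⟨Real.sqrt S, Real.sqrt_nonneg _, fun T B' W ψ h hW hψ0 hψ t ht => ?_⟩
  have hmass := h.mass_eq hW hψ t ht
  have henergy := h.energy_eq hW hψ t ht
  set f := ψ t
  have hf3 : SobBound 3 f B' := (hψ t ht).weaken (by norm_num)
  set m := mass f with hm
  have hm0 : 0 ≤ m := (hasSum_mass f).nonneg fun _ => sq_nonneg _
  have hmA : m ≤ A ^ 2 := by
    rw [hmass]
    refine hasSum_le_of_sum_le (hasSum_mass (ψ 0)) fun F => ?_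
    have := (hψ0.weaken (σ' := 0) (by norm_num)).2 F
    simpa only [weight_zero, one_mul] using this
  have hH := hasSum_weight_sq hf3
  set H := m + 2 * reMean (kinetic f * star f) with hHdef
  have hH0 : 0 ≤ H := hH.nonneg fun _ => sq_nonneg _
  have hf1 : SobBound 1 f (Real.sqrt H) := seqBound_sqrt hH
  have hf0 : SeqBound (weight L 0) (coeff f) (Real.sqrt m) :=
    seqBound_sqrt (by simpa only [weight_zero, one_mul] using hasSum_mass f)
  have hsup := norm_le_of_sum_coeff_le (hCe (coeff f) _ _ hf0 hf1)
  have hsupW := norm_le_of_sum_coeff_le ((hW.weaken (σ' := 1) (by norm_num)).sum_norm_le hL)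
  -- the initial energy
  have hQ : |energy α W (ψ 0)| ≤ Q₀ := by
    have h1 : SobBound 1 (ψ 0) A := hψ0.weaken (by norm_num)
    have h2 : SobBound 1 (kinetic (ψ 0)) A := SobBound.kinetic le_rfl (hψ0.weaken (by norm_num))
    have hd := h1.mul le_rfl h1.star
    have := abs_reMean_le (((h2.mul le_rfl h1.star).add
      ((hW.weaken (σ' := 1) (by norm_num)).mul le_rfl hd)).add
      ((hd.mul le_rfl hd).smul ((α / 2 : ℝ) : ℂ)))
    rwa [Complex.norm_real, Real.norm_eq_abs] at this
  have hWm : |reMean (W * (f * star f))| ≤ wienerConst L * R * A ^ 2 := by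
    refine (abs_reMean_mul_density_le W f).trans ?_
    exact mul_le_mul hsupW hmA hm0 (by positivity)
  have hquart : |reMean (f * star f * (f * star f))| ≤
      2 * (A ^ 4 * Ce ^ 2) + 2 * A ^ 2 * e ^ 2 * H := by
    refine (abs_reMean_mul_density_le (f * star f) f).trans ?_
    have h1 : ‖((f * star f : HOne L) : C(Torus L, ℂ))‖ ≤ ‖(f : C(Torus L, ℂ))‖ ^ 2 := by
      have h2 : ((f * star f : HOne L) : C(Torus L, ℂ)) =
          (f : C(Torus L, ℂ)) * star (f : C(Torus L, ℂ)) := rfl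
      rw [h2, sq]
      refine (norm_mul_le _ _).trans ?_
      rw [norm_star]
    have h2 : ‖(f : C(Torus L, ℂ))‖ ^ 2 ≤ 2 * (Ce ^ 2 * m) + 2 * (e ^ 2 * H) := by
      refine (pow_le_pow_left₀ (norm_nonneg _) hsup 2).trans ?_
      have h3 := Real.sq_sqrt hm0
      have h4 := Real.sq_sqrt hH0
      have h5 : (Ce * Real.sqrt m + e * Real.sqrt H) ^ 2 ≤
          2 * (Ce * Real.sqrt m) ^ 2 + 2 * (e * Real.sqrt H) ^ 2 := by
        nlinarith [sq_nonneg (Ce * Real.sqrt m - e * Real.sqrt H)]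
      rw [mul_pow, mul_pow, h3, h4] at h5
      exact h5
    calc ‖((f * star f : HOne L) : C(Torus L, ℂ))‖ * m
        ≤ (2 * (Ce ^ 2 * m) + 2 * (e ^ 2 * H)) * m := by gcongr; exact h1.trans h2
      _ ≤ (2 * (Ce ^ 2 * A ^ 2) + 2 * (e ^ 2 * H)) * A ^ 2 := by gcongr
      _ = _ := by ring
  have hsmall : 2 * y * e ^ 2 ≤ 1 / 2 := by
    rw [he, one_div, inv_pow, mul_pow, ← div_eq_mul_inv, div_le_iff₀ (by positivity)]
    nlinarith
  have hEn : energy α W f = reMean (kinetic f * star f) + reMean (W * (f * star f)) +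
      α / 2 * reMean (f * star f * (f * star f)) := by
    rw [energy, reMean_add, reMean_add]
    congr 1
    rw [reMean, coeff_smul, Complex.re_ofReal_mul, reMean]
  have hq2 : -(α * reMean (f * star f * (f * star f))) ≤
      2 * |α| * (A ^ 4 * Ce ^ 2) + 1 / 2 * H := by
    calc -(α * reMean (f * star f * (f * star f)))
        ≤ |α| * |reMean (f * star f * (f * star f))| := by
          rw [← abs_mul]; exact neg_le_abs _
      _ ≤ |α| * (2 * (A ^ 4 * Ce ^ 2) + 2 * A ^ 2 * e ^ 2 * H) := by gcongr
      _ = 2 * |α| * (A ^ 4 * Ce ^ 2) + 2 * y * e ^ 2 * H := by ring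
      _ ≤ _ := by gcongr
  have hHS : H ≤ S := by
    rw [henergy] at hEn
    have h1 := (abs_le.1 hQ).2
    have h2 := (abs_le.1 hWm).1
    have h3 : S = 2 * (A ^ 2 + 2 * Q₀ + 2 * (wienerConst L * R * A ^ 2) +
      2 * |α| * (A ^ 4 * Ce ^ 2)) := rfl
    have h4 : H = m + 2 * energy α W (ψ 0) - 2 * reMean (W * (f * star f)) -
        α * reMean (f * star f * (f * star f)) := by rw [hEn, hHdef]; ring
    linarith
  exact hf1.mono (Real.sqrt_le_sqrt hHS)

/-! ### Sobolev norms and weighted bounds -/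

theorem sqrt_two_mul_pos : 0 < Real.sqrt (2 * L) :=
  Real.sqrt_pos.2 (mul_pos two_pos (pos_of_fact (L := L)))

theorem sobolevNorm_sq (σ : ℝ) (f : Torus L → ℂ) : sobolevNorm σ f ^ 2 = ENNReal.ofReal (2 * L) *
    ∑' l, (ENNReal.ofReal (weight L σ l) * ENNReal.ofReal ‖fourierCoeff f l‖) ^ 2 := by
  have e : (1 / 2 : ℝ) * ((2 : ℕ) : ℝ) = 1 := by norm_num
  rw [sobolevNorm, ← ENNReal.rpow_natCast, ← ENNReal.rpow_mul, e, ENNReal.rpow_one]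
  congr 1
  refine tsum_congr fun l => ?_
  rw [← ENNReal.ofReal_mul (weight_nonneg L σ l), ← ENNReal.ofReal_pow
    (mul_nonneg (weight_nonneg L σ l) (norm_nonneg _)), mul_pow, weight_sq]

theorem sobolevNorm_le_iff {σ B : ℝ} (hB : 0 ≤ B) {f : Torus L → ℂ} :
    sobolevNorm σ f ≤ ENNReal.ofReal (Real.sqrt (2 * L) * B) ↔
      SeqBound (weight L σ) (fourierCoeff f) B := by
  have h2L : 0 < 2 * L := mul_pos two_pos pos_of_fact
  rw [SeqBound.iff_tsum (weight_nonneg L σ) hB, ← ENNReal.pow_le_pow_left_iff two_ne_zero,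
    sobolevNorm_sq, ENNReal.ofReal_mul (Real.sqrt_nonneg _), mul_pow,
    ← ENNReal.ofReal_pow (Real.sqrt_nonneg _), Real.sq_sqrt h2L.le]
  exact ENNReal.mul_le_mul_iff_right (by simpa using h2L) ENNReal.ofReal_ne_top

theorem seqBound_of_sobolevNorm_le {σ : ℝ} {f : Torus L → ℂ} {S : ℝ≥0∞} (hS : S < ⊤)
    (h : sobolevNorm σ f ≤ S) :
    SeqBound (weight L σ) (fourierCoeff f) (S.toReal / Real.sqrt (2 * L)) := by
  have hpos := sqrt_two_mul_pos (L := L)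
  refine (sobolevNorm_le_iff (by positivity)).1 (h.trans (le_of_eq ?_))
  rw [mul_div_cancel₀ _ hpos.ne', ENNReal.ofReal_toReal hS.ne]

open Classical in
/-- A continuous function as an element of `H¹(𝕋)`, with value `0` outside `H¹(𝕋)`. -/
noncomputable def toHOne (f : C(Torus L, ℂ)) : HOne L :=
  if h : f ∈ sobolevOne L then ⟨f, h⟩ else 0

theorem coe_toHOne {f : C(Torus L, ℂ)} {B : ℝ} (h : SeqBound (weight L 1) (fourierCoeff f) B) :
    (toHOne f : C(Torus L, ℂ)) = f := by
  have : f ∈ sobolevOne L := ⟨B, h⟩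
  rw [toHOne, dif_pos this]

theorem coe_toHOne_of_norm {f : C(Torus L, ℂ)} (h : sobolevNorm 1 f < ⊤) :
    (toHOne f : C(Torus L, ℂ)) = f :=
  coe_toHOne (seqBound_of_sobolevNorm_le h le_rfl)

theorem sobBound_toHOne {σ : ℝ} (hσ : 1 ≤ σ) {f : C(Torus L, ℂ)} {S : ℝ≥0∞} (hS : S < ⊤)
    (h : sobolevNorm σ f ≤ S) : (toHOne f : C(Torus L, ℂ)) = f ∧
      SobBound σ (toHOne f) (S.toReal / Real.sqrt (2 * L)) := by
  have h1 := seqBound_of_sobolevNorm_le hS h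
  have h2 : (toHOne f : C(Torus L, ℂ)) = f :=
    coe_toHOne ((h1.of_le zero_le_one (weight_nonneg L 1) fun l => by
      rw [one_mul]
      exact mul_le_mul_of_nonneg_right (weight_le_weight L hσ l) (norm_nonneg _)))
  refine ⟨h2, ?_⟩
  have e : coeff (toHOne f) = fourierCoeff f := by
    ext l; rw [coeff_apply, h2]
  unfold SobBound
  rwa [e]

/-- A real-valued continuous function, regarded as complex-valued. -/
def complexify (W : C(Torus L, ℝ)) : C(Torus L, ℂ) := ⟨fun x => (W x : ℂ), by fun_prop⟩

/-! ### Weak solutions are mild solutions -/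

/-- The test function `e^{-i u_n x}`. -/
noncomputable def testFun (L : ℝ) (n : ℤ) (x : ℝ) : ℂ :=
  Complex.exp ((-(Complex.I * (freq L n : ℂ))) * (x : ℂ))

theorem testFun_eq (n : ℤ) (x : ℝ) :
    testFun L n x = (fourier (-n) : C(Torus L, ℂ)) (x : Torus L) := by
  rw [fourier_coe_eq, testFun, freq_neg]
  congr 1; push_cast; ring

theorem contDiff_testFun (L : ℝ) (n : ℤ) : ContDiff ℝ ∞ (testFun L n) := by
  unfold testFun
  exact (contDiff_const.mul Complex.ofRealCLM.contDiff).cexp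

theorem periodic_testFun (n : ℤ) : Function.Periodic (testFun L n) (2 * L) := fun x => by
  rw [testFun_eq, testFun_eq, AddCircle.coe_add_period]

theorem iteratedDeriv_testFun (L : ℝ) (n : ℤ) (x : ℝ) :
    iteratedDeriv 2 (testFun L n) x = -(freq L n ^ 2 : ℝ) * testFun L n x := by
  have hd : ∀ (a : ℂ) (x : ℝ), HasDerivAt (fun x : ℝ => Complex.exp (a * (x : ℂ)))
      (a * Complex.exp (a * (x : ℂ))) x := fun a x => by
    have h1 : HasDerivAt (fun x : ℝ => a * (x : ℂ)) (a * 1) x :=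
      (Complex.ofRealCLM.hasDerivAt (x := x)).const_mul a
    convert! h1.cexp using 1
    ring
  set a : ℂ := -(Complex.I * (freq L n : ℂ)) with ha
  have h1 : deriv (testFun L n) = fun x => a * testFun L n x := by
    funext x; exact (hd a x).deriv
  rw [iteratedDeriv_succ, iteratedDeriv_one, h1]
  have h2 : HasDerivAt (fun x => a * testFun L n x) (a * (a * testFun L n x)) x :=
    (hd a x).const_mul a
  rw [h2.deriv, ← mul_assoc, ha]
  congr 1
  push_cast
  linear_combination (freq L n : ℂ) ^ 2 * Complex.I_sq

theorem integral_mul_testFun (g : C(Torus L, ℂ)) (n : ℤ) :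
    ∫ x in (-L)..L, g (x : Torus L) * testFun L n x = (2 * L : ℝ) * fourierCoeff g n := by
  have h2L : (2 * L : ℝ) ≠ 0 := (mul_pos two_pos (pos_of_fact (L := L))).ne'
  rw [fourierCoeff_eq_intervalIntegral g n (-L)]
  have e : -L + 2 * L = L := by ring
  rw [e, Complex.real_smul, ← mul_assoc, ← Complex.ofReal_mul, mul_one_div_cancel h2L,
    Complex.ofReal_one, one_mul]
  refine intervalIntegral.integral_congr fun x _ => ?_
  simp only [testFun_eq, smul_eq_mul, mul_comm]

section Solution

variable {α T : ℝ} {W : C(Torus L, ℝ)} {ψin : C(Torus L, ℂ)} {ψ : ℝ → C(Torus L, ℂ)}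

theorem IsNLSSolution.coe_toHOne (h : IsNLSSolution α T W ψin ψ) {t : ℝ} (ht : t ∈ Set.Icc 0 T) :
    (toHOne (ψ t) : C(Torus L, ℂ)) = ψ t := coe_toHOne_of_norm (h.mem t ht)

theorem coe_nonlin (W f : HOne L) : (nonlin α W f : C(Torus L, ℂ)) =
    -Complex.I • ((W : C(Torus L, ℂ)) * f +
      (α : ℂ) • ((f : C(Torus L, ℂ)) * star (f : C(Torus L, ℂ)) * f)) :=
  rfl

theorem IsNLSSolution.continuousOn (h : IsNLSSolution α T W ψin ψ) :
    ContinuousOn ψ (Set.Icc 0 T) := by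
  intro t ht
  have h1 := h.cont t ht
  rw [ContinuousWithinAt, tendsto_iff_norm_sub_tendsto_zero]
  have h2 : Tendsto (fun r => wienerConst L *
      ((sobolevNorm 1 (ψ r - ψ t)).toReal / Real.sqrt (2 * L))) (𝓝[Set.Icc 0 T] t) (𝓝 0) := by
    have h3 := (ENNReal.tendsto_toReal ENNReal.zero_ne_top).comp h1
    simpa using (h3.div_const (Real.sqrt (2 * L))).const_mul (wienerConst L)
  refine squeeze_zero' (.of_forall fun _ => norm_nonneg _) ?_ h2
  filter_upwards [h1.eventually (gt_mem_nhds ENNReal.zero_lt_top)] with r hr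
  have h4 : SobBound 1 (toHOne (ψ r - ψ t)) _ :=
    (sobBound_toHOne (f := ψ r - ψ t) le_rfl hr le_rfl).2
  have h5 := norm_le_of_sum_coeff_le (h4.sum_norm_le pos_of_fact)
  rwa [coe_toHOne_of_norm (f := ψ r - ψ t) hr] at h5

theorem IsNLSSolution.exists_bound (h : IsNLSSolution α T W ψin ψ) :
    ∃ B, 0 ≤ B ∧ ∀ t ∈ Set.Icc 0 T, SobBound 1 (toHOne (ψ t)) B := by
  have key : ∃ B, 0 ≤ B ∧ ∀ t ∈ Set.Icc 0 T, t ∈ Set.Icc 0 T → SobBound 1 (toHOne (ψ t)) B := by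
    refine isCompact_Icc.induction_on (s := Set.Icc 0 T)
      (p := fun S => ∃ B, 0 ≤ B ∧ ∀ t ∈ S, t ∈ Set.Icc 0 T → SobBound 1 (toHOne (ψ t)) B)
      ⟨0, le_rfl, by simp⟩ ?_ ?_ ?_
    · rintro S S' hS ⟨B, hB0, hB⟩
      exact ⟨B, hB0, fun t ht => hB t (hS ht)⟩
    · rintro S S' ⟨B, hB0, hB⟩ ⟨B', hB0', hB'⟩
      refine ⟨max B B', hB0.trans (le_max_left _ _), ?_⟩
      rintro t (ht | ht) htT
      · exact (hB t ht htT).mono (le_max_left _ _)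
      · exact (hB' t ht htT).mono (le_max_right _ _)
    · intro t ht
      refine ⟨{r | sobolevNorm 1 (ψ r - ψ t) < 1},
        (h.cont t ht).eventually (gt_mem_nhds one_pos), ?_⟩
      have h1 := (sobBound_toHOne le_rfl (h.mem t ht) le_rfl).2
      refine ⟨(sobolevNorm 1 (ψ t)).toReal / Real.sqrt (2 * L) +
          (1 : ℝ≥0∞).toReal / Real.sqrt (2 * L),
        add_nonneg h1.nonneg (div_nonneg ENNReal.toReal_nonneg (Real.sqrt_nonneg _)),
        fun r hr hrT => ?_⟩
      have h2 := sobBound_toHOne (f := ψ r - ψ t) le_rfl ENNReal.one_lt_top (le_of_lt hr)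
      have e : toHOne (ψ r) = toHOne (ψ t) + toHOne (ψ r - ψ t) := by
        apply Subtype.ext
        have e1 : ((toHOne (ψ t) + toHOne (ψ r - ψ t) : HOne L) : C(Torus L, ℂ)) =
            (toHOne (ψ t) : C(Torus L, ℂ)) + (toHOne (ψ r - ψ t) : C(Torus L, ℂ)) := rfl
        rw [e1, h2.1, h.coe_toHOne ht, h.coe_toHOne hrT]
        abel
      rw [e]
      exact h1.add h2.2
  obtain ⟨B, hB0, hB⟩ := key
  exact ⟨B, hB0, fun t ht => hB t ht ht⟩

/-- The ordinary differential equation for the Fourier coefficients of a weak solution. -/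
theorem IsNLSSolution.hasDerivWithinAt_coeff (h : IsNLSSolution α T W ψin ψ)
    (hW : (toHOne (complexify W) : C(Torus L, ℂ)) = complexify W) (n : ℤ) {t : ℝ}
    (ht : t ∈ Set.Icc 0 T) :
    HasDerivWithinAt (fun r => fourierCoeff (ψ r) n)
      (-Complex.I * (((freq L n ^ 2 / 2 : ℝ) : ℂ) * fourierCoeff (ψ t) n) +
        coeff (nonlin α (toHOne (complexify W)) (toHOne (ψ t))) n) (Set.Icc 0 T) t := by
  have h2L : ((2 * L : ℝ) : ℂ) ≠ 0 := by
    exact_mod_cast (mul_pos two_pos (pos_of_fact (L := L))).ne'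
  have h1 := h.eqn (testFun L n) (contDiff_testFun L n) (periodic_testFun n) t ht
  simp only [integral_mul_testFun] at h1
  have h3 := h1.const_mul (((2 * L : ℝ) : ℂ)⁻¹)
  simp only [inv_mul_cancel_left₀ h2L] at h3
  convert! h3 using 1
  set N : C(Torus L, ℂ) := complexify W * ψ t + (α : ℂ) • (ψ t * star (ψ t) * ψ t) with hN
  have e1 : coeff (nonlin α (toHOne (complexify W)) (toHOne (ψ t))) n =
      -Complex.I * fourierCoeff N n := by
    rw [coeff_apply, coe_nonlin, hW, h.coe_toHOne ht, ← hN, ← coeffCLM_apply, map_smul,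
      smul_eq_mul, coeffCLM_apply]
  have e2 : ∀ x : ℝ, -(1 / 2) * ψ t (x : Torus L) * iteratedDeriv 2 (testFun L n) x +
      ((W (x : Torus L) : ℂ) * ψ t (x : Torus L) +
        (α : ℂ) * (‖ψ t (x : Torus L)‖ : ℂ) ^ 2 * ψ t (x : Torus L)) * testFun L n x =
      (((freq L n ^ 2 / 2 : ℝ) : ℂ) • ψ t + N : C(Torus L, ℂ)) (x : Torus L) * testFun L n x := by
    intro x
    have h4 : N (x : Torus L) = (W (x : Torus L) : ℂ) * ψ t (x : Torus L) +
        (α : ℂ) * (‖ψ t (x : Torus L)‖ : ℂ) ^ 2 * ψ t (x : Torus L) := by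
      rw [hN, ← Complex.mul_conj']
      simp [complexify]
      ring
    rw [iteratedDeriv_testFun, ContinuousMap.add_apply, ContinuousMap.smul_apply, h4, smul_eq_mul]
    push_cast
    ring
  rw [intervalIntegral.integral_congr fun x _ => e2 x, integral_mul_testFun,
    ← coeffCLM_apply n (_ + N), map_add, map_smul, coeffCLM_apply, coeffCLM_apply, smul_eq_mul, e1]
  field_simp
  ring

theorem IsNLSSolution.isMild (h : IsNLSSolution α T W ψin ψ)
    (hW : (toHOne (complexify W) : C(Torus L, ℂ)) = complexify W) :
    IsMild α T (toHOne (complexify W)) (fun t => toHOne (ψ t)) := by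
  have hcont : ∀ l, ContinuousOn
      (fun t => coeff (nonlin α (toHOne (complexify W)) (toHOne (ψ t))) l) (Set.Icc 0 T) := by
    intro l
    have h1 := h.continuousOn
    have h2 : ContinuousOn (fun t => coeffCLM l (-Complex.I • (complexify W * ψ t +
        (α : ℂ) • (ψ t * star (ψ t) * ψ t)))) (Set.Icc 0 T) :=
      (coeffCLM l).continuous.comp_continuousOn (by fun_prop)
    refine h2.congr fun t ht => ?_
    rw [coeff_apply, coe_nonlin, hW, h.coe_toHOne ht]
    exact (coeffCLM_apply _ _).symm
  refine ⟨?_, hcont, fun a ha b hb hab l => ?_⟩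
  · apply Subtype.ext
    have e : ((star (toHOne (complexify W)) : HOne L) : C(Torus L, ℂ)) =
        star (toHOne (complexify W) : C(Torus L, ℂ)) := rfl
    rw [e, hW]
    ext x
    simp [complexify]
  · have hsub := Icc_subset_of_mem ha hb
    have hphase : ∀ t : ℝ, HasDerivAt (fun t => phase L (-t) l)
        (phase L (-t) l * (Complex.I * ((freq L l ^ 2 / 2 : ℝ) : ℂ))) t := fun t => by
      have h1 : HasDerivAt (fun t : ℝ => (Complex.I * ((freq L l ^ 2 / 2 : ℝ) : ℂ)) * (t : ℂ))
          ((Complex.I * ((freq L l ^ 2 / 2 : ℝ) : ℂ)) * 1) t :=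
        (Complex.ofRealCLM.hasDerivAt (x := t)).const_mul _
      have e : ∀ t : ℝ, phase L (-t) l =
          Complex.exp ((Complex.I * ((freq L l ^ 2 / 2 : ℝ) : ℂ)) * (t : ℂ)) := fun t => by
        rw [phase]; congr 1; push_cast; ring
      simp only [e]
      convert! h1.cexp using 1
      rw [mul_one]
    have hderiv : ∀ t ∈ Set.Icc 0 T, HasDerivWithinAt
        (fun t => phase L (-t) l * fourierCoeff (ψ t) l)
        (phase L (-t) l * coeff (nonlin α (toHOne (complexify W)) (toHOne (ψ t))) l)
        (Set.Icc 0 T) t := fun t ht => by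
      convert! (hphase t).hasDerivWithinAt.mul (h.hasDerivWithinAt_coeff hW l ht) using 1
      ring
    have hval : ∀ t ∈ Set.Icc 0 T, coeff (freeFlow (-t) (toHOne (ψ t))) l =
        phase L (-t) l * fourierCoeff (ψ t) l := fun t ht => by
      rw [coeff_freeFlow, coeff_apply, h.coe_toHOne ht]
    rw [hval a ha, hval b hb]
    simp only [coeff_freeFlow]
    refine (intervalIntegral.integral_eq_sub_of_hasDerivAt_of_le hab
      (fun t ht => ((hderiv t (hsub ht)).continuousWithinAt).mono hsub) (fun t ht => ?_) ?_).symm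
    · exact (hderiv t (hsub (Set.Ioo_subset_Icc_self ht))).hasDerivAt
        (mem_of_superset (Icc_mem_nhds ht.1 ht.2) hsub)
    · refine ContinuousOn.intervalIntegrable_of_Icc hab ?_
      exact ((continuous_phase L l).comp continuous_neg).continuousOn.mul ((hcont l).mono hsub)

end Solution

/-! ### The scheme in terms of interpolants -/

theorem kineticHalfStep_eq (τ : ℝ) {M : ℕ} (φ : Fin M → ℂ) :
    kineticHalfStep L τ φ =
      gridValues M (freeFlow (τ / 2) (interpH φ : HOne L) : C(Torus L, ℂ)) := by
  funext k
  rw [gridValues, apply_eq_sum_modes (M := M) (fun l hl => by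
    rw [coeff_freeFlow, coeff_interpH, if_neg hl, mul_zero]), kineticHalfStep]
  refine Finset.sum_congr rfl fun l hl => ?_
  rw [coeff_freeFlow, coeff_interpH, if_pos hl, fourier_coe_eq, phase]
  have e1 : freq L l ^ 2 * τ / 4 = freq L l ^ 2 * (τ / 2) / 2 := by ring
  have e2 : Complex.exp (Complex.I * ((freq L l * (gridPoint L M k + L) : ℝ) : ℂ)) =
      Complex.exp (Complex.I * ((freq L l * L : ℝ) : ℂ)) *
        Complex.exp (Complex.I * ((freq L l * gridPoint L M k : ℝ) : ℂ)) := by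
    rw [← Complex.exp_add]; congr 1; push_cast; ring
  rw [e1, e2]
  ring

theorem potentialStep_gridValues (α τ : ℝ) {W : C(Torus L, ℝ)}
    (hW : (toHOne (complexify W) : C(Torus L, ℂ)) = complexify W) {M : ℕ} (f : HOne L) :
    potentialStep α τ W (gridValues M (f : C(Torus L, ℂ))) =
      gridValues M (stepFlow α τ (toHOne (complexify W)) f : C(Torus L, ℂ)) := by
  funext k
  rw [gridValues, potentialStep, gridValues, stepFlow]
  set x : Torus L := (gridPoint L M k : Torus L)
  have e1 : ((expH ((τ : ℂ) • stepGen α (toHOne (complexify W)) f) * f : HOne L) :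
      C(Torus L, ℂ)) x = Complex.exp ((((τ : ℂ) • stepGen α (toHOne (complexify W)) f : HOne L) :
        C(Torus L, ℂ)) x) * (f : C(Torus L, ℂ)) x := by
    rw [← expH_apply]; rfl
  have e2 : (((τ : ℂ) • stepGen α (toHOne (complexify W)) f : HOne L) : C(Torus L, ℂ)) x =
      (τ : ℂ) * (-Complex.I * ((toHOne (complexify W) : C(Torus L, ℂ)) x +
        α * ((f : C(Torus L, ℂ)) x * star ((f : C(Torus L, ℂ)) x)))) := rfl
  rw [e1, e2, hW, Complex.star_def, Complex.mul_conj']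
  congr 2
  simp only [complexify, ContinuousMap.coe_mk]
  push_cast
  ring

theorem interpH_tsfp_succ (α τ : ℝ) {W : C(Torus L, ℝ)}
    (hW : (toHOne (complexify W) : C(Torus L, ℂ)) = complexify W) (ψin : C(Torus L, ℂ)) {M : ℕ}
    (hM : 0 < M) (hE : Even M) (n : ℕ) :
    (interpH (tsfp α τ W ψin M (n + 1)) : HOne L) = freeFlow (τ / 2) (interpolate M
      (stepFlow α τ (toHOne (complexify W))
        (freeFlow (τ / 2) (interpH (tsfp α τ W ψin M n))))) := by
  rw [tsfp, kineticHalfStep_eq τ (tsfp α τ W ψin M n), potentialStep_gridValues α τ hW,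
    kineticHalfStep_eq]
  refine interpolate_eq_self hM hE fun l hl => ?_
  rw [coeff_freeFlow, coeff_interpH, if_neg hl, mul_zero]

/-- The empty truncation is the truncation to one term with parameter `0`. -/
theorem truncPotential_zero {ℓ : ℝ} (v₀ : C(Torus ℓ, ℝ)) (lam : ℕ → ℝ) (v : ℕ → C(Torus ℓ, ℝ))
    (ξ : Fin 0 → ℝ) : truncPotential v₀ lam v 0 ξ = truncPotential v₀ lam v 1 0 := by
  simp [truncPotential]

theorem DataAssumptions.truncPotential_le {s : ℝ} {ψin : C(Torus L, ℂ)} {v₀ : C(Torus L, ℝ)}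
    {lam : ℕ → ℝ} {v : ℕ → C(Torus L, ℝ)} {V : (ℕ → ℝ) → C(Torus L, ℝ)}
    (h : DataAssumptions s ψin v₀ lam v V) {m : ℕ} {ξ : Fin m → ℝ} (hξ : ξ ∈ paramSetTrunc m) :
    sobolevNormReal s (truncPotential v₀ lam v m ξ) ≤
      ⨆ ξ ∈ paramSet, sobolevNormReal s (V ξ) := by
  cases m with
  | zero =>
    rw [truncPotential_zero]
    refine le_trans ?_ (h.trunc_le 1 one_pos)
    exact le_iSup₂ (f := fun ξ (_ : ξ ∈ paramSetTrunc 1) =>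
      sobolevNormReal s (truncPotential v₀ lam v 1 ξ)) (0 : Fin 1 → ℝ)
      (fun j => by constructor <;> norm_num)
  | succ m =>
    refine le_trans ?_ (h.trunc_le (m + 1) m.succ_pos)
    exact le_iSup₂ (f := fun ξ (_ : ξ ∈ paramSetTrunc (m + 1)) =>
      sobolevNormReal s (truncPotential v₀ lam v (m + 1) ξ)) ξ hξ

end

end RandomNLS

theorem mainTheorem4 (L : ℝ) [Fact (0 < L)] (α s T : ℝ) (hs : 5 ≤ s) (hT : 0 < T)
    (ψin : C(Torus L, ℂ)) (v₀ : C(Torus L, ℝ)) (lam : ℕ → ℝ) (v : ℕ → C(Torus L, ℝ))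
    (V : (ℕ → ℝ) → C(Torus L, ℝ)) (hdata : DataAssumptions s ψin v₀ lam v V) :
    ∃ τ₀ > (0 : ℝ), ∃ h₀ > (0 : ℝ), ∃ C > (0 : ℝ),
      ∀ m : ℕ, ∀ ξ ∈ paramSetTrunc m, ∀ ψ : ℝ → C(Torus L, ℂ),
        IsNLSSolution α T (truncPotential v₀ lam v m ξ) ψin ψ →
        ∀ τ : ℝ, 0 < τ → τ ≤ τ₀ →
        ∀ M : ℕ, 0 < M → Even M → 2 * L / M ≤ h₀ →
        ∀ n : ℕ, n * τ ≤ T →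
          sobolevNorm 1
              (fun x => interp (tsfp α τ (truncPotential v₀ lam v m ξ) ψin M n) x - ψ (n * τ) x) ≤
            ENNReal.ofReal (C * (τ ^ 2 + (2 * L / M) ^ (s - 1))) := by
  have hL : 0 < L := Fact.out
  have hs1 : 1 ≤ s := by linarith
  have hsq := sqrt_two_mul_pos (L := L)
  -- uniform bounds for the data
  set R := (⨆ ξ ∈ paramSet, sobolevNormReal s (V ξ)).toReal / Real.sqrt (2 * L)
  set A := (sobolevNorm s ψin).toReal / Real.sqrt (2 * L)
  have hR : 0 ≤ R := div_nonneg ENNReal.toReal_nonneg hsq.le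
  have hA : 0 ≤ A := div_nonneg ENNReal.toReal_nonneg hsq.le
  obtain ⟨-, hψinA⟩ := sobBound_toHOne hs1 hdata.initial_mem le_rfl
  -- the `H¹` bound comes first, and the `H^s` bound depends on it only
  obtain ⟨B₁, hB₁, hapriori⟩ := exists_apriori L α hR hA
  obtain ⟨B, hB, hpers⟩ := exists_persistence L α hs1 hT.le hR hB₁ hA
  obtain ⟨τ₀, hτ₀, h₀, hh₀, C, hC, hmain⟩ := exists_global_error L α hs hT hR hB
  refine ⟨τ₀, hτ₀, h₀, hh₀, Real.sqrt (2 * L) * C, by positivity, ?_⟩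
  intro m ξ hξ ψ hψ τ hτ hττ M hM hE hh n hn
  set W := truncPotential v₀ lam v m ξ
  obtain ⟨hWc, hWR⟩ := sobBound_toHOne (f := complexify W) hs1 hdata.potential_mem
    (hdata.truncPotential_le hξ)
  have hmild := hψ.isMild hWc
  have hψ0 : SobBound s (toHOne (ψ 0)) A := by rw [hψ.initial]; exact hψinA
  have hψB : ∀ t ∈ Set.Icc 0 T, SobBound s (toHOne (ψ t)) B := by
    -- a first bound, depending on `ψ`, provides the regularity that the conservation laws require
    obtain ⟨B', hB', hψB'⟩ := hψ.exists_bound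
    obtain ⟨B'', -, hpers'⟩ := exists_persistence L α hs1 hT.le hR hB' hA
    have h5 := hpers' _ _ hmild hWR hψ0 hψB'
    exact hpers _ _ hmild hWR hψ0 (hapriori T B'' _ _ hmild (hWR.weaken hs) (hψ0.weaken hs)
      fun t ht => (h5 t ht).weaken hs)
  have h0T : (0 : ℝ) ∈ Set.Icc 0 T := ⟨le_rfl, hT.le⟩
  have herr := hmain _ _ hmild hWR hψB τ hτ hττ M hM hE hh
    (fun n => interpH (tsfp α τ W ψin M n))
    (by
      rw [interpolate, hψ.coe_toHOne h0T, hψ.initial]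
      rfl)
    (interpH_tsfp_succ α τ hWc ψin hM hE) n hn
  have hnT : (n : ℝ) * τ ∈ Set.Icc 0 T := ⟨by positivity, hn⟩
  have efun : (fun x => interp (tsfp α τ W ψin M n) x - ψ (n * τ) x) =
      ((interpH (tsfp α τ W ψin M n) - toHOne (ψ (n * τ)) : HOne L) : C(Torus L, ℂ)) := by
    funext x
    have e : ((interpH (tsfp α τ W ψin M n) - toHOne (ψ (n * τ)) : HOne L) : C(Torus L, ℂ)) x =
        ((interpH (tsfp α τ W ψin M n) : HOne L) : C(Torus L, ℂ)) x -
          (toHOne (ψ (n * τ)) : C(Torus L, ℂ)) x := rfl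
    rw [e, interpH_apply, hψ.coe_toHOne hnT]
  rw [efun, mul_assoc]
  exact (sobolevNorm_le_iff herr.nonneg).2 herr
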